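/- Let $d\ge 2$ and $p_d=\frac{2d-2}{d+1}$ (so $p_d>1$ exactly when $d\ge4$). For $r\ge 1$ let $\sigma_r$ be the surface measure on the sphere $\{|x|=r\}\subset\mathbb R^d$. Let $\psi_\circ$ be a radial complex-valued $C^\infty$ function on $\mathbb R^d$ supported in $\{|x|\le 1/10\}$ such that all derivatives of order less than $20d$ of its Fourier transform vanish at the origin; put $\psi=\psi_\circ*\psi_\circ$ and $F_{y,r}=\sigma_r*\psi(\cdot-y)$ for $y\in\mathbb R^d$, $r\ge1$. A set is called $1$-separated if any two distinct points of it have distance at least $1$. (i) Let $0<p<p_d$. There is a constant $C$ depending only on $d,p,\psi_\circ$ such that for all $1$-separated sets $\mathcal Y\subset\mathbb R^d$ and $\mathcal R\subset[1,\infty)$ and every $\gamma:\mathcal Y\times\mathcal R\to\mathbb C$ for which the right-hand side is finite, the sum on the left converges absolutely at every point, defines an $L^p$ function, and $$\Big\|\sum_{(y,r)\in\mathcal Y\times\mathcal R}\gamma(y,r)F_{y,r}\Big\|_{L^p(\mathbb R^d)}\le C\Big(\sum_{(y,r)\in\mathcal Y\times\mathcal R}|\gamma(y,r)|^p\,r^{d-1}\Big)^{1/p}.$$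 (ii) Let $1\le p<p_d$. There is a constant $C$ depending only on $d,p,\psi_\circ$ such that for every measurable $h:\mathbb R^d\times(1,\infty)\to\mathbb C$ for which the right-hand side is finite, the integral on the left converges absolutely at every point, defines an $L^p$ function, and $$\Big\|\int_{\mathbb R^d}\int_1^\infty h(y,r)F_{y,r}\,dr\,dy\Big\|_{L^p(\mathbb R^d)}\le C\Big(\int_{\mathbb R^d}\int_1^\infty|h(y,r)|^p\,r^{d-1}\,dr\,dy\Big)^{1/p}.$$ (iii) Let $1\le p<p_d$. There is a constant $C$ depending only on $d$ and $p$ such that for every integrable radial $m:\mathbb R^d\to\mathbb C$ vanishing outside $\{1/2<|\xi|<2\}$ whose inverse Fourier transform $K=\mathcal F^{-1}[m]$ lies in $L^p(\mathbb R^d)$, and every $f\in L^p(\mathbb R^d)$, the integral defining $K*f$ converges absolutely at every point, $K*f\in L^p(\mathbb R^d)$, and $$\|K*f\|_{L^p(\mathbb R^d)}\le C\,\|K\|_{L^p(\mathbb R^d)}\|f\|_{L^p(\mathbb R^d)}.$$ -/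

import Mathlib

open MeasureTheory Set
open scoped FourierTransform ENNReal NNReal

noncomputable section

/-- The critical exponent `p_d = (2d - 2) / (d + 1)`. -/
def critExp (d : ℕ) : ℝ := (2 * (d : ℝ) - 2) / ((d : ℝ) + 1)

/-- A function on `ℝ^d` is radial if its value at `x` depends on `|x|` only. -/
def IsRadial {d : ℕ} (f : EuclideanSpace ℝ (Fin d) → ℂ) : Prop :=
  ∀ x x' : EuclideanSpace ℝ (Fin d), ‖x‖ = ‖x'‖ → f x = f x'

/-- A radial smooth function supported in the ball of radius `1/10` about the origin whose
Fourier transform vanishes to order `20 d` at the origin. -/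
structure IsBump {d : ℕ} (ψ₀ : EuclideanSpace ℝ (Fin d) → ℂ) : Prop where
  radial : IsRadial ψ₀
  smooth : ContDiff ℝ (⊤ : ℕ∞) ψ₀
  support_subset : tsupport ψ₀ ⊆ Metric.closedBall 0 (1 / 10)
  fourier_vanish : ∀ k : ℕ, k < 20 * d → iteratedFDeriv ℝ k (𝓕 ψ₀) 0 = 0

/-- The convolution `(f * g)(x) = ∫ f(t) g(x - t) dt` of two functions on `ℝ^d`. -/
def conv {d : ℕ} (f g : EuclideanSpace ℝ (Fin d) → ℂ) : EuclideanSpace ℝ (Fin d) → ℂ :=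
  convolution f g (ContinuousLinearMap.mul ℝ ℂ) volume

/-- The surface measure `σ_r` on the sphere of radius `r` centred at the origin, as a measure on
`ℝ^d`: the image under `θ ↦ r θ` of the surface measure of the unit sphere (`Measure.toSphere`,
the one of polar coordinates), multiplied by `r^(d-1)`. -/
def sphereMeasure (d : ℕ) (r : ℝ) : Measure (EuclideanSpace ℝ (Fin d)) :=
  ENNReal.ofReal (r ^ (d - 1)) •
    ((volume : Measure (EuclideanSpace ℝ (Fin d))).toSphere).map
      (fun θ : Metric.sphere (0 : EuclideanSpace ℝ (Fin d)) 1 =>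
        r • (θ : EuclideanSpace ℝ (Fin d)))

/-- The function `F_{y,r} = σ_r * ψ(· - y)`, where `ψ = ψ₀ * ψ₀`. -/
def sphereBump {d : ℕ} (ψ₀ : EuclideanSpace ℝ (Fin d) → ℂ) (y : EuclideanSpace ℝ (Fin d)) (r : ℝ)
    (x : EuclideanSpace ℝ (Fin d)) : ℂ :=
  ∫ z, conv ψ₀ ψ₀ (x - z - y) ∂(sphereMeasure d r)

/-- Distinct points of `s` have distance at least `1`. -/
def OneSeparated {X : Type*} [PseudoMetricSpace X] (s : Set X) : Prop :=
  s.Pairwise fun a b => 1 ≤ dist a b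

end

/-! Write F_q for F_{y,r} with q = (y, r), and put a = (d-1)/2. The core is a restricted estimate
(`IsOscillatingBump.exists_lintegral_sum_le`): for d ≥ 4, a finite grid Q, coefficients with |c_q| ≤
1 and 1 ≤ s < p_d, the integral of |∑ c_q F_q|^s is at most a constant times ∑ r^(d-1). It balances
an L² bound against a bound on the support.

L² side. By Parseval ⟨F_q, F_q'⟩ is the Fourier transform, at y' - y, of a radial function, so it is
an integral containing three Fourier transforms of the unit sphere, at scales r, r' and |y' - y|.
Each decays like |ξ|^(-a), which follows from an energy argument for the Bessel-type equation. The
zero of the Fourier transform of ψ₀ at the origin absorbs the singularity, leaving (r r')^a |y -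
y'|^(-a). The product also vanishes unless the two annuli meet. If balls of radius 2^l contain
O(2^(ν+l)) points of each scale, these interactions are summable because a > 1. Cutting the radii
into blocks of length 2^N with 2^(aN) ≥ 2^ν gives a squared L² norm O(2^(ν/a) ∑ r^(d-1))
(`exists_norm_sq_sum_le`).

Support side. Each q is assigned the largest ν for which some ball around it has at least 2^(ν+l)
points of its scale. Points of level ν are crowded, so their annuli overlap heavily, and a Vitali
selection bounds the volume of the union by O(2^(-ν) ∑ r^(d-1)) (`exists_volume_densityPart_le`).
Hölder combines the two into a factor 2^(ν (s(d+1)/(2(d-1)) - 1)), which is geometrically decaying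
exactly when s < p_d.

For 1 < p < p_d the coefficients are split dyadically by size, and the restricted estimate at the
exponents 1 and some s > p is interpolated pointwise (`exists_rpow_tsum_le`); for p ≤ 1
subadditivity of t^p is enough. Fatou's lemma passes from finite sums to (i).

For (ii), ℝ^d × (1, ∞) is tiled by unit cells. For a fixed point of the base cell, its translates
form a grid to which (i) applies with a uniform constant, and one integrates over the base cell.

For (iii), choose ψ = ψ₀ * ψ₀ and a Schwartz φ whose Fourier transforms have product 1 on the
annulus, so that K * f = (K * ψ) * (φ * f). In polar coordinates the part of K outside the unit
ball, convolved with ψ, is the superposition of the F_{0,r} with density K(r). Convolving with g = φ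
* f gives (ii) with h(y, r) = g(y) K(r), whose norm factorises. The part of K inside the unit ball
is integrable and Young's inequality handles it. -/

/-- Euclidean `d`-space. -/
abbrev Space (d : ℕ) := EuclideanSpace ℝ (Fin d)

/-! ### Rotation invariance of the surface measure -/

section SphereInvariance

variable {d : ℕ}

-- The measure of a subset of the sphere is defined through the volume of the cone over it; cones
-- correspond under the isometry, and the isometry preserves volume.
open Metric Pointwise in
theorem toSphere_map_isometry (L : Space d ≃ₗᵢ[ℝ] Space d)
    (e : sphere (0 : Space d) 1 → sphere (0 : Space d) 1) (he : ∀ θ, (e θ : Space d) = L θ) :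
    MeasurePreserving e (volume : Measure (Space d)).toSphere
      (volume : Measure (Space d)).toSphere := by
  have hec : Continuous e := by
    refine continuous_induced_rng.2 ?_
    have : (Subtype.val ∘ e) = fun θ : sphere (0 : Space d) 1 => L θ := funext he
    rw [this]
    fun_prop
  refine ⟨hec.measurable, ?_⟩
  ext s hs
  rw [Measure.map_apply hec.measurable hs, Measure.toSphere_apply' _ hs,
    Measure.toSphere_apply' _ (hec.measurable hs)]
  have key : Ioo (0 : ℝ) 1 • (Subtype.val '' (e ⁻¹' s))
      = L ⁻¹' (Ioo (0 : ℝ) 1 • (Subtype.val '' s)) := by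
    ext x
    simp only [mem_smul, mem_image, mem_preimage]
    constructor
    · rintro ⟨t, ht, _, ⟨θ, hθ, rfl⟩, rfl⟩
      exact ⟨t, ht, _, ⟨e θ, hθ, rfl⟩, by simp [he]⟩
    · rintro ⟨t, ht, _, ⟨θ, hθ, rfl⟩, h⟩
      refine ⟨t, ht, _, ⟨⟨L.symm θ, by simp⟩, ?_, rfl⟩, ?_⟩
      · have : e ⟨L.symm θ, by simp⟩ = θ := by ext1; simp [he]
        rw [this]; exact hθ
      · apply L.injective
        simpa using h
  rw [key, L.measurePreserving.measure_preimage_emb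
    L.toHomeomorph.measurableEmbedding]

theorem integral_sphere_comp_isometry {G : Type*} [NormedAddCommGroup G] [NormedSpace ℝ G]
    (L : Space d ≃ₗᵢ[ℝ] Space d) (f : Space d → G) :
    ∫ θ, f (L θ) ∂(volume : Measure (Space d)).toSphere
      = ∫ θ, f θ ∂(volume : Measure (Space d)).toSphere := by
  let e : Metric.sphere (0 : Space d) 1 ≃ₜ Metric.sphere (0 : Space d) 1 :=
    { toFun := fun θ => ⟨L θ, by simp⟩
      invFun := fun θ => ⟨L.symm θ, by simp⟩
      left_inv := fun θ => by simp
      right_inv := fun θ => by simp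
      continuous_toFun := by fun_prop
      continuous_invFun := by fun_prop }
  exact (toSphere_map_isometry L e fun θ => rfl).integral_comp e.measurableEmbedding
    (fun θ => f θ)

/-- The (cosine) Fourier transform of the surface measure of the unit sphere. -/
noncomputable def sphereCos (ξ : Space d) : ℝ :=
  ∫ θ, Real.cos (inner ℝ ξ (θ : Space d)) ∂(volume : Measure (Space d)).toSphere

/-- The reflection in the hyperplane orthogonal to ξ - η exchanges the two frequencies and preserves
the surface measure. -/
theorem sphereCos_eq_of_norm_eq {ξ η : Space d} (h : ‖ξ‖ = ‖η‖) : sphereCos ξ = sphereCos η := by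
  let L : Space d ≃ₗᵢ[ℝ] Space d := (ℝ ∙ (ξ - η))ᗮ.reflection
  have hL : L ξ = η := Submodule.reflection_sub h
  unfold sphereCos
  rw [← integral_sphere_comp_isometry L (fun θ => Real.cos (inner ℝ η θ))]
  simp_rw [← hL, LinearIsometryEquiv.inner_map_map]

theorem abs_sphereCos_le (ξ : Space d) :
    |sphereCos ξ| ≤ (volume : Measure (Space d)).toSphere.real univ := by
  have := norm_integral_le_of_norm_le_const (μ := (volume : Measure (Space d)).toSphere) (C := 1)
    (f := fun θ => Real.cos (inner ℝ ξ (θ : Space d))) (by simp [Real.abs_cos_le_one])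
  rw [one_mul, Real.norm_eq_abs] at this
  exact this

theorem continuous_sphereCos : Continuous (sphereCos : Space d → ℝ) := by
  refine continuous_of_dominated (bound := fun _ => 1) (fun ξ => ?_) (fun ξ => ?_)
    (integrable_const _) ?_
  · exact Continuous.aestronglyMeasurable (by fun_prop)
  · simp [Real.abs_cos_le_one]
  · exact .of_forall fun θ => by fun_prop

/-- The antipodal map preserves the measure, so the exponential may be averaged with its conjugate
and only the cosine survives. -/
theorem integral_sphere_exp (ξ : Space d) :
    ∫ θ, Complex.exp (Complex.I * (inner ℝ ξ (θ : Space d) : ℝ))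
      ∂(volume : Measure (Space d)).toSphere = sphereCos ξ := by
  have hi (f : Metric.sphere (0 : Space d) 1 → ℂ) (hf : Continuous f) :
      Integrable f (volume : Measure (Space d)).toSphere :=
    hf.integrable_of_hasCompactSupport (HasCompactSupport.of_compactSpace _)
  have h1 := integral_sphere_comp_isometry (LinearIsometryEquiv.neg ℝ (E := Space d))
    (fun θ => Complex.exp (Complex.I * (inner ℝ ξ θ : ℝ)))
  have h2 : ∀ x : ℝ, (Real.cos x : ℂ)
      = 2⁻¹ * (Complex.exp (Complex.I * x) + Complex.exp (Complex.I * (-x : ℝ))) := by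
    intro x
    rw [Complex.ofReal_cos, Complex.cos]
    push_cast
    ring_nf
  unfold sphereCos
  rw [← integral_complex_ofReal]
  simp_rw [h2]
  rw [integral_const_mul, integral_add (hi _ (by fun_prop)) (hi _ (by fun_prop))]
  simp only [LinearIsometryEquiv.coe_neg, inner_neg_right] at h1
  rw [h1]
  ring

end SphereInvariance

/-! ### Decay of the Fourier transform of the sphere -/

section SphereDecay

variable {d : ℕ}

/-- Differentiation under the integral sign with dominating function 1. The weight `c` lets the same
statement serve for first and second derivatives. -/
theorem hasDerivAt_integral_comp_affine {X : Type*} [TopologicalSpace X] [CompactSpace X]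
    [MeasurableSpace X] [OpensMeasurableSpace X] {μ : Measure X}
    [IsFiniteMeasure μ] {a b c : X → ℝ} (ha : Continuous a) (hb : Continuous b) (hc : Continuous c)
    {φ φ' : ℝ → ℝ} (hφ : ∀ x, HasDerivAt φ (φ' x) x) (hφ' : Continuous φ')
    (hb1 : ∀ x, |b x| ≤ 1) (hc1 : ∀ x, |c x| ≤ 1) (hφ1 : ∀ x, |φ' x| ≤ 1) (s : ℝ) :
    HasDerivAt (fun s => ∫ x, c x * φ (a x + s * b x) ∂μ)
      (∫ x, c x * (φ' (a x + s * b x) * b x) ∂μ) s := by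
  have hφc : Continuous φ := continuous_iff_continuousAt.2 fun x => (hφ x).continuousAt
  have hi (f : X → ℝ) (hf : Continuous f) : Integrable f μ :=
    hf.integrable_of_hasCompactSupport (HasCompactSupport.of_compactSpace _)
  refine (hasDerivAt_integral_of_dominated_loc_of_deriv_le (bound := fun _ => 1)
    (F := fun s x => c x * φ (a x + s * b x))
    (F' := fun s x => c x * (φ' (a x + s * b x) * b x)) (s := univ) Filter.univ_mem
    ?_ (hi _ (by fun_prop)) ?_ ?_ (integrable_const _) ?_).2
  · exact .of_forall fun s => Continuous.aestronglyMeasurable (by fun_prop)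
  · exact Continuous.aestronglyMeasurable (by fun_prop)
  · refine .of_forall fun x s _ => ?_
    rw [Real.norm_eq_abs, abs_mul, abs_mul]
    exact mul_le_one₀ (hc1 x) (by positivity) (mul_le_one₀ (hφ1 _) (abs_nonneg _) (hb1 x))
  · refine .of_forall fun x s _ => ?_
    refine HasDerivAt.const_mul _ ?_
    have : HasDerivAt (fun s => a x + s * b x) (b x) s := by
      simpa using ((hasDerivAt_id s).mul_const (b x)).const_add (a x)
    exact (hφ _).comp s this

/-- The coordinates of a point of the unit sphere. -/
theorem abs_coord_sphere_le (θ : Metric.sphere (0 : Space d) 1) (i : Fin d) :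
    |(θ : Space d) i| ≤ 1 := by
  have := PiLp.norm_apply_le (θ : Space d) i
  simpa using this

theorem sum_coord_sphere (θ : Metric.sphere (0 : Space d) 1) :
    ∑ i, (θ : Space d) i ^ 2 = 1 := by
  have h : ‖(θ : Space d)‖ = 1 := by simp
  have := EuclideanSpace.real_norm_sq_eq (θ : Space d)
  rw [← this, h]; norm_num

/-- The restriction of `sphereCos` to the `i`-th axis. -/
noncomputable def axisCos (i : Fin d) (t : ℝ) : ℝ :=
  ∫ θ, Real.cos (t * (θ : Space d) i) ∂(volume : Measure (Space d)).toSphere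

/-- The derivative of `axisCos`. -/
noncomputable def axisCosDeriv (i : Fin d) (t : ℝ) : ℝ :=
  ∫ θ, -(θ : Space d) i * Real.sin (t * (θ : Space d) i) ∂(volume : Measure (Space d)).toSphere

/-- The frequency t e_i + s e_j has the length of √(t² + s²) e_i. Differentiating in s then yields
information in a direction transversal to the axis. -/
theorem integral_sphere_cos_pair {i j : Fin d} (hij : i ≠ j) (t s : ℝ) :
    ∫ θ, Real.cos (t * (θ : Space d) i + s * (θ : Space d) j)
      ∂(volume : Measure (Space d)).toSphere = axisCos i (√(t ^ 2 + s ^ 2)) := by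
  have h := sphereCos_eq_of_norm_eq
    (ξ := EuclideanSpace.single i t + EuclideanSpace.single j s)
    (η := EuclideanSpace.single i (√(t ^ 2 + s ^ 2))) (by
      have h0 : inner ℝ (EuclideanSpace.single i t : Space d) (EuclideanSpace.single j s) = 0 := by
        simp [EuclideanSpace.inner_single_left, hij]
      have h1 := norm_add_sq_eq_norm_sq_add_norm_sq_of_inner_eq_zero _ _ h0
      simp only [PiLp.norm_single, Real.norm_eq_abs] at h1 ⊢
      rw [abs_of_nonneg (Real.sqrt_nonneg _), eq_comm, Real.sqrt_eq_iff_mul_self_eq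
        (by positivity) (norm_nonneg _), h1]
      simp [← sq])
  unfold sphereCos at h
  simpa [inner_add_left, EuclideanSpace.inner_single_left, axisCos] using h

theorem hasDerivAt_axisCos (i : Fin d) (t : ℝ) :
    HasDerivAt (axisCos i) (axisCosDeriv i t) t := by
  have := hasDerivAt_integral_comp_affine (μ := (volume : Measure (Space d)).toSphere)
    (a := fun _ => 0) (b := fun θ => (θ : Space d) i) (c := fun _ => 1) (φ := Real.cos)
    (φ' := fun x => -Real.sin x) (by fun_prop) (by fun_prop) (by fun_prop) Real.hasDerivAt_cos
    (by fun_prop) (fun θ => abs_coord_sphere_le θ i) (by simp)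
    (by simp [Real.abs_sin_le_one]) t
  simp only [zero_add, one_mul] at this
  refine this.congr_deriv ?_
  unfold axisCosDeriv
  congr 1; ext θ; ring

theorem hasDerivAt_axisCosDeriv (i : Fin d) (t : ℝ) :
    HasDerivAt (axisCosDeriv i) (∫ θ, -(θ : Space d) i ^ 2 * Real.cos (t * (θ : Space d) i)
      ∂(volume : Measure (Space d)).toSphere) t := by
  have := hasDerivAt_integral_comp_affine (μ := (volume : Measure (Space d)).toSphere)
    (a := fun _ => 0) (b := fun θ => (θ : Space d) i) (c := fun θ => -(θ : Space d) i)
    (φ := Real.sin) (φ' := Real.cos) (by fun_prop) (by fun_prop) (by fun_prop) Real.hasDerivAt_sin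
    (by fun_prop) (fun θ => abs_coord_sphere_le θ i)
    (fun θ => by simpa using abs_coord_sphere_le θ i) (by simp [Real.abs_cos_le_one]) t
  simp only [zero_add] at this
  refine this.congr_deriv ?_
  congr 1; ext θ; ring

/-- A radial function with profile B has transversal second derivative B'(t)/t at a point at
distance t from the origin. Here it is read off from two computations of the same s-derivative. -/
theorem integral_sphere_coord_sq_cos {i j : Fin d} (hij : i ≠ j) {t : ℝ} (ht : 0 < t) :
    ∫ θ, -(θ : Space d) j ^ 2 * Real.cos (t * (θ : Space d) i)
      ∂(volume : Measure (Space d)).toSphere = axisCosDeriv i t / t := by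
  set σ := (volume : Measure (Space d)).toSphere
  have hsq (s : ℝ) : HasDerivAt (fun s => √(t ^ 2 + s ^ 2)) (s / √(t ^ 2 + s ^ 2)) s := by
    have h1 : HasDerivAt (fun s : ℝ => t ^ 2 + s ^ 2) (2 * s) s := by
      simpa using (hasDerivAt_pow 2 s).const_add (t ^ 2)
    refine (h1.sqrt (by positivity)).congr_deriv ?_
    field_simp
  have h1 (s : ℝ) : HasDerivAt (fun s => axisCos i (√(t ^ 2 + s ^ 2)))
      (axisCosDeriv i (√(t ^ 2 + s ^ 2)) * (s / √(t ^ 2 + s ^ 2))) s :=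
    (hasDerivAt_axisCos i _).comp s (hsq s)
  have h2 (s : ℝ) : HasDerivAt (fun s => axisCos i (√(t ^ 2 + s ^ 2)))
      (∫ θ, -(θ : Space d) j * Real.sin (t * (θ : Space d) i + s * (θ : Space d) j) ∂σ) s := by
    have := hasDerivAt_integral_comp_affine (μ := σ)
      (a := fun θ => t * (θ : Space d) i) (b := fun θ => (θ : Space d) j) (c := fun _ => 1)
      (φ := Real.cos)
      (φ' := fun x => -Real.sin x) (by fun_prop) (by fun_prop) (by fun_prop) Real.hasDerivAt_cos
      (by fun_prop) (fun θ => abs_coord_sphere_le θ j) (by simp)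
      (by simp [Real.abs_sin_le_one]) s
    simp only [one_mul, σ, integral_sphere_cos_pair hij] at this
    refine this.congr_deriv ?_
    congr 1; ext θ; ring
  have h3 : HasDerivAt
      (fun s => ∫ θ, -(θ : Space d) j * Real.sin (t * (θ : Space d) i + s * (θ : Space d) j) ∂σ)
      (∫ θ, -(θ : Space d) j ^ 2 * Real.cos (t * (θ : Space d) i) ∂σ) 0 := by
    have := hasDerivAt_integral_comp_affine (μ := σ)
      (a := fun θ => t * (θ : Space d) i) (b := fun θ => (θ : Space d) j)
      (c := fun θ => -(θ : Space d) j)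
      (φ := Real.sin) (φ' := Real.cos) (by fun_prop) (by fun_prop) (by fun_prop)
      Real.hasDerivAt_sin (by fun_prop) (fun θ => abs_coord_sphere_le θ j)
      (fun θ => by simpa using abs_coord_sphere_le θ j) (by simp [Real.abs_cos_le_one]) 0
    refine this.congr_deriv ?_
    congr 1; ext θ; simp only [zero_mul, add_zero]; ring
  -- The first derivative has the form s g(s), so its derivative at s = 0 is g(0), which is the
  -- desired quotient.
  have h4 : (fun s => ∫ θ, -(θ : Space d) j *
      Real.sin (t * (θ : Space d) i + s * (θ : Space d) j) ∂σ)
      = fun s => s * (axisCosDeriv i (√(t ^ 2 + s ^ 2)) / √(t ^ 2 + s ^ 2)) := by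
    ext s
    rw [(h2 s).unique (h1 s)]
    ring
  rw [h4] at h3
  have h5 : HasDerivAt (fun s => axisCosDeriv i (√(t ^ 2 + s ^ 2)) / √(t ^ 2 + s ^ 2))
      _ 0 := ((hasDerivAt_axisCosDeriv i _).comp 0 (hsq 0)).div (hsq 0) (by positivity)
  have h6 := (hasDerivAt_id (0 : ℝ)).mul h5
  have h7 := h3.unique h6
  rw [h7]
  simp [Real.sqrt_sq ht.le]

/-- The squares of the coordinates add up to 1 on the sphere, so the transform is an eigenfunction
of the Laplacian: B'' + (d-1)/t B' + B = 0. The d - 1 transversal directions contribute B'/t each.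
-/
theorem axisCos_ode (i : Fin d) {t : ℝ} (ht : 0 < t) :
    HasDerivAt (axisCosDeriv i) (-axisCos i t - (d - 1) / t * axisCosDeriv i t) t := by
  refine (hasDerivAt_axisCosDeriv i t).congr_deriv ?_
  set σ := (volume : Measure (Space d)).toSphere
  have hi (f : Metric.sphere (0 : Space d) 1 → ℝ) (hf : Continuous f) : Integrable f σ :=
    hf.integrable_of_hasCompactSupport (HasCompactSupport.of_compactSpace _)
  have hsum : ∑ j, ∫ θ, -(θ : Space d) j ^ 2 * Real.cos (t * (θ : Space d) i) ∂σ
      = -axisCos i t := by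
    rw [← integral_finsetSum _ fun j _ => hi _ (by fun_prop)]
    simp_rw [← Finset.sum_mul, Finset.sum_neg_distrib, sum_coord_sphere]
    simp [axisCos, integral_neg, σ]
  rw [← Finset.add_sum_erase _ _ (Finset.mem_univ i)] at hsum
  rw [Finset.sum_congr rfl fun j hj =>
    integral_sphere_coord_sq_cos (Finset.ne_of_mem_erase hj).symm ht] at hsum
  simp only [Finset.sum_const, Finset.card_erase_of_mem (Finset.mem_univ i), Finset.card_univ,
    Fintype.card_fin, nsmul_eq_mul] at hsum
  have hd : ((d - 1 : ℕ) : ℝ) = d - 1 := by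
    rw [Nat.cast_sub (Nat.one_le_iff_ne_zero.2 (Fin.pos i).ne')]; simp
  rw [hd] at hsum
  have : (d - 1 : ℝ) * (axisCosDeriv i t / t) = (d - 1) / t * axisCosDeriv i t := by ring
  linarith

/-- A monotone energy for the equation, with n = d - 1. The cross term n/t B B' cancels the damping
up to -(n/t²) B B', and the factor exp(n/t) completes this remainder to -(n/t²) times a quadratic
form that is nonnegative once n/t ≤ 1. -/
theorem axisCos_energy (i : Fin d) {t₀ t : ℝ} (ht₀ : 0 < t₀) (hdt : 2 * (d - 1 : ℝ) ≤ t₀)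
    (ht : t₀ ≤ t) :
    t ^ (d - 1) * (axisCosDeriv i t ^ 2 + axisCos i t ^ 2
        + (d - 1) / t * (axisCos i t * axisCosDeriv i t)) * Real.exp ((d - 1) / t)
      ≤ t₀ ^ (d - 1) * (axisCosDeriv i t₀ ^ 2 + axisCos i t₀ ^ 2
        + (d - 1) / t₀ * (axisCos i t₀ * axisCosDeriv i t₀)) * Real.exp ((d - 1) / t₀) := by
  set n := d - 1 with hn
  have hd : (d - 1 : ℝ) = n := by
    rw [hn, Nat.cast_sub (Nat.one_le_iff_ne_zero.2 (Fin.pos i).ne')]; simp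
  rw [hd] at hdt ⊢
  set B := axisCos i
  set B' := axisCosDeriv i
  have hder (t : ℝ) (ht : 0 < t) : HasDerivAt
      (fun t => t ^ n * (B' t ^ 2 + B t ^ 2 + n / t * (B t * B' t)) * Real.exp (n / t))
      (t ^ n * Real.exp (n / t) * (-(n / t ^ 2) *
        (B' t ^ 2 + B t ^ 2 + (1 + n / t) * (B t * B' t)))) t := by
    have hB := hasDerivAt_axisCos i t
    have hB' := axisCos_ode i ht
    rw [hd] at hB'
    have hinv : HasDerivAt (fun t : ℝ => n / t) (-(n / t ^ 2)) t := by
      have := (hasDerivAt_inv ht.ne').const_mul (n : ℝ)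
      refine (this.congr_deriv ?_)
      ring
    have hp : HasDerivAt (fun t : ℝ => t ^ n) (n * (t ^ n / t)) t := by
      refine (hasDerivAt_pow n t).congr_deriv ?_
      rcases n with _ | n
      · simp
      · rw [pow_succ]; field_simp; simp
    refine ((hp.mul (((hB'.pow 2).add (hB.pow 2)).add (hinv.mul (hB.mul hB')))).mul
      hinv.exp).congr_deriv ?_
    simp only [Pi.add_apply, Pi.mul_apply, Pi.pow_apply, B, B']
    field_simp
    ring
  have hanti : AntitoneOn
      (fun t => t ^ n * (B' t ^ 2 + B t ^ 2 + n / t * (B t * B' t)) * Real.exp (n / t))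
      (Ici t₀) := by
    refine antitoneOn_of_deriv_nonpos (convex_Ici _) (fun t ht => ?_) (fun t ht => ?_)
      (fun t ht => ?_)
    · exact (hder t (ht₀.trans_le ht)).continuousAt.continuousWithinAt
    · rw [interior_Ici] at ht
      exact (hder t (ht₀.trans ht)).differentiableAt.differentiableWithinAt
    · rw [interior_Ici] at ht
      have htp : 0 < t := ht₀.trans ht
      rw [(hder t htp).deriv]
      have h1 : (n : ℝ) / t ≤ 1 := by
        rw [div_le_one htp]; have : (0 : ℝ) ≤ n := by positivity
        linarith [mem_Ioi.1 ht]
      have h0 : 0 ≤ (n : ℝ) / t := by positivity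
      have h2 : 0 ≤ B' t ^ 2 + B t ^ 2 + (1 + n / t) * (B t * B' t) := by
        nlinarith [sq_nonneg (B t + B' t), sq_nonneg (B t - B' t)]
      have h3 : 0 ≤ t ^ n * Real.exp (n / t) := by positivity
      have h4 : 0 ≤ (n : ℝ) / t ^ 2 := by positivity
      have := mul_nonneg h3 (mul_nonneg h4 h2)
      linarith
  exact hanti self_mem_Ici ht ht

/-- For large |ξ| the energy dominates t^(d-1) B²/2 and does not increase; for small |ξ| the total
mass of the sphere is a bound. -/
theorem exists_sphereCos_sq_mul_le (hd : 1 ≤ d) :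
    ∃ C, 0 ≤ C ∧ ∀ ξ : Space d, sphereCos ξ ^ 2 * ‖ξ‖ ^ (d - 1) ≤ C := by
  let i : Fin d := ⟨0, hd⟩
  have hn : ((d - 1 : ℕ) : ℝ) = (d : ℝ) - 1 := by rw [Nat.cast_sub hd]; simp
  have hd1 : (0 : ℝ) ≤ d - 1 := by rw [← hn]; positivity
  -- Beyond this point (d-1)/t ≤ 1/2, so the cross term costs at most half of the energy. The
  -- summand 1 keeps `t₀` positive when d = 1.
  set t₀ : ℝ := 2 * (d - 1 : ℝ) + 1 with ht₀
  have hpos : 0 < t₀ := by positivity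
  set K := t₀ ^ (d - 1) * (axisCosDeriv i t₀ ^ 2 + axisCos i t₀ ^ 2
        + (d - 1) / t₀ * (axisCos i t₀ * axisCosDeriv i t₀)) * Real.exp ((d - 1) / t₀)
  set M := (volume : Measure (Space d)).toSphere.real univ
  have hax (ξ : Space d) : sphereCos ξ = axisCos i ‖ξ‖ := by
    rw [sphereCos_eq_of_norm_eq (η := EuclideanSpace.single i ‖ξ‖) (by simp)]
    simp [sphereCos, axisCos, EuclideanSpace.inner_single_left]
  refine ⟨max (M ^ 2 * t₀ ^ (d - 1)) (2 * K), le_max_of_le_left (by positivity), fun ξ => ?_⟩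
  rcases le_total ‖ξ‖ t₀ with h | h
  · refine le_max_of_le_left ?_
    gcongr ?_ * ?_
    · rw [← sq_abs]
      gcongr
      exact abs_sphereCos_le ξ
    · gcongr
  · refine le_max_of_le_right ?_
    have hE := axisCos_energy i hpos (by linarith) h
    rw [hax]
    set t := ‖ξ‖
    have ht : 0 < t := hpos.trans_le h
    set b := axisCos i t
    set b' := axisCosDeriv i t
    have h0 : 0 ≤ (d - 1) / t := by positivity
    have h1 : (d - 1) / t ≤ 1 / 2 := by
      rw [div_le_iff₀ ht]; linarith
    have h2 : b ^ 2 / 2 ≤ b' ^ 2 + b ^ 2 + (d - 1) / t * (b * b') := by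
      nlinarith [sq_nonneg (b + b'), sq_nonneg (b - b')]
    have h3 : 1 ≤ Real.exp ((d - 1) / t) := Real.one_le_exp h0
    have h4 : t ^ (d - 1) * (b ^ 2 / 2) * 1 ≤ K := by
      refine le_trans ?_ hE
      have h5 : 0 ≤ b' ^ 2 + b ^ 2 + (d - 1) / t * (b * b') := le_trans (by positivity) h2
      gcongr
    linarith

end SphereDecay

/-! ### Volumes of balls and annuli -/

section Annulus

variable {d : ℕ}

/-- The closed annulus of radius `r` and half-width `w` centred at `y`. -/
def annulus (y : Space d) (r w : ℝ) : Set (Space d) := {x | |‖x - y‖ - r| ≤ w}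

theorem mem_annulus {y : Space d} {r w : ℝ} {x : Space d} :
    x ∈ annulus y r w ↔ |‖x - y‖ - r| ≤ w := Iff.rfl

theorem isClosed_annulus (y : Space d) (r w : ℝ) : IsClosed (annulus y r w) :=
  isClosed_le (by fun_prop) continuous_const

theorem measurableSet_annulus (y : Space d) (r w : ℝ) : MeasurableSet (annulus y r w) :=
  (isClosed_annulus y r w).measurableSet

/-- The volume of the unit ball. -/
noncomputable def unitBallVol (d : ℕ) : ℝ := (volume : Measure (Space d)).real (Metric.ball 0 1)

theorem unitBallVol_nonneg (d : ℕ) : 0 ≤ unitBallVol d := measureReal_nonneg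

theorem unitBallVol_pos (d : ℕ) : 0 < unitBallVol d :=
  ENNReal.toReal_pos (Metric.measure_ball_pos _ _ one_pos).ne' measure_ball_lt_top.ne

theorem volume_ball_eq (x : Space d) {r : ℝ} (hr : 0 < r) :
    volume (Metric.ball x r) = ENNReal.ofReal (r ^ d * unitBallVol d) := by
  rw [Measure.addHaar_ball_of_pos _ _ hr, ENNReal.ofReal_mul (by positivity), unitBallVol,
    measureReal_def, ENNReal.ofReal_toReal measure_ball_lt_top.ne]
  simp

theorem volume_closedBall_eq (x : Space d) {r : ℝ} (hr : 0 ≤ r) :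
    volume (Metric.closedBall x r) = ENNReal.ofReal (r ^ d * unitBallVol d) := by
  rw [Measure.addHaar_closedBall _ _ hr, ENNReal.ofReal_mul (by positivity), unitBallVol,
    measureReal_def, ENNReal.ofReal_toReal measure_ball_lt_top.ne]
  simp

theorem pow_sub_pow_le_mul {a b : ℝ} (hb : 0 ≤ b) (hab : b ≤ a) (n : ℕ) :
    a ^ n - b ^ n ≤ n * a ^ (n - 1) * (a - b) := by
  have ha : 0 ≤ a := hb.trans hab
  have h := abs_pow_sub_pow_le a b n
  rw [abs_of_nonneg (sub_nonneg.2 hab), abs_of_nonneg ha, abs_of_nonneg hb, max_eq_left hab] at h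
  calc a ^ n - b ^ n ≤ |a ^ n - b ^ n| := le_abs_self _
    _ ≤ _ := h
    _ = _ := by ring

/-- A thin annulus is a difference of two balls. When r ≤ w the ball of radius r + w suffices,
because r + w ≤ 2dw; the density argument needs such thick annuli too. -/
theorem volume_annulus_le (hd : 1 ≤ d) (y : Space d) {r w : ℝ} (hr : 0 ≤ r) (hw : 0 ≤ w) :
    volume (annulus y r w)
      ≤ ENNReal.ofReal (2 * d * unitBallVol d * w * (r + w) ^ (d - 1)) := by
  have hU := unitBallVol_nonneg d
  have hd1 : (1 : ℝ) ≤ d := by exact_mod_cast hd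
  rcases le_or_gt r w with hrw | hrw
  · calc volume (annulus y r w) ≤ volume (Metric.closedBall y (r + w)) := by
          refine measure_mono fun x hx => ?_
          have := (abs_le.1 (mem_annulus.1 hx)).2
          rw [mem_closedBall_iff_norm]; linarith
      _ = _ := volume_closedBall_eq _ (by positivity)
      _ ≤ _ := by
          refine ENNReal.ofReal_le_ofReal ?_
          obtain ⟨n, rfl⟩ : ∃ n, d = n + 1 := ⟨d - 1, by omega⟩
          rw [pow_succ, Nat.add_sub_cancel]
          have h1 : (r + w) ≤ 2 * (n + 1 : ℕ) * w := by nlinarith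
          calc (r + w) ^ n * (r + w) * unitBallVol (n + 1)
              ≤ (r + w) ^ n * (2 * (n + 1 : ℕ) * w) * unitBallVol (n + 1) := by gcongr
            _ = _ := by ring
  · have hsub : Metric.ball y (r - w) ⊆ Metric.closedBall y (r + w) :=
      Metric.ball_subset_closedBall.trans (Metric.closedBall_subset_closedBall (by linarith))
    calc volume (annulus y r w)
        ≤ volume (Metric.closedBall y (r + w) \ Metric.ball y (r - w)) := by
          refine measure_mono fun x hx => ?_
          have := abs_le.1 (mem_annulus.1 hx)
          simp only [mem_sdiff, mem_closedBall_iff_norm, mem_ball_iff_norm, not_lt]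
          constructor <;> linarith
      _ = _ := by
          rw [measure_sdiff hsub measurableSet_ball.nullMeasurableSet measure_ball_lt_top.ne,
            volume_closedBall_eq _ (by positivity), volume_ball_eq _ (sub_pos.2 hrw),
            ← ENNReal.ofReal_sub _ (by have := sub_pos.2 hrw; positivity)]
      _ ≤ _ := by
          refine ENNReal.ofReal_le_ofReal ?_
          have h := pow_sub_pow_le_mul (a := r + w) (b := r - w) (by linarith) (by linarith) d
          calc (r + w) ^ d * unitBallVol d - (r - w) ^ d * unitBallVol d
              = ((r + w) ^ d - (r - w) ^ d) * unitBallVol d := by ring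
            _ ≤ (d * (r + w) ^ (d - 1) * (r + w - (r - w))) * unitBallVol d := by gcongr
            _ = _ := by ring

end Annulus

/-! ### The measures σ_r -/

section SphereMeasure

variable {d : ℕ}

theorem continuous_smul_sphere (r : ℝ) :
    Continuous fun θ : Metric.sphere (0 : Space d) 1 => r • (θ : Space d) := by fun_prop

theorem integral_sphereMeasure {G : Type*} [NormedAddCommGroup G] [NormedSpace ℝ G]
    {r : ℝ} (f : Space d → G) (hf : Continuous f) :
    ∫ z, f z ∂(sphereMeasure d r) = (max (r ^ (d - 1)) 0) •
      ∫ θ, f (r • (θ : Space d)) ∂(volume : Measure (Space d)).toSphere := by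
  rw [sphereMeasure, integral_smul_measure, integral_map
    (continuous_smul_sphere r).aemeasurable hf.aestronglyMeasurable, ENNReal.toReal_ofReal']

instance (r : ℝ) : IsFiniteMeasure (sphereMeasure d r) := by
  unfold sphereMeasure
  exact Measure.smul_finite _ ENNReal.ofReal_ne_top

theorem sphereMeasure_apply (r : ℝ) {s : Set (Space d)} (hs : MeasurableSet s) :
    sphereMeasure d r s = ENNReal.ofReal (r ^ (d - 1)) *
      (volume : Measure (Space d)).toSphere {θ | r • (θ : Space d) ∈ s} := by
  rw [sphereMeasure, Measure.smul_apply, Measure.map_apply (continuous_smul_sphere r).measurable hs,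
    smul_eq_mul]
  rfl

theorem ae_sphereMeasure_norm (hr : 0 ≤ r) : ∀ᵐ z ∂(sphereMeasure d r), ‖z‖ = r := by
  have : MeasurableSet {z : Space d | ¬ ‖z‖ = r} :=
    (isClosed_eq continuous_norm continuous_const).measurableSet.compl
  rw [ae_iff, sphereMeasure_apply r this]
  simp [norm_smul, abs_of_nonneg hr]

-- The cone over the cap is a thin tube around a segment of direction x. About 2r balls of radius
-- 2/r cover it, with volume O(r · r^(-d)), and the factor r^(d-1) of σ_r makes the bound uniform in
-- r.
open Pointwise in
theorem exists_sphereMeasure_closedBall_le (hd : 1 ≤ d) : ∃ C : ℝ, 0 ≤ C ∧ ∀ r : ℝ, 1 ≤ r →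
    ∀ x : Space d, sphereMeasure d r (Metric.closedBall x (1 / 5)) ≤ ENNReal.ofReal C := by
  refine ⟨d * 3 * 2 ^ d * unitBallVol d, by have := unitBallVol_nonneg d; positivity,
    fun r hr x => ?_⟩
  have hr0 : 0 < r := by linarith
  rw [sphereMeasure_apply r measurableSet_closedBall]
  have hms : MeasurableSet {θ : Metric.sphere (0 : Space d) 1 |
      r • (θ : Space d) ∈ Metric.closedBall x (1 / 5)} :=
    (continuous_smul_sphere r).measurable measurableSet_closedBall
  rw [Measure.toSphere_apply' _ hms]
  set n := ⌈2 * r⌉₊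
  have hn0 : 0 < n := Nat.ceil_pos.2 (by positivity)
  have hn : 2 * r ≤ n := Nat.le_ceil _
  have hn' : (n : ℝ) ≤ 3 * r := by
    have := Nat.ceil_lt_add_one (a := 2 * r) (by positivity); linarith
  have hcov : Ioo (0 : ℝ) 1 • (Subtype.val '' {θ : Metric.sphere (0 : Space d) 1 |
      r • (θ : Space d) ∈ Metric.closedBall x (1 / 5)})
      -- Centres are spaced by |x|/(nr) ≤ 1/r, since |x| ≤ 2r ≤ n; the cap itself adds at most
      -- 1/(5r).
      ⊆ ⋃ j ∈ Finset.range n, Metric.closedBall ((j / (n * r) : ℝ) • x) (2 / r) := by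
    rintro _ ⟨t, ht, _, ⟨θ, hθ, rfl⟩, rfl⟩
    simp only [mem_ofPred_eq, mem_closedBall_iff_norm] at hθ
    have hx : ‖x‖ ≤ 2 * r := by
      have h1 : ‖r • (θ : Space d)‖ = r := by simp [norm_smul, abs_of_pos hr0]
      have := norm_sub_norm_le x (r • (θ : Space d))
      rw [norm_sub_rev, h1] at this
      linarith
    refine mem_iUnion₂.2 ⟨⌊t * n⌋₊, ?_, ?_⟩
    · rw [Finset.mem_range, Nat.floor_lt (by have := ht.1; positivity)]
      have := ht.2
      have : (0 : ℝ) < n := by exact_mod_cast hn0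
      nlinarith
    · set j := ⌊t * n⌋₊
      have hnp : (0 : ℝ) < n := by exact_mod_cast hn0
      have hj1 : (j : ℝ) ≤ t * n := Nat.floor_le (by have := ht.1; positivity)
      have hj2 : t * n < j + 1 := Nat.lt_floor_add_one _
      rw [mem_closedBall_iff_norm]
      have hsplit : t • (θ : Space d) - (j / (n * r) : ℝ) • x
          = (t / r) • (r • (θ : Space d) - x) + ((t * n - j) / (n * r)) • x := by
        rw [smul_sub, smul_smul, div_mul_cancel₀ _ hr0.ne', sub_add, ← sub_smul]
        congr 2
        field_simp
        ring
      simp only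
      rw [hsplit]
      refine (norm_add_le _ _).trans ?_
      rw [norm_smul, norm_smul, Real.norm_of_nonneg (div_nonneg ht.1.le hr0.le),
        Real.norm_of_nonneg (div_nonneg (by linarith) (by positivity))]
      have e1 : t / r * ‖r • (θ : Space d) - x‖ ≤ 1 / r * (1 / 5) := by
        gcongr
        exact ht.2.le
      have e2 : (t * n - j) / (n * r) * ‖x‖ ≤ 1 / (n * r) * n := by
        gcongr
        · linarith
        · linarith
      calc _ ≤ 1 / r * (1 / 5) + 1 / (n * r) * n := add_le_add e1 e2
        _ = (6 / 5) / r := by field_simp; norm_num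
        _ ≤ 2 / r := by gcongr; norm_num
  calc _ ≤ ENNReal.ofReal (r ^ (d - 1)) * (d * (n * ENNReal.ofReal ((2 / r) ^ d * unitBallVol d))) := by
        rw [finrank_euclideanSpace_fin]
        gcongr
        refine (measure_mono hcov).trans ((measure_biUnion_finset_le _ _).trans ?_)
        simp_rw [volume_closedBall_eq _ (show 0 ≤ 2 / r by positivity)]
        simp
    _ = ENNReal.ofReal (r ^ (d - 1) * (d * (n * ((2 / r) ^ d * unitBallVol d)))) := by
        have := unitBallVol_nonneg d
        rw [ENNReal.ofReal_mul (p := r ^ (d - 1)) (by positivity),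
          ENNReal.ofReal_mul (p := (d : ℝ)) (by positivity),
          ENNReal.ofReal_mul (p := (n : ℝ)) (by positivity)]
        simp
    _ ≤ _ := by
        refine ENNReal.ofReal_le_ofReal ?_
        have := unitBallVol_nonneg d
        calc r ^ (d - 1) * (d * (n * ((2 / r) ^ d * unitBallVol d)))
            ≤ r ^ (d - 1) * (d * (3 * r * ((2 / r) ^ d * unitBallVol d))) := by gcongr
          _ = d * 3 * 2 ^ d * unitBallVol d * ((r ^ (d - 1) * r) / r ^ d) := by
              rw [div_pow]; field_simp
          _ = _ := by
              rw [← pow_succ, Nat.sub_add_cancel hd, div_self (by positivity), mul_one]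

end SphereMeasure

/-! ### Support and size of the functions F_{y,r} -/

section SphereBump

variable {d : ℕ}

/-- A radial smooth function supported in the ball of radius `1/10` whose Fourier transform is
`O(|ξ|^(2d))`. -/
structure IsOscillatingBump (ψ₀ : Space d → ℂ) : Prop where
  radial : IsRadial ψ₀
  smooth : ContDiff ℝ (⊤ : ℕ∞) ψ₀
  support_subset : tsupport ψ₀ ⊆ Metric.closedBall 0 (1 / 10)
  fourier_le : ∃ C : ℝ, ∀ ξ, ‖𝓕 ψ₀ ξ‖ ≤ C * ‖ξ‖ ^ (2 * d)

namespace IsOscillatingBump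

variable {ψ₀ : Space d → ℂ} (hψ : IsOscillatingBump ψ₀)
include hψ

theorem hasCompactSupport : HasCompactSupport ψ₀ :=
  (isCompact_closedBall 0 (1 / 10)).of_isClosed_subset (isClosed_tsupport _) hψ.support_subset

theorem eq_zero {x : Space d} (hx : 1 / 10 < ‖x‖) : ψ₀ x = 0 := by
  by_contra h
  have := hψ.support_subset (subset_tsupport _ h)
  rw [mem_closedBall_zero_iff] at this
  linarith

theorem conv_continuous : Continuous (conv ψ₀ ψ₀) :=
  hψ.hasCompactSupport.continuous_convolution_right _
    (hψ.smooth.continuous.locallyIntegrable) hψ.smooth.continuous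

theorem conv_eq_zero {x : Space d} (hx : 1 / 5 < ‖x‖) : conv ψ₀ ψ₀ x = 0 := by
  rw [conv, convolution_def]
  refine integral_eq_zero_of_ae (.of_forall fun t => ?_)
  simp only [ContinuousLinearMap.mul_apply', Pi.zero_apply, mul_eq_zero]
  by_contra! h
  have h1 : ‖t‖ ≤ 1 / 10 := by by_contra! h'; exact h.1 (hψ.eq_zero h')
  have h2 : ‖x - t‖ ≤ 1 / 10 := by by_contra! h'; exact h.2 (hψ.eq_zero h')
  have := norm_add_le (x - t) t
  rw [sub_add_cancel] at this
  linarith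

theorem conv_hasCompactSupport : HasCompactSupport (conv ψ₀ ψ₀) := by
  refine HasCompactSupport.of_support_subset_isCompact (isCompact_closedBall 0 (1 / 5)) ?_
  intro x hx
  rw [mem_closedBall_zero_iff]
  by_contra! h
  exact hx (hψ.conv_eq_zero h)

theorem exists_conv_bound : ∃ C : ℝ, 0 ≤ C ∧ ∀ x, ‖conv ψ₀ ψ₀ x‖ ≤ C := by
  obtain ⟨C, hC⟩ := hψ.conv_hasCompactSupport.exists_bound_of_continuous hψ.conv_continuous
  exact ⟨C, (norm_nonneg _).trans (hC 0), hC⟩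

theorem sphereBump_eq (y : Space d) (r : ℝ) (x : Space d) :
    sphereBump ψ₀ y r x = (max (r ^ (d - 1)) 0) •
      ∫ θ, conv ψ₀ ψ₀ (x - r • (θ : Space d) - y) ∂(volume : Measure (Space d)).toSphere := by
  have := hψ.conv_continuous
  exact integral_sphereMeasure (fun z => conv ψ₀ ψ₀ (x - z - y)) (by fun_prop)

/-- Joint continuity in (y, r, x) supplies the measurability on product spaces that the continuous
inequality needs. -/
theorem continuous_sphereBump :
    Continuous fun q : (Space d × ℝ) × Space d => sphereBump ψ₀ q.1.1 q.1.2 q.2 := by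
  simp_rw [hψ.sphereBump_eq]
  have := hψ.conv_continuous
  obtain ⟨C, hC0, hC⟩ := hψ.exists_conv_bound
  have h1 : Continuous fun q : (Space d × ℝ) × Space d => max (q.1.2 ^ (d - 1)) 0 := by fun_prop
  refine h1.smul ?_
  refine continuous_of_dominated (bound := fun _ => C) (fun ξ => ?_) (fun ξ => ?_)
    (integrable_const _) ?_
  · exact Continuous.aestronglyMeasurable (by fun_prop)
  · exact .of_forall fun θ => hC _
  · exact .of_forall fun θ => by fun_prop

theorem continuous_sphereBump_right (y : Space d) (r : ℝ) : Continuous (sphereBump ψ₀ y r) :=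
  hψ.continuous_sphereBump.comp (f := fun x => ((y, r), x)) (by fun_prop)

/-- The half-width 1/5 is twice the radius 1/10 of the support of ψ₀. -/
theorem mem_annulus_of_sphereBump_ne_zero {y : Space d} {r : ℝ} (hr : 0 ≤ r) {x : Space d}
    (h : sphereBump ψ₀ y r x ≠ 0) : x ∈ annulus y r (1 / 5) := by
  by_contra hx
  refine h (integral_eq_zero_of_ae ?_)
  filter_upwards [ae_sphereMeasure_norm hr] with z hz
  refine hψ.conv_eq_zero ?_
  rw [mem_annulus, not_le] at hx
  refine hx.trans_le ?_
  rw [← hz, show x - z - y = (x - y) - z by abel]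
  exact abs_norm_sub_norm_le _ _

/-- Only the piece of the sphere inside a ball of radius 1/5 contributes, and its measure is bounded
uniformly in r. -/
theorem exists_sphereBump_bound (hd : 1 ≤ d) : ∃ C : ℝ, 0 ≤ C ∧ ∀ y r x, 1 ≤ r →
    ‖sphereBump ψ₀ y r x‖ ≤ C := by
  obtain ⟨C, hC0, hC⟩ := hψ.exists_conv_bound
  obtain ⟨K, hK0, hK⟩ := exists_sphereMeasure_closedBall_le hd
  refine ⟨C * K, by positivity, fun y r x hr => ?_⟩
  have h1 : sphereBump ψ₀ y r x = ∫ z in Metric.closedBall (x - y) (1 / 5),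
      conv ψ₀ ψ₀ (x - z - y) ∂(sphereMeasure d r) := by
    refine (setIntegral_eq_integral_of_forall_compl_eq_zero fun z hz => ?_).symm
    refine hψ.conv_eq_zero ?_
    rw [mem_closedBall_iff_norm', not_le] at hz
    rwa [show x - z - y = x - y - z by abel]
  rw [h1]
  refine (norm_setIntegral_le_of_norm_le_const (measure_lt_top _ _) fun z _ => hC _).trans ?_
  gcongr
  rw [measureReal_def]
  exact ENNReal.toReal_le_of_le_ofReal hK0 (hK r hr _)

theorem exists_lintegral_sphereBump_rpow_le (hd : 1 ≤ d) {p : ℝ} (hp : 0 < p) :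
    ∃ C : ℝ≥0, ∀ y r, 1 ≤ r →
      ∫⁻ x, ‖sphereBump ψ₀ y r x‖ₑ ^ p ≤ C * ENNReal.ofReal (r ^ (d - 1)) := by
  obtain ⟨K, hK0, hK⟩ := hψ.exists_sphereBump_bound hd
  have hU := unitBallVol_nonneg d
  refine ⟨Real.toNNReal (K ^ p * (2 * d * unitBallVol d * 2 ^ (d - 1))), fun y r hr => ?_⟩
  calc ∫⁻ x, ‖sphereBump ψ₀ y r x‖ₑ ^ p
      ≤ ∫⁻ x, (annulus y r (1 / 5)).indicator (fun _ => ENNReal.ofReal (K ^ p)) x := by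
        refine lintegral_mono fun x => ?_
        by_cases hx : x ∈ annulus y r (1 / 5)
        · rw [indicator_of_mem hx, ← ENNReal.ofReal_rpow_of_nonneg hK0 hp.le]
          gcongr
          rw [← ofReal_norm]
          exact ENNReal.ofReal_le_ofReal (hK y r x hr)
        · have : sphereBump ψ₀ y r x = 0 := by
            by_contra h
            exact hx (hψ.mem_annulus_of_sphereBump_ne_zero (by linarith) h)
          simp [this, hp]
    _ = ENNReal.ofReal (K ^ p) * volume (annulus y r (1 / 5)) :=
        lintegral_indicator_const (measurableSet_annulus _ _ _) _
    _ ≤ ENNReal.ofReal (K ^ p) *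
          ENNReal.ofReal (2 * d * unitBallVol d * (1 / 5) * (r + 1 / 5) ^ (d - 1)) := by
        gcongr
        exact volume_annulus_le hd y (by linarith) (by norm_num)
    _ ≤ _ := by
        have hr0 : 0 < r := by linarith
        rw [← ENNReal.ofReal_mul (by positivity),
          show ((Real.toNNReal (K ^ p * (2 * d * unitBallVol d * 2 ^ (d - 1))) : ℝ≥0) : ℝ≥0∞)
            = ENNReal.ofReal (K ^ p * (2 * d * unitBallVol d * 2 ^ (d - 1))) from rfl,
          ← ENNReal.ofReal_mul (by positivity)]
        refine ENNReal.ofReal_le_ofReal ?_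
        rw [mul_assoc (K ^ p)]
        refine mul_le_mul_of_nonneg_left ?_ (by positivity)
        calc 2 * d * unitBallVol d * (1 / 5) * (r + 1 / 5) ^ (d - 1)
            ≤ 2 * d * unitBallVol d * 1 * (2 * r) ^ (d - 1) := by
              gcongr
              · norm_num
              · linarith
          _ = _ := by rw [mul_pow]; ring

end IsOscillatingBump

end SphereBump

/-! ### Fourier transforms: Parseval and radial functions -/

section FourierGeneral

variable {d : ℕ}

theorem continuous_fourierChar_coe : Continuous fun x : ℝ => (Real.fourierChar x : ℂ) := by
  simp only [Real.fourierChar_apply]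
  fun_prop

theorem fourier_translate (f : Space d → ℂ) (a ξ : Space d) :
    𝓕 (fun x => f (x - a)) ξ = Real.fourierChar (-inner ℝ a ξ) * 𝓕 f ξ := by
  have h := integral_sub_right_eq_self (μ := (volume : Measure (Space d)))
    (fun x => Real.fourierChar (-inner ℝ (x + a) ξ) • f x) a
  simp only [sub_add_cancel] at h
  rw [Real.fourier_eq, h, Real.fourier_eq, ← integral_const_mul]
  congr 1; ext x
  rw [inner_add_left, neg_add, AddChar.map_add_eq_mul, Circle.smul_def, Circle.smul_def]
  push_cast
  simp only [smul_eq_mul]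
  ring

theorem fourier_finset_sum {ι : Type*} (s : Finset ι) (c : ι → ℂ) (f : ι → Space d → ℂ)
    (hf : ∀ i ∈ s, Integrable (f i)) (ξ : Space d) :
    𝓕 (fun x => ∑ i ∈ s, c i * f i x) ξ = ∑ i ∈ s, c i * 𝓕 (f i) ξ := by
  simp only [Real.fourier_eq, Finset.smul_sum]
  rw [integral_finsetSum]
  · refine Finset.sum_congr rfl fun i _ => ?_
    rw [← integral_const_mul]
    congr 1; ext x
    simp only [Circle.smul_def, smul_eq_mul]; ring
  · intro i hi
    exact (Real.fourierIntegral_convergent_iff ξ).2 ((hf i hi).const_mul _)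

theorem continuous_fourier {f : Space d → ℂ} (hf : Integrable f) : Continuous (𝓕 f) :=
  VectorFourier.fourierIntegral_continuous Real.continuous_fourierChar
    (by exact continuous_inner) hf

/-- Parseval's identity. -/
theorem integral_inner_fourier {f g : Space d → ℂ} (hf : Integrable f) (hg : Integrable g)
    (hgc : Continuous g) (hg' : Integrable (𝓕 g)) :
    ∫ ξ, inner ℂ (𝓕 f ξ) (𝓕 g ξ) = ∫ x, inner ℂ (f x) (g x) := by
  have h := VectorFourier.integral_sesq_fourierIntegral_eq_neg_flip (innerSL ℂ)
    (L := innerₗ (Space d)) (μ := volume) (ν := volume)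
    Real.continuous_fourierChar continuous_inner hf hg'
  -- The adjoint of the transform carries the opposite sign in the exponent; applied to `𝓕 g` it is
  -- the inverse transform.
  have h2 : VectorFourier.fourierIntegral Real.fourierChar volume (-(innerₗ (Space d)).flip) (𝓕 g)
      = g := by
    rw [flip_innerₗ]
    exact hgc.fourierInv_fourier_eq hg hg'
  rw [h2] at h
  exact h

theorem integral_norm_sq_fourier {f : Space d → ℂ} (hf : Integrable f)
    (hfc : Continuous f) (hf' : Integrable (𝓕 f)) :
    ∫ ξ, ‖𝓕 f ξ‖ ^ 2 = ∫ x, ‖f x‖ ^ 2 := by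
  have h := integral_inner_fourier hf hf hfc hf'
  simp only [inner_self_eq_norm_sq_to_K] at h
  apply Complex.ofRealLI.injective
  simpa [← LinearIsometry.integral_comp_comm] using h

theorem fourier_isRadial {f : Space d → ℂ} (hf : IsRadial f) : IsRadial (𝓕 f) := by
  intro x x' h
  let L : Space d ≃ₗᵢ[ℝ] Space d := (ℝ ∙ (x - x'))ᗮ.reflection
  have hL : L x = x' := Submodule.reflection_sub h
  rw [← hL, ← Real.fourier_comp_linearIsometry]
  have h2 : f ∘ L = f := funext fun z => hf _ _ (L.norm_map z)
  rw [h2]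

theorem integral_sphere_fourierChar (ρ : ℝ) (ξ : Space d) :
    ∫ θ, (Real.fourierChar (-inner ℝ ξ (ρ • (θ : Space d))) : ℂ)
      ∂(volume : Measure (Space d)).toSphere = sphereCos ((2 * Real.pi * ρ) • ξ) := by
  rw [sphereCos_eq_of_norm_eq (η := (-(2 * Real.pi * ρ)) • ξ) (by simp [norm_smul]),
    ← integral_sphere_exp]
  congr 1; ext θ
  rw [Real.fourierChar_apply, inner_smul_left, inner_smul_right]
  congr 1
  simp
  ring

/-- The Fourier transform of a radial function as an average of `sphereCos`. -/
theorem fourier_radial_eq {f : Space d → ℂ} (hf : IsRadial f) (hfi : Integrable f)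
    (w : Space d) : ((volume : Measure (Space d)).toSphere.real univ : ℂ) * 𝓕 f w
      = ∫ ξ, sphereCos ((2 * Real.pi * ‖w‖) • ξ) * f ξ := by
  set σ := (volume : Measure (Space d)).toSphere
  have h1 : ∀ θ : Metric.sphere (0 : Space d) 1, 𝓕 f w
      = ∫ ξ, (Real.fourierChar (-inner ℝ ξ (‖w‖ • (θ : Space d))) : ℂ) * f ξ := by
    intro θ
    rw [fourier_isRadial hf w (‖w‖ • (θ : Space d)) (by simp [norm_smul]), Real.fourier_eq]
    rfl
  have h2 : (σ.real univ : ℂ) * 𝓕 f w = ∫ θ, ∫ ξ,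
      (Real.fourierChar (-inner ℝ ξ (‖w‖ • (θ : Space d))) : ℂ) * f ξ ∂volume ∂σ := by
    rw [← integral_congr_ae (.of_forall h1), integral_const]
    simp
  rw [h2, integral_integral_swap]
  · congr 1; ext ξ
    rw [integral_mul_const, integral_sphere_fourierChar]
  · have : Integrable (fun q : Metric.sphere (0 : Space d) 1 × Space d => f q.2)
        (σ.prod volume) := hfi.comp_snd σ
    refine this.bdd_mul (c := 1) (Continuous.aestronglyMeasurable ?_) ?_
    · exact continuous_fourierChar_coe.comp (by fun_prop)
    · exact .of_forall fun q => (Circle.norm_coe _).le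

/-- The square root of the decay estimate, with the powers of the radius and of the frequency
separated: the former enter the final bounds, the latter are absorbed by the zero of the bump. -/
theorem exists_abs_sphereCos_le_rpow (hd : 1 ≤ d) : ∃ C : ℝ, 0 ≤ C ∧ ∀ t : ℝ, 0 < t →
    ∀ ξ : Space d, ξ ≠ 0 → |sphereCos ((2 * Real.pi * t) • ξ)|
      ≤ C * (t ^ (-(((d : ℝ) - 1) / 2)) * ‖ξ‖ ^ (-(((d : ℝ) - 1) / 2))) := by
  obtain ⟨C, hC0, hC⟩ := exists_sphereCos_sq_mul_le hd
  refine ⟨√C, by positivity, fun t ht ξ hξ => ?_⟩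
  have hξ' : 0 < ‖ξ‖ := norm_pos_iff.2 hξ
  have hpi : (1 : ℝ) ≤ 2 * Real.pi := by linarith [Real.pi_gt_three]
  have hu : 0 < t * ‖ξ‖ := by positivity
  set S := |sphereCos ((2 * Real.pi * t) • ξ)|
  have h1 : S ^ 2 * (t * ‖ξ‖) ^ (d - 1) ≤ C := by
    refine le_trans ?_ (hC ((2 * Real.pi * t) • ξ))
    rw [sq_abs, norm_smul, Real.norm_of_nonneg (by positivity)]
    gcongr
    nlinarith
  rw [← Real.mul_rpow ht.le hξ'.le, Real.rpow_neg hu.le, ← div_eq_mul_inv,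
    le_div_iff₀ (by positivity)]
  refine Real.le_sqrt_of_sq_le ?_
  rw [mul_pow, ← Real.rpow_natCast ((t * ‖ξ‖) ^ _), ← Real.rpow_mul hu.le]
  convert h1 using 2
  rw [← Real.rpow_natCast, Nat.cast_sub hd]
  congr 1
  push_cast; ring

end FourierGeneral

/-! ### Fourier transforms of the bump and of F_{y,r} -/

namespace IsOscillatingBump

variable {d : ℕ} {ψ₀ : Space d → ℂ} (hψ : IsOscillatingBump ψ₀)
include hψ

theorem integrable : Integrable ψ₀ :=
  hψ.smooth.continuous.integrable_of_hasCompactSupport hψ.hasCompactSupport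

/-- The bump as a Schwartz function. -/
noncomputable def schwartz : SchwartzMap (Space d) ℂ :=
  hψ.hasCompactSupport.toSchwartzMap hψ.smooth

theorem fourier_eq_schwartz : 𝓕 ψ₀ = (𝓕 hψ.schwartz : SchwartzMap (Space d) ℂ) := by
  rw [SchwartzMap.fourier_coe]; rfl

theorem fourier_integrable : Integrable (𝓕 ψ₀) := by
  rw [hψ.fourier_eq_schwartz]
  exact SchwartzMap.integrable _

theorem fourier_integrable_sq : Integrable (fun ξ => ‖𝓕 ψ₀ ξ‖ ^ 2) := by
  rw [hψ.fourier_eq_schwartz]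
  exact ((𝓕 hψ.schwartz).memLp 2).integrable_norm_pow (by norm_num)

omit hψ in
theorem exists_fourier_bound : ∃ C : ℝ, 0 ≤ C ∧ ∀ ξ, ‖𝓕 ψ₀ ξ‖ ≤ C := by
  refine ⟨∫ x, ‖ψ₀ x‖, by positivity, fun ξ => ?_⟩
  exact VectorFourier.norm_fourierIntegral_le_integral_norm _ _ _ _ _

/-- Near the origin use the zero of order 2d, elsewhere boundedness. This is what compensates
negative powers of |ξ| coming from the sphere. -/
theorem exists_fourier_le_rpow {s : ℝ} (hs0 : 0 ≤ s) (hs : s ≤ 2 * d) :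
    ∃ C : ℝ, 0 ≤ C ∧ ∀ ξ, ‖𝓕 ψ₀ ξ‖ ≤ C * ‖ξ‖ ^ s := by
  obtain ⟨C, hC0, hC⟩ := exists_fourier_bound (ψ₀ := ψ₀)
  obtain ⟨K, hK⟩ := hψ.fourier_le
  refine ⟨max C |K|, by positivity, fun ξ => ?_⟩
  rcases le_total ‖ξ‖ 1 with h | h
  · calc ‖𝓕 ψ₀ ξ‖ ≤ K * ‖ξ‖ ^ (2 * d) := hK ξ
      _ ≤ |K| * ‖ξ‖ ^ (2 * d) := by gcongr; exact le_abs_self K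
      _ ≤ |K| * ‖ξ‖ ^ s := by
          gcongr
          rw [← Real.rpow_natCast]
          rcases (norm_nonneg ξ).eq_or_lt with h0 | h0
          · rw [← h0]
            rcases hs0.eq_or_lt with hs0 | hs0
            · rw [← hs0, Real.rpow_zero]
              exact Real.rpow_le_one le_rfl zero_le_one (by positivity)
            · rw [Real.zero_rpow hs0.ne', Real.zero_rpow]
              push_cast; linarith
          · exact Real.rpow_le_rpow_of_exponent_ge h0 h (by push_cast; exact hs)
      _ ≤ _ := by gcongr; exact le_max_right _ _
  · calc ‖𝓕 ψ₀ ξ‖ ≤ C * 1 := by rw [mul_one]; exact hC ξ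
      _ ≤ _ := by
        gcongr
        · exact le_max_left _ _
        · exact Real.one_le_rpow h hs0

theorem conv_integrable : Integrable (conv ψ₀ ψ₀) :=
  hψ.conv_continuous.integrable_of_hasCompactSupport hψ.conv_hasCompactSupport

theorem fourier_conv (ξ : Space d) : 𝓕 (conv ψ₀ ψ₀) ξ = 𝓕 ψ₀ ξ ^ 2 := by
  rw [sq, ← Real.fourier_mul_convolution_eq hψ.integrable hψ.integrable]
  rfl

theorem hasCompactSupport_sphereBump (y : Space d) {r : ℝ} (hr : 0 ≤ r) :
    HasCompactSupport (sphereBump ψ₀ y r) := by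
  refine HasCompactSupport.of_support_subset_isCompact (isCompact_closedBall y (r + 1 / 5)) ?_
  intro x hx
  have := (abs_le.1 (mem_annulus.1 (hψ.mem_annulus_of_sphereBump_ne_zero hr hx))).2
  rw [mem_closedBall_iff_norm]
  linarith

theorem integrable_sphereBump (y : Space d) {r : ℝ} (hr : 0 ≤ r) :
    Integrable (sphereBump ψ₀ y r) :=
  (hψ.continuous_sphereBump_right y r).integrable_of_hasCompactSupport
    (hψ.hasCompactSupport_sphereBump y hr)

/-- F_{y,r} is an average over the sphere of translates of ψ₀ * ψ₀, so Fubini reduces the transform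
to that of one translate. -/
theorem fourier_sphereBump (y : Space d) {r : ℝ} (hr : 0 ≤ r) (ξ : Space d) :
    𝓕 (sphereBump ψ₀ y r) ξ = (r ^ (d - 1) * sphereCos ((2 * Real.pi * r) • ξ) : ℝ) * 𝓕 ψ₀ ξ ^ 2
      * Real.fourierChar (-inner ℝ y ξ) := by
  set σ := (volume : Measure (Space d)).toSphere
  have hc := hψ.conv_continuous
  rw [Real.fourier_eq]
  have h1 : ∀ x, Real.fourierChar (-inner ℝ x ξ) • sphereBump ψ₀ y r x
      = (r ^ (d - 1) : ℝ) * ∫ θ, Real.fourierChar (-inner ℝ x ξ) •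
        conv ψ₀ ψ₀ (x - (r • (θ : Space d) + y)) ∂σ := by
    intro x
    rw [hψ.sphereBump_eq, max_eq_left (by positivity)]
    simp only [Circle.smul_def, smul_eq_mul, Complex.real_smul, sub_sub]
    rw [integral_const_mul]
    ring
  simp_rw [h1]
  rw [integral_const_mul, integral_integral_swap]
  · have h2 : ∀ θ : Metric.sphere (0 : Space d) 1, ∫ x, Real.fourierChar (-inner ℝ x ξ) •
        conv ψ₀ ψ₀ (x - (r • (θ : Space d) + y))
        = (Real.fourierChar (-inner ℝ ξ (r • (θ : Space d))) : ℂ)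
          * (Real.fourierChar (-inner ℝ y ξ) * 𝓕 ψ₀ ξ ^ 2) := by
      intro θ
      rw [← Real.fourier_eq (fun x => conv ψ₀ ψ₀ (x - (r • (θ : Space d) + y))),
        fourier_translate, hψ.fourier_conv, inner_add_left, neg_add, AddChar.map_add_eq_mul,
        real_inner_comm ξ]
      push_cast
      ring
    simp_rw [h2]
    rw [integral_mul_const, integral_sphere_fourierChar]
    push_cast
    ring
  · refine (Continuous.integrable_of_hasCompactSupport ?_ ?_)
    · simp only [Circle.smul_def]
      refine Continuous.smul (continuous_fourierChar_coe.comp ?_) (hc.comp ?_)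
      · fun_prop
      · fun_prop
    · refine HasCompactSupport.of_support_subset_isCompact
        ((isCompact_closedBall y (r + 1 / 5)).prod isCompact_univ) ?_
      rintro ⟨x, θ⟩ h
      refine ⟨?_, mem_univ _⟩
      have h0 : conv ψ₀ ψ₀ (x - (r • (θ : Space d) + y)) ≠ 0 := by
        intro h0
        apply h
        simp [Function.uncurry, h0]
      have h3 : ‖x - (r • (θ : Space d) + y)‖ ≤ 1 / 5 := by
        by_contra! h'
        exact h0 (hψ.conv_eq_zero h')
      have h4 : ‖r • (θ : Space d)‖ = r := by simp [norm_smul, abs_of_nonneg hr]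
      rw [mem_closedBall_iff_norm]
      have := norm_add_le (x - (r • (θ : Space d) + y)) (r • (θ : Space d))
      rw [show x - (r • (θ : Space d) + y) + r • (θ : Space d) = x - y by abel] at this
      simp only
      linarith

theorem integrable_fourier_sphereBump (y : Space d) {r : ℝ} (hr : 0 ≤ r) :
    Integrable (𝓕 (sphereBump ψ₀ y r)) := by
  have h1 : Integrable (fun ξ => 𝓕 ψ₀ ξ ^ 2) := by
    refine (hψ.fourier_integrable_sq).mono' ?_ (by simp)
    exact ((continuous_fourier hψ.integrable).pow 2).aestronglyMeasurable
  refine (h1.const_mul ((r ^ (d - 1) * (volume : Measure (Space d)).toSphere.real univ : ℝ) : ℂ)).mono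
    (continuous_fourier (hψ.integrable_sphereBump y hr)).aestronglyMeasurable
    (.of_forall fun ξ => ?_)
  rw [hψ.fourier_sphereBump y hr, norm_mul, Circle.norm_coe, mul_one, norm_mul, norm_mul,
    Complex.norm_real, Complex.norm_real, norm_mul, norm_mul]
  gcongr
  rw [Real.norm_eq_abs, Real.norm_of_nonneg measureReal_nonneg]
  exact abs_sphereCos_le _

end IsOscillatingBump

/-! ### Inner products and L² norms of the F_{y,r} -/

namespace IsOscillatingBump

variable {d : ℕ} {ψ₀ : Space d → ℂ} (hψ : IsOscillatingBump ψ₀)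
include hψ

/-- Parseval turns the inner product into the transform at w = y' - y of a radial function `Φ`;
averaging over rotations adds a third sphere factor, at scale |w|, to those at r and r'. With a =
(d-1)/2, the factors r^(d-1) r^(-a) leave r^a, and the total singularity |ξ|^(-3a) is cancelled by
two copies of the bump's transform. -/
theorem exists_norm_integral_inner_sphereBump_le (hd : 1 ≤ d) : ∃ C : ℝ, 0 ≤ C ∧
    ∀ (y y' : Space d) (r r' : ℝ), 1 ≤ r → 1 ≤ r' → y ≠ y' →
      ‖∫ x, inner ℂ (sphereBump ψ₀ y r x) (sphereBump ψ₀ y' r' x)‖ ≤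
        C * ((r * r') ^ (((d : ℝ) - 1) / 2) * ‖y' - y‖ ^ (-(((d : ℝ) - 1) / 2))) := by
  have hd1 : (1 : ℝ) ≤ d := by exact_mod_cast hd
  set a : ℝ := ((d : ℝ) - 1) / 2 with ha
  have ha0 : 0 ≤ a := by rw [ha]; linarith
  have : Nonempty (Fin d) := ⟨⟨0, hd⟩⟩
  set S := (volume : Measure (Space d)).toSphere.real univ with hS
  have hSpos : 0 < S := by
    rw [hS, Measure.toSphere_real_apply_univ, finrank_euclideanSpace_fin]
    have := unitBallVol_pos d
    unfold unitBallVol at this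
    positivity
  obtain ⟨C₁, hC₁0, hC₁⟩ := exists_abs_sphereCos_le_rpow hd
  -- Of the four factors |ψ̂₀|, two supply |ξ|^(3a), that is |ξ|^(3a/2) each, and the other two
  -- remain to make the integral converge.
  obtain ⟨C₂, hC₂0, hC₂⟩ := hψ.exists_fourier_le_rpow (s := 3 * a / 2) (by positivity)
    (by rw [ha]; linarith)
  set I := ∫ ξ, ‖𝓕 ψ₀ ξ‖ ^ 2 with hI
  have hI0 : 0 ≤ I := integral_nonneg fun _ => by positivity
  refine ⟨C₁ ^ 3 * C₂ ^ 2 * I / S, by positivity, fun y y' r r' hr hr' hyy => ?_⟩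
  have hr0 : 0 < r := by linarith
  have hr0' : 0 < r' := by linarith
  set w := y' - y with hw
  have hw0 : 0 < ‖w‖ := norm_pos_iff.2 (sub_ne_zero.2 hyy.symm)
  rw [← integral_inner_fourier (hψ.integrable_sphereBump y hr0.le)
    (hψ.integrable_sphereBump y' hr0'.le) (hψ.continuous_sphereBump_right y' r')
    (hψ.integrable_fourier_sphereBump y' hr0'.le)]
  set Φ : Space d → ℂ := fun ξ => ((r ^ (d - 1) * sphereCos ((2 * Real.pi * r) • ξ)) *
    (r' ^ (d - 1) * sphereCos ((2 * Real.pi * r') • ξ)) * ‖𝓕 ψ₀ ξ‖ ^ 4 : ℝ) with hΦ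
  have h1 : ∫ ξ, inner ℂ (𝓕 (sphereBump ψ₀ y r) ξ) (𝓕 (sphereBump ψ₀ y' r') ξ) = 𝓕 Φ w := by
    rw [Real.fourier_eq]
    congr 1; ext ξ
    rw [hψ.fourier_sphereBump y hr0.le, hψ.fourier_sphereBump y' hr0'.le]
    have e1 : (Real.fourierChar (-inner ℝ ξ w) : ℂ) = Real.fourierChar (-inner ℝ y' ξ) *
        (starRingEnd ℂ) (Real.fourierChar (-inner ℝ y ξ)) := by
      rw [← Circle.coe_inv_eq_conj, ← AddChar.map_neg_eq_inv, ← Circle.coe_mul,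
        ← AddChar.map_add_eq_mul, hw, inner_sub_right, real_inner_comm ξ y, real_inner_comm ξ y']
      congr 2; ring
    have e2 : ((‖𝓕 ψ₀ ξ‖ ^ 4 : ℝ) : ℂ) = 𝓕 ψ₀ ξ ^ 2 * (starRingEnd ℂ) (𝓕 ψ₀ ξ) ^ 2 := by
      rw [← mul_pow, Complex.mul_conj, Complex.normSq_eq_norm_sq]
      push_cast; ring
    rw [Circle.smul_def, e1, smul_eq_mul, hΦ]
    simp only [Complex.ofReal_mul (_ * _)  (_ ^ 4), e2, RCLike.inner_apply, map_mul, map_pow,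
      Complex.conj_ofReal]
    push_cast
    ring
  rw [h1]
  have hrad : IsRadial Φ := by
    intro ξ ξ' h
    have e1 : ∀ t : ℝ, sphereCos (t • ξ) = sphereCos (t • ξ') := fun t =>
      sphereCos_eq_of_norm_eq (by simp [norm_smul, h])
    simp only [hΦ, e1, fourier_isRadial hψ.radial ξ ξ' h]
  have hcont : Continuous (𝓕 ψ₀) := continuous_fourier hψ.integrable
  have hcs : Continuous (sphereCos : Space d → ℝ) := continuous_sphereCos
  have hΦc : Continuous Φ := by
    refine Complex.continuous_ofReal.comp ?_
    fun_prop
  obtain ⟨K, hK0, hK⟩ := exists_fourier_bound (ψ₀ := ψ₀)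
  have hΦi : Integrable Φ := by
    refine (hψ.fourier_integrable_sq.const_mul (r ^ (d - 1) * S * (r' ^ (d - 1) * S) * K ^ 2)).mono'
      hΦc.aestronglyMeasurable (.of_forall fun ξ => ?_)
    have e (ξ : Space d) : |sphereCos ξ| ≤ S := abs_sphereCos_le ξ
    simp only [hΦ, Complex.norm_real, norm_mul, norm_pow, Real.norm_eq_abs, abs_norm,
      abs_of_pos hr0, abs_of_pos hr0']
    rw [show ‖𝓕 ψ₀ ξ‖ ^ 4 = ‖𝓕 ψ₀ ξ‖ ^ 2 * ‖𝓕 ψ₀ ξ‖ ^ 2 by ring, ← mul_assoc]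
    gcongr
    · exact e _
    · exact e _
    · exact hK ξ
  have h2 := fourier_radial_eq hrad hΦi w
  have h3 : S * ‖𝓕 Φ w‖ = ‖∫ ξ, sphereCos ((2 * Real.pi * ‖w‖) • ξ) * Φ ξ‖ := by
    rw [← h2, norm_mul, Complex.norm_real, Real.norm_of_nonneg measureReal_nonneg]
  have h4 : ‖∫ ξ, sphereCos ((2 * Real.pi * ‖w‖) • ξ) * Φ ξ‖
      ≤ ∫ ξ, C₁ ^ 3 * C₂ ^ 2 * ((r * r') ^ a * ‖w‖ ^ (-a)) * ‖𝓕 ψ₀ ξ‖ ^ 2 := by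
    refine norm_integral_le_of_norm_le (hψ.fourier_integrable_sq.const_mul _)
      (.of_forall fun ξ => ?_)
    simp only [hΦ, Complex.norm_real, norm_mul, norm_pow, Real.norm_eq_abs, abs_norm,
      abs_of_pos hr0, abs_of_pos hr0']
    rcases eq_or_ne (𝓕 ψ₀ ξ) 0 with h0 | h0
    · simp [h0]
    have hpw (t : ℝ) (ht : 0 < t) : t ^ (d - 1) * t ^ (-a) = t ^ a := by
      rw [← Real.rpow_natCast, ← Real.rpow_add ht, Nat.cast_sub hd, ha]
      congr 1
      push_cast; ring
    -- The power bounds are singular at ξ = 0, but the transform of ψ₀ vanishes there.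
    rcases eq_or_ne ξ 0 with hξ | hξ
    · have e1 := hC₂ ξ
      obtain ⟨D, hD0, hD⟩ := hψ.exists_fourier_le_rpow (s := 1) (by simp) (by linarith)
      have e2 := hD ξ
      rw [hξ] at e2 h0
      simp at e2
      exact absurd e2 h0
    · have hξ0 : 0 < ‖ξ‖ := norm_pos_iff.2 hξ
      have b1 := hC₁ r hr0 ξ hξ
      have b2 := hC₁ r' hr0' ξ hξ
      have b3 := hC₁ ‖w‖ hw0 ξ hξ
      have b4 := hC₂ ξ
      have b5 : ‖𝓕 ψ₀ ξ‖ ^ 4 ≤ (C₂ * ‖ξ‖ ^ (3 * a / 2)) ^ 2 * ‖𝓕 ψ₀ ξ‖ ^ 2 := by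
        rw [show ‖𝓕 ψ₀ ξ‖ ^ 4 = ‖𝓕 ψ₀ ξ‖ ^ 2 * ‖𝓕 ψ₀ ξ‖ ^ 2 by ring]
        gcongr
      have b6 : ‖ξ‖ ^ (-a) * ‖ξ‖ ^ (-a) * ‖ξ‖ ^ (-a) * (‖ξ‖ ^ (3 * a / 2)) ^ 2 = 1 := by
        rw [← Real.rpow_natCast (‖ξ‖ ^ _), ← Real.rpow_mul hξ0.le, ← Real.rpow_add hξ0,
          ← Real.rpow_add hξ0, ← Real.rpow_add hξ0]
        convert Real.rpow_zero ‖ξ‖ using 2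
        push_cast; ring
      calc _ ≤ C₁ * (‖w‖ ^ (-a) * ‖ξ‖ ^ (-a)) * (r ^ (d - 1) * (C₁ * (r ^ (-a) * ‖ξ‖ ^ (-a))) *
            (r' ^ (d - 1) * (C₁ * (r' ^ (-a) * ‖ξ‖ ^ (-a)))) *
            ((C₂ * ‖ξ‖ ^ (3 * a / 2)) ^ 2 * ‖𝓕 ψ₀ ξ‖ ^ 2)) := by gcongr
        _ = C₁ ^ 3 * C₂ ^ 2 * ((r ^ (d - 1) * r ^ (-a)) * (r' ^ (d - 1) * r' ^ (-a)) * ‖w‖ ^ (-a)) *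
            ‖𝓕 ψ₀ ξ‖ ^ 2 *
            (‖ξ‖ ^ (-a) * ‖ξ‖ ^ (-a) * ‖ξ‖ ^ (-a) * (‖ξ‖ ^ (3 * a / 2)) ^ 2) := by ring
        _ = _ := by rw [b6, hpw r hr0, hpw r' hr0', Real.mul_rpow hr0.le hr0'.le]; ring
  rw [integral_const_mul] at h4
  calc ‖𝓕 Φ w‖ = (S * ‖𝓕 Φ w‖) / S := by field_simp
    _ ≤ (C₁ ^ 3 * C₂ ^ 2 * ((r * r') ^ a * ‖w‖ ^ (-a)) * I) / S :=
        div_le_div_of_nonneg_right (h3.trans_le h4) hSpos.le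
    _ = _ := by ring

/-- Translates by distinct points of a 1-separated set have disjoint supports, so they are
orthogonal pointwise. -/
theorem integral_norm_sq_sum_translates (Y : Finset (Space d))
    (hY : ∀ y ∈ Y, ∀ y' ∈ Y, y = y' ∨ 1 ≤ dist y y') (c : Space d → ℂ) :
    ∫ x, ‖∑ y ∈ Y, c y * ψ₀ (x - y)‖ ^ 2 = (∑ y ∈ Y, ‖c y‖ ^ 2) * ∫ x, ‖ψ₀ x‖ ^ 2 := by
  have hpt : ∀ x, ‖∑ y ∈ Y, c y * ψ₀ (x - y)‖ ^ 2 = ∑ y ∈ Y, ‖c y‖ ^ 2 * ‖ψ₀ (x - y)‖ ^ 2 := by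
    intro x
    by_cases h : ∃ y ∈ Y, ψ₀ (x - y) ≠ 0
    · obtain ⟨y, hy, hne⟩ := h
      have hz : ∀ y' ∈ Y, y' ≠ y → ψ₀ (x - y') = 0 := by
        intro y' hy' hyy
        by_contra hne'
        have h1 : ‖x - y‖ ≤ 1 / 10 := by by_contra! h'; exact hne (hψ.eq_zero h')
        have h2 : ‖x - y'‖ ≤ 1 / 10 := by by_contra! h'; exact hne' (hψ.eq_zero h')
        have h3 := (hY y' hy' y hy).resolve_left hyy
        have h4 := dist_triangle_left y' y x
        rw [dist_eq_norm x, dist_eq_norm x] at h4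
        linarith
      rw [Finset.sum_eq_single_of_mem y hy fun y' hy' hyy => by rw [hz y' hy' hyy, mul_zero],
        Finset.sum_eq_single_of_mem y hy fun y' hy' hyy => by simp [hz y' hy' hyy],
        norm_mul, mul_pow]
    · push Not at h
      rw [Finset.sum_eq_zero fun y hy => by rw [h y hy, mul_zero],
        Finset.sum_eq_zero fun y hy => by simp [h y hy]]
      simp
  simp_rw [hpt]
  have hi : Integrable (fun x => ‖ψ₀ x‖ ^ 2) := by
    refine Continuous.integrable_of_hasCompactSupport (by have := hψ.smooth.continuous; fun_prop) ?_
    refine hψ.hasCompactSupport.comp_left (g := fun z : ℂ => ‖z‖ ^ 2) (by simp)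
  rw [integral_finsetSum _ fun y _ => (hi.comp_sub_right y).const_mul _, Finset.sum_mul]
  refine Finset.sum_congr rfl fun y _ => ?_
  rw [integral_const_mul, integral_sub_right_eq_self (fun x => ‖ψ₀ x‖ ^ 2)]

/-- This is where ψ being a convolution square matters. One factor ψ₀ keeps the translates disjoint;
the other joins σ_r to form a Fourier multiplier bounded by O(r^((d-1)/2)). -/
theorem exists_integral_norm_sq_sum_sphereBump_le (hd : 1 ≤ d) : ∃ C : ℝ, 0 ≤ C ∧
    ∀ (Y : Finset (Space d)), (∀ y ∈ Y, ∀ y' ∈ Y, y = y' ∨ 1 ≤ dist y y') →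
      ∀ (c : Space d → ℂ) (r : ℝ), 1 ≤ r →
        ∫ x, ‖∑ y ∈ Y, c y * sphereBump ψ₀ y r x‖ ^ 2 ≤
          C * (r ^ (d - 1) * ∑ y ∈ Y, ‖c y‖ ^ 2) := by
  have hd1 : (1 : ℝ) ≤ d := by exact_mod_cast hd
  set a : ℝ := ((d : ℝ) - 1) / 2 with ha
  have ha0 : 0 ≤ a := by rw [ha]; linarith
  obtain ⟨C₁, hC₁0, hC₁⟩ := exists_abs_sphereCos_le_rpow hd
  obtain ⟨C₂, hC₂0, hC₂⟩ := hψ.exists_fourier_le_rpow (s := a) (by positivity)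
    (by rw [ha]; linarith)
  refine ⟨(C₁ * C₂) ^ 2 * ∫ x, ‖ψ₀ x‖ ^ 2, by positivity, fun Y hY c r hr => ?_⟩
  have hr0 : 0 < r := by linarith
  have hmult : ∀ ξ : Space d, r ^ (d - 1) * |sphereCos ((2 * Real.pi * r) • ξ)| * ‖𝓕 ψ₀ ξ‖
      ≤ C₁ * C₂ * r ^ a := by
    intro ξ
    rcases eq_or_ne ξ 0 with hξ | hξ
    · obtain ⟨D, hD0, hD⟩ := hψ.exists_fourier_le_rpow (s := 1) (by simp) (by linarith)
      have e2 := hD ξ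
      rw [hξ] at e2 ⊢
      simp only [norm_zero, Real.rpow_one, mul_zero, norm_le_zero_iff] at e2
      rw [e2, norm_zero, mul_zero]
      positivity
    · have hξ0 : 0 < ‖ξ‖ := norm_pos_iff.2 hξ
      calc _ ≤ r ^ (d - 1) * (C₁ * (r ^ (-a) * ‖ξ‖ ^ (-a))) * (C₂ * ‖ξ‖ ^ a) := by
            gcongr
            · exact hC₁ r hr0 ξ hξ
            · exact hC₂ ξ
        _ = C₁ * C₂ * (r ^ (d - 1) * r ^ (-a)) * (‖ξ‖ ^ (-a) * ‖ξ‖ ^ a) := by ring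
        _ = _ := by
          rw [← Real.rpow_natCast, ← Real.rpow_add hr0, ← Real.rpow_add hξ0, Nat.cast_sub hd, ha]
          rw [neg_add_cancel, Real.rpow_zero, mul_one]
          congr 2
          push_cast; ring
  have hF (y : Space d) := hψ.integrable_sphereBump y hr0.le
  have hT (y : Space d) : Integrable (fun x => ψ₀ (x - y)) := hψ.integrable.comp_sub_right y
  have hFT (y : Space d) : Integrable (𝓕 fun x => ψ₀ (x - y)) := by
    have : (𝓕 fun x => ψ₀ (x - y)) = fun ξ => Real.fourierChar (-inner ℝ y ξ) * 𝓕 ψ₀ ξ :=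
      funext fun ξ => fourier_translate ψ₀ y ξ
    rw [this]
    refine hψ.fourier_integrable.bdd_mul (c := 1) (Continuous.aestronglyMeasurable ?_) ?_
    · exact continuous_fourierChar_coe.comp (by fun_prop)
    · exact .of_forall fun q => (Circle.norm_coe _).le
  have hψc := hψ.smooth.continuous
  set g : Space d → ℂ := fun x => ∑ y ∈ Y, c y * ψ₀ (x - y) with hg
  set G : Space d → ℂ := fun x => ∑ y ∈ Y, c y * sphereBump ψ₀ y r x with hG
  have hgF : 𝓕 g = fun ξ => ∑ y ∈ Y, c y * 𝓕 (fun x => ψ₀ (x - y)) ξ :=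
    funext fun ξ => fourier_finset_sum Y c (fun y x => ψ₀ (x - y)) (fun y _ => hT y) ξ
  have hGF : 𝓕 G = fun ξ => ∑ y ∈ Y, c y * 𝓕 (sphereBump ψ₀ y r) ξ :=
    funext fun ξ => fourier_finset_sum Y c (fun y => sphereBump ψ₀ y r) (fun y _ => hF y) ξ
  have hgi : Integrable g := integrable_finsetSum _ fun y _ => (hT y).const_mul _
  have hGi : Integrable G := integrable_finsetSum _ fun y _ => (hF y).const_mul _
  have hgc : Continuous g := by fun_prop
  have hGc : Continuous G := continuous_finsetSum _ fun y _ =>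
    continuous_const.mul (hψ.continuous_sphereBump_right y r)
  have hgFi : Integrable (𝓕 g) := by
    rw [hgF]; exact integrable_finsetSum _ fun y _ => (hFT y).const_mul _
  have hGFi : Integrable (𝓕 G) := by
    rw [hGF]
    exact integrable_finsetSum _ fun y _ =>
      (hψ.integrable_fourier_sphereBump y hr0.le).const_mul _
  have hrel : ∀ ξ, 𝓕 G ξ =
      (r ^ (d - 1) * sphereCos ((2 * Real.pi * r) • ξ) : ℝ) * 𝓕 ψ₀ ξ * 𝓕 g ξ := by
    intro ξ
    rw [hgF, hGF]
    simp only [Finset.mul_sum]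
    refine Finset.sum_congr rfl fun y _ => ?_
    rw [hψ.fourier_sphereBump y hr0.le, fourier_translate]
    ring
  have hgL : Integrable (fun ξ => ‖𝓕 g ξ‖ ^ 2) := by
    obtain ⟨K, hK0, hK⟩ := exists_fourier_bound (ψ₀ := g)
    have hc := continuous_fourier hgi
    refine (hgFi.norm.const_mul K).mono' (by fun_prop) (.of_forall fun ξ => ?_)
    rw [Real.norm_of_nonneg (by positivity), sq]
    exact mul_le_mul_of_nonneg_right (hK ξ) (norm_nonneg _)
  calc ∫ x, ‖G x‖ ^ 2 = ∫ ξ, ‖𝓕 G ξ‖ ^ 2 := (integral_norm_sq_fourier hGi hGc hGFi).symm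
    _ ≤ ∫ ξ, (C₁ * C₂ * r ^ a) ^ 2 * ‖𝓕 g ξ‖ ^ 2 := by
        refine integral_mono_of_nonneg (.of_forall fun ξ => by positivity) (hgL.const_mul _)
          (.of_forall fun ξ => ?_)
        simp only
        rw [hrel, norm_mul, mul_pow, norm_mul, Complex.norm_real, norm_mul,
          Real.norm_of_nonneg (by positivity), Real.norm_eq_abs]
        refine mul_le_mul_of_nonneg_right ?_ (by positivity)
        exact pow_le_pow_left₀ (by positivity) (hmult ξ) 2
    _ = _ := by
        rw [integral_const_mul, integral_norm_sq_fourier hgi hgc hgFi,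
          hψ.integral_norm_sq_sum_translates Y hY c]
        have : (r ^ a) ^ 2 = r ^ (d - 1) := by
          rw [← Real.rpow_natCast, ← Real.rpow_natCast, ← Real.rpow_mul hr0.le, Nat.cast_sub hd, ha]
          congr 1
          push_cast; ring
        rw [mul_pow, this]
        ring

/-- `sphereBump` as an element of `L²`; it is zero for negative radii. -/
noncomputable def toL2 (q : Space d × ℝ) : Lp ℂ 2 (volume : Measure (Space d)) :=
  if h : 0 ≤ q.2 then
    MemLp.toLp (sphereBump ψ₀ q.1 q.2) ((hψ.continuous_sphereBump_right q.1 q.2).memLp_of_hasCompactSupport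
      (hψ.hasCompactSupport_sphereBump q.1 h))
  else 0

theorem coeFn_toL2 {q : Space d × ℝ} (hq : 0 ≤ q.2) :
    hψ.toL2 q =ᵐ[volume] sphereBump ψ₀ q.1 q.2 := by
  rw [toL2, dif_pos hq]
  exact MemLp.coeFn_toLp _

theorem inner_toL2 {q q' : Space d × ℝ} (hq : 0 ≤ q.2) (hq' : 0 ≤ q'.2) :
    inner ℂ (hψ.toL2 q) (hψ.toL2 q') =
      ∫ x, inner ℂ (sphereBump ψ₀ q.1 q.2 x) (sphereBump ψ₀ q'.1 q'.2 x) := by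
  rw [L2.inner_def]
  refine integral_congr_ae ?_
  filter_upwards [hψ.coeFn_toL2 hq, hψ.coeFn_toL2 hq'] with x h1 h2
  rw [h1, h2]

theorem coeFn_sum_toL2 (Q : Finset (Space d × ℝ)) (hQ : ∀ q ∈ Q, 0 ≤ q.2)
    (c : Space d × ℝ → ℂ) : (∑ q ∈ Q, c q • hψ.toL2 q : Lp ℂ 2 (volume : Measure (Space d)))
      =ᵐ[volume] fun x => ∑ q ∈ Q, c q * sphereBump ψ₀ q.1 q.2 x := by
  classical
  induction Q using Finset.induction_on with
  | empty =>
    simp only [Finset.sum_empty]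
    exact Lp.coeFn_zero _ _ _
  | insert q Q hqQ ih =>
    rw [Finset.sum_insert hqQ]
    filter_upwards [Lp.coeFn_add (c q • hψ.toL2 q) (∑ q ∈ Q, c q • hψ.toL2 q),
      Lp.coeFn_smul (c q) (hψ.toL2 q), hψ.coeFn_toL2 (hQ q (Finset.mem_insert_self _ _)),
      ih fun q hq => hQ q (Finset.mem_insert_of_mem hq)] with x h1 h2 h3 h4
    rw [h1, Pi.add_apply, h2, Pi.smul_apply, h3, h4, Finset.sum_insert hqQ, smul_eq_mul]

theorem lintegral_enorm_sq_sum_sphereBump (Q : Finset (Space d × ℝ)) (hQ : ∀ q ∈ Q, 0 ≤ q.2)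
    (c : Space d × ℝ → ℂ) :
    ∫⁻ x, ‖∑ q ∈ Q, c q * sphereBump ψ₀ q.1 q.2 x‖ₑ ^ (2 : ℝ)
      = ENNReal.ofReal (‖∑ q ∈ Q, c q • hψ.toL2 q‖ ^ 2) := by
  have h := coeFn_sum_toL2 hψ Q hQ c
  rw [ENNReal.ofReal_pow (norm_nonneg _), ofReal_norm, Lp.enorm_def, eLpNorm_congr_ae h,
    eLpNorm_eq_lintegral_rpow_enorm_toReal (by norm_num) (by norm_num), ← ENNReal.rpow_natCast,
    ← ENNReal.rpow_mul]
  simp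

theorem norm_sq_sum_toL2 (Q : Finset (Space d × ℝ)) (hQ : ∀ q ∈ Q, 0 ≤ q.2)
    (c : Space d × ℝ → ℂ) :
    ‖∑ q ∈ Q, c q • hψ.toL2 q‖ ^ 2 = ∫ x, ‖∑ q ∈ Q, c q * sphereBump ψ₀ q.1 q.2 x‖ ^ 2 := by
  have h := coeFn_sum_toL2 hψ Q hQ c
  have h2 := L2.inner_def (𝕜 := ℂ) (∑ q ∈ Q, c q • hψ.toL2 q) (∑ q ∈ Q, c q • hψ.toL2 q)
  simp only [inner_self_eq_norm_sq_to_K] at h2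
  apply Complex.ofRealLI.injective
  rw [← LinearIsometry.integral_comp_comm]
  simp only [Complex.ofRealLI_apply]
  refine Eq.trans (by simp) (h2.trans (integral_congr_ae ?_))
  filter_upwards [h] with x hx
  rw [hx]
  simp

/-- A point common to both annuli forces triangle inequalities between the two radii and the
distance of the centres; 2/5 is the sum of the half-widths. -/
theorem inner_toL2_ne_zero {q q' : Space d × ℝ} (hq : 0 ≤ q.2) (hq' : 0 ≤ q'.2)
    (h : inner ℂ (hψ.toL2 q) (hψ.toL2 q') ≠ 0) :
    |q.2 - q'.2| ≤ dist q.1 q'.1 + 2 / 5 ∧ |dist q.1 q'.1 - q.2| ≤ q'.2 + 2 / 5 := by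
  rw [hψ.inner_toL2 hq hq'] at h
  obtain ⟨x, hx⟩ : ∃ x, inner ℂ (sphereBump ψ₀ q.1 q.2 x) (sphereBump ψ₀ q'.1 q'.2 x) ≠ 0 := by
    by_contra! h'
    exact h (by simp only [h', integral_zero])
  have h1 : sphereBump ψ₀ q.1 q.2 x ≠ 0 := by rintro h0; simp [h0] at hx
  have h2 : sphereBump ψ₀ q'.1 q'.2 x ≠ 0 := by rintro h0; simp [h0] at hx
  have a1 := abs_le.1 (mem_annulus.1 (hψ.mem_annulus_of_sphereBump_ne_zero hq h1))
  have a2 := abs_le.1 (mem_annulus.1 (hψ.mem_annulus_of_sphereBump_ne_zero hq' h2))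
  have t1 := dist_triangle_left q.1 q'.1 x
  have t2 := dist_triangle x q.1 q'.1
  have t3 := dist_triangle_right x q.1 q'.1
  rw [dist_eq_norm x, dist_eq_norm x] at t1 t2 t3
  constructor <;> rw [abs_le] <;> constructor <;> linarith

end IsOscillatingBump

/-! ### Dyadic scales -/

section Scale

/-- The integer `k` with `2^k ≤ r < 2^(k+1)`, for `r ≥ 1`. -/
noncomputable def scale (r : ℝ) : ℕ := Nat.log 2 ⌊r⌋₊

theorem two_pow_scale_le {r : ℝ} (hr : 1 ≤ r) : (2 : ℝ) ^ scale r ≤ r := by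
  have h1 : ⌊r⌋₊ ≠ 0 := (Nat.floor_pos.2 hr).ne'
  have h2 : 2 ^ scale r ≤ ⌊r⌋₊ := Nat.pow_log_le_self 2 h1
  have h3 : ((2 ^ scale r : ℕ) : ℝ) ≤ ⌊r⌋₊ := by exact_mod_cast h2
  push_cast at h3
  exact h3.trans (Nat.floor_le (by linarith))

theorem lt_two_pow_scale (r : ℝ) : r < (2 : ℝ) ^ (scale r + 1) := by
  have h2 : ⌊r⌋₊ < 2 ^ (scale r + 1) := Nat.lt_pow_succ_log_self one_lt_two _
  have h3 := Nat.lt_of_floor_lt h2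
  exact_mod_cast h3

theorem le_scale {r : ℝ} {n : ℕ} (h : (2 : ℝ) ^ n ≤ r) : n ≤ scale r := by
  by_contra! h'
  have : (2 : ℝ) ^ (scale r + 1) ≤ 2 ^ n := pow_le_pow_right₀ one_le_two h'
  linarith [lt_two_pow_scale r]

theorem scale_le {r : ℝ} {n : ℕ} (hr : 1 ≤ r) (h : r < (2 : ℝ) ^ (n + 1)) : scale r ≤ n := by
  by_contra! h'
  have : (2 : ℝ) ^ (n + 1) ≤ 2 ^ scale r := pow_le_pow_right₀ one_le_two h'
  linarith [two_pow_scale_le hr]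

end Scale

/-! ### Grids and counting -/

section Grid

variable {d : ℕ}

/-- A finite subset of a product of a `1`-separated set of centres and a `1`-separated set of
radii that are at least `1`. -/
structure IsGrid (Q : Finset (Space d × ℝ)) : Prop where
  fst : ∀ q ∈ Q, ∀ q' ∈ Q, q.1 = q'.1 ∨ 1 ≤ dist q.1 q'.1
  snd : ∀ q ∈ Q, ∀ q' ∈ Q, q.2 = q'.2 ∨ 1 ≤ dist q.2 q'.2
  one_le : ∀ q ∈ Q, 1 ≤ q.2

theorem IsGrid.subset {Q Q' : Finset (Space d × ℝ)} (h : IsGrid Q) (hQ : Q' ⊆ Q) : IsGrid Q' :=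
  ⟨fun q hq q' hq' => h.fst q (hQ hq) q' (hQ hq'), fun q hq q' hq' => h.snd q (hQ hq) q' (hQ hq'),
    fun q hq => h.one_le q (hQ hq)⟩

/-- Numbers at distance at least 1 have different integer parts. Radii can thus be counted, and sums
over them compared with sums over ℕ. -/
theorem IsGrid.floor_injOn {Q : Finset (Space d × ℝ)} (h : IsGrid Q) :
    Set.InjOn (fun r : ℝ => ⌊r⌋₊) (Q.image Prod.snd : Finset ℝ) := by
  intro r hr r' hr' he
  simp only [Finset.coe_image, Set.mem_image, Finset.mem_coe] at hr hr'
  obtain ⟨q, hq, rfl⟩ := hr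
  obtain ⟨q', hq', rfl⟩ := hr'
  refine (h.snd q hq q' hq').resolve_right ?_
  simp only at he
  have h0 := h.one_le q hq
  have h0' := h.one_le q' hq'
  have h1 := Nat.floor_le (a := q.2) (by linarith)
  have h2 := Nat.lt_floor_add_one q.2
  have h3 := Nat.floor_le (a := q'.2) (by linarith)
  have h4 := Nat.lt_floor_add_one q'.2
  rw [he] at h1 h2
  rw [Real.dist_eq, not_le, abs_lt]
  constructor <;> linarith

/-- At each scale, balls of radius `2^l` contain at most `2^(ν+1+l)` points of `Q`. -/
def HasDensityLE (Q : Finset (Space d × ℝ)) (ν : ℕ) : Prop :=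
  ∀ q ∈ Q, ∀ l ≤ scale q.2 + 2,
    (Q.filter fun q' => scale q'.2 = scale q.2 ∧ dist q q' ≤ 2 ^ l).card ≤ 2 ^ (ν + 1 + l)

theorem HasDensityLE.subset {Q Q' : Finset (Space d × ℝ)} {ν : ℕ} (h : HasDensityLE Q ν)
    (hQ : Q' ⊆ Q) : HasDensityLE Q' ν := fun q hq l hl =>
  (Finset.card_le_card (Finset.filter_subset_filter _ hQ)).trans (h q (hQ hq) l hl)

/-- A set of diameter at most 2^l lies in the ball of that radius about any of its points. -/
theorem HasDensityLE.card_le {Q : Finset (Space d × ℝ)} {ν : ℕ} (h : HasDensityLE Q ν)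
    {P : Finset (Space d × ℝ)} (hP : P ⊆ Q) {k l : ℕ} (hk : ∀ q ∈ P, scale q.2 = k)
    (hl : l ≤ k + 2) (hd : ∀ q ∈ P, ∀ q' ∈ P, dist q q' ≤ 2 ^ l) : P.card ≤ 2 ^ (ν + 1 + l) := by
  rcases P.eq_empty_or_nonempty with rfl | ⟨q, hq⟩
  · simp
  · refine (Finset.card_le_card fun q' hq' => ?_).trans (h q (hP hq) l (by rw [hk q hq]; exact hl))
    rw [Finset.mem_filter]
    exact ⟨hP hq', by rw [hk q hq, hk q' hq'], hd q hq q' hq'⟩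

/-- Integrating the overlap function of the balls, which is at most M and lives on A. -/
theorem card_mul_volume_le {ι : Type*} (P : Finset ι) (f : ι → Space d) (ρ : ℝ) (M : ℕ)
    {A : Set (Space d)} (hA : MeasurableSet A)
    (hM : ∀ z, (P.filter fun i => dist z (f i) ≤ ρ).card ≤ M)
    (hsub : ∀ i ∈ P, Metric.closedBall (f i) ρ ⊆ A) :
    P.card * volume (Metric.closedBall (0 : Space d) ρ) ≤ M * volume A := by
  calc P.card * volume (Metric.closedBall (0 : Space d) ρ)
      = ∑ i ∈ P, volume (Metric.closedBall (f i) ρ) := by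
        rw [Finset.sum_congr rfl fun i _ => Measure.addHaar_closedBall_center volume (f i) ρ]
        simp
    _ = ∫⁻ z, ∑ i ∈ P, (Metric.closedBall (f i) ρ).indicator 1 z := by
        rw [lintegral_finsetSum _ fun i _ => measurable_one.indicator measurableSet_closedBall]
        exact Finset.sum_congr rfl fun i _ => (lintegral_indicator_one measurableSet_closedBall).symm
    _ ≤ ∫⁻ z, A.indicator (fun _ => (M : ℝ≥0∞)) z := by
        refine lintegral_mono fun z => ?_
        by_cases hz : z ∈ A
        · rw [indicator_of_mem hz]
          have : ∑ i ∈ P, (Metric.closedBall (f i) ρ).indicator (1 : Space d → ℝ≥0∞) z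
              = ((P.filter fun i => dist z (f i) ≤ ρ).card : ℝ≥0∞) := by
            rw [Finset.card_filter]
            push_cast
            refine Finset.sum_congr rfl fun i _ => ?_
            by_cases hi : dist z (f i) ≤ ρ
            · rw [if_pos hi, indicator_of_mem (Metric.mem_closedBall.2 hi)]
              rfl
            · rw [if_neg hi, indicator_of_notMem (fun h => hi (Metric.mem_closedBall.1 h))]
          rw [this]
          exact Nat.cast_le.2 (hM z)
        · rw [indicator_of_notMem hz, Finset.sum_eq_zero]
          intro i hi
          rw [indicator_of_notMem]
          exact fun h => hz (hsub i hi h)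
    _ = M * volume A := lintegral_indicator_const hA _

/-- The points of one scale whose centres lie in an annulus of radius `r`. -/
theorem HasDensityLE.card_annulus_le (hd : 1 ≤ d) {Q : Finset (Space d × ℝ)} {ν : ℕ}
    (h : HasDensityLE Q ν) (hQ1 : ∀ q ∈ Q, 1 ≤ q.2)
    {P : Finset (Space d × ℝ)} (hP : P ⊆ Q) {k : ℕ} (hk : ∀ q ∈ P, scale q.2 = k)
    {y : Space d} {r : ℝ} (hr : 2 ^ k ≤ r) (hy : ∀ q ∈ P, q.1 ∈ annulus y r (2 ^ (k + 2))) :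
    (P.card : ℝ) ≤ 40 * d * 6 ^ (d - 1) * (2 ^ ν * 2 ^ k * r ^ (d - 1) / (2 ^ k) ^ (d - 1)) := by
  set t : ℝ := 2 ^ k with ht
  have ht0 : 0 < t := by positivity
  have hr0 : 0 < r := ht0.trans_le hr
  have hUpos := unitBallVol_pos d
  -- Balls of radius t = 2^k about the centres stay in the annulus of half-width 4t + t. Points
  -- whose centres are within t of a common z have pairwise distance at most 2t in ℝ^d × ℝ, since
  -- radii of one scale differ by less than t, so the overlap is controlled by the density at
  -- 2^(k+1).
  have key := card_mul_volume_le P Prod.fst t (2 ^ (ν + 1 + (k + 1)))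
    (measurableSet_annulus y r (5 * t)) (fun z => ?_) (fun q hq x hx => ?_)
  · rw [volume_closedBall_eq _ ht0.le] at key
    have key2 := key.trans (mul_le_mul_right (volume_annulus_le hd y hr0.le (by positivity)) _)
    rw [show (P.card : ℝ≥0∞) = ENNReal.ofReal P.card by simp,
      show ((2 ^ (ν + 1 + (k + 1)) : ℕ) : ℝ≥0∞) = ENNReal.ofReal (2 ^ (ν + 1 + (k + 1))) by
        rw [ENNReal.ofReal_pow (by positivity)]; simp,
      ← ENNReal.ofReal_mul (by positivity), ← ENNReal.ofReal_mul (by positivity),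
      ENNReal.ofReal_le_ofReal_iff (by positivity)] at key2
    have h1 : t ^ d = t * t ^ (d - 1) := by rw [← pow_succ', Nat.sub_add_cancel hd]
    have h2 : (2 : ℝ) ^ (ν + 1 + (k + 1)) = 4 * 2 ^ ν * t := by rw [ht]; ring
    have h3 : (r + 5 * t) ^ (d - 1) ≤ 6 ^ (d - 1) * r ^ (d - 1) := by
      rw [← mul_pow]; gcongr; linarith
    have h4 : (P.card : ℝ) * (t * t ^ (d - 1) * unitBallVol d) ≤
        4 * 2 ^ ν * t * (2 * d * unitBallVol d * (5 * t) * (6 ^ (d - 1) * r ^ (d - 1))) := by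
      rw [← h1, ← h2]
      refine key2.trans ?_
      gcongr
    have h5 : (P.card : ℝ) * t ^ (d - 1) ≤ 40 * d * 6 ^ (d - 1) * (2 ^ ν * t * r ^ (d - 1)) := by
      refine le_of_mul_le_mul_right (a := t * unitBallVol d) ?_ (by positivity)
      calc _ = (P.card : ℝ) * (t * t ^ (d - 1) * unitBallVol d) := by ring
        _ ≤ _ := h4
        _ = _ := by ring
    rw [← mul_div_assoc, le_div_iff₀ (by positivity)]
    exact h5
  · refine h.card_le ((Finset.filter_subset _ _).trans hP)
      (fun q hq => hk q (Finset.mem_of_mem_filter q hq)) (by omega) ?_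
    intro q hq q' hq'
    rw [Finset.mem_filter] at hq hq'
    rw [Prod.dist_eq, max_le_iff]
    constructor
    · have := dist_triangle_left q.1 q'.1 z
      rw [pow_succ]
      linarith [hq.2, hq'.2]
    · have a1 := two_pow_scale_le (hQ1 q (hP hq.1))
      have a2 := two_pow_scale_le (hQ1 q' (hP hq'.1))
      have a3 := lt_two_pow_scale q.2
      have a4 := lt_two_pow_scale q'.2
      rw [hk q hq.1] at a1 a3
      rw [hk q' hq'.1] at a2 a4
      have a5 : (0 : ℝ) < 2 ^ k := by positivity
      rw [Real.dist_eq, abs_le]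
      constructor <;> linarith
  · have h1 := mem_annulus.1 (hy q hq)
    rw [mem_closedBall_iff_norm] at hx
    rw [mem_annulus]
    have h2 := norm_sub_norm_le (x - y) (q.1 - y)
    have h3 := norm_sub_norm_le (q.1 - y) (x - y)
    rw [sub_sub_sub_cancel_right] at h2 h3
    rw [norm_sub_rev q.1 x] at h3
    have h4 : (2 : ℝ) ^ (k + 2) = 4 * t := by rw [ht]; ring
    rw [h4] at h1
    rw [abs_le] at h1 ⊢
    constructor <;> linarith

/-- The sum is grouped by the level f, and the levels start at N, so the geometric tail from N is
gained. It is applied with f a dyadic scale. -/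
theorem sum_le_geometric {ι : Type*} (S : Finset ι) (f : ι → ℕ) (N : ℕ) {β M : ℝ} (hβ0 : 0 ≤ β)
    (hβ1 : β < 1) (hM : 0 ≤ M) (hf : ∀ i ∈ S, N ≤ f i) (w : ι → ℝ)
    (h : ∀ l, N ≤ l → ∑ i ∈ S with f i = l, w i ≤ M * β ^ l) :
    ∑ i ∈ S, w i ≤ M * (β ^ N / (1 - β)) := by
  classical
  rw [← Finset.sum_fiberwise_of_maps_to (t := S.image f) (g := f)
    (fun i hi => Finset.mem_image_of_mem f hi)]
  have h1 : ∀ l ∈ S.image f, N ≤ l := by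
    intro l hl
    obtain ⟨i, hi, rfl⟩ := Finset.mem_image.1 hl
    exact hf i hi
  calc ∑ l ∈ S.image f, ∑ i ∈ S with f i = l, w i
      ≤ ∑ l ∈ S.image f, M * β ^ l := Finset.sum_le_sum fun l hl => h l (h1 l hl)
    _ = M * ∑ l ∈ S.image f, β ^ l := by rw [Finset.mul_sum]
    _ ≤ _ := by
        refine mul_le_mul_of_nonneg_left ?_ hM
        have hs : Summable fun n : ℕ => β ^ (N + n) := by
          simp_rw [pow_add]
          exact (summable_geometric_of_lt_one hβ0 hβ1).mul_left _
        have ht : ∑' n : ℕ, β ^ (N + n) = β ^ N / (1 - β) := by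
          simp_rw [pow_add]
          rw [tsum_mul_left, tsum_geometric_of_lt_one hβ0 hβ1, div_eq_mul_inv]
        rw [← ht]
        have hinj : Set.InjOn (fun l => l - N) (S.image f : Finset ℕ) := by
          intro l hl l' hl' he
          have := h1 l hl
          have := h1 l' hl'
          simp only at he
          omega
        have : ∑ l ∈ S.image f, β ^ l = ∑ n ∈ (S.image f).image (fun l => l - N), β ^ (N + n) := by
          rw [Finset.sum_image hinj]
          refine Finset.sum_congr rfl fun l hl => ?_
          rw [Nat.add_sub_cancel' (h1 l hl)]
        rw [this]
        exact hs.sum_le_tsum _ fun _ _ => by positivity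

end Grid

/-! ### The L² estimate for families of bounded density -/

section AlmostOrthogonal

variable {d : ℕ} {H : Type*} [NormedAddCommGroup H] [InnerProductSpace ℂ H]

/-- The almost orthogonality properties of the family of functions `F_{y,r}`. -/
structure IsAlmostOrthogonal (Q : Finset (Space d × ℝ)) (u : Space d × ℝ → H) (C : ℝ) : Prop where
  nonneg : 0 ≤ C
  fiber : ∀ S ⊆ Q, ∀ r, 1 ≤ r → (∀ q ∈ S, q.2 = r) →
    ‖∑ q ∈ S, u q‖ ^ 2 ≤ C * (r ^ (d - 1) * S.card)
  inner_le : ∀ q ∈ Q, ∀ q' ∈ Q, q.1 ≠ q'.1 → ‖(inner ℂ (u q) (u q') : ℂ)‖ ≤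
    C * ((q.2 * q'.2) ^ (((d : ℝ) - 1) / 2) * dist q.1 q'.1 ^ (-(((d : ℝ) - 1) / 2)))
  of_inner_ne_zero : ∀ q ∈ Q, ∀ q' ∈ Q, (inner ℂ (u q) (u q') : ℂ) ≠ 0 →
    |q.2 - q'.2| ≤ dist q.1 q'.1 + 2 / 5 ∧ |dist q.1 q'.1 - q.2| ≤ q'.2 + 2 / 5

theorem IsAlmostOrthogonal.subset {Q Q' : Finset (Space d × ℝ)} {u : Space d × ℝ → H} {C : ℝ}
    (h : IsAlmostOrthogonal Q u C) (hQ : Q' ⊆ Q) : IsAlmostOrthogonal Q' u C :=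
  ⟨h.nonneg, fun S hS => h.fiber S (hS.trans hQ),
    fun q hq q' hq' => h.inner_le q (hQ hq) q' (hQ hq'),
    fun q hq q' hq' => h.of_inner_ne_zero q (hQ hq) q' (hQ hq')⟩

/-- Radii in an interval of length `M`: Cauchy-Schwarz over the radii. -/
theorem IsAlmostOrthogonal.block {Q : Finset (Space d × ℝ)} {u : Space d × ℝ → H} {C : ℝ}
    (h : IsAlmostOrthogonal Q u C) (hQ : IsGrid Q) {m M : ℕ}
    (hr : ∀ q ∈ Q, m ≤ q.2 ∧ q.2 < m + M) :
    ‖∑ q ∈ Q, u q‖ ^ 2 ≤ C * (M * ∑ q ∈ Q, q.2 ^ (d - 1)) := by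
  classical
  set R := Q.image Prod.snd with hR
  have hcard : R.card ≤ M := by
    have h1 : R.card ≤ (Finset.Ico m (m + M)).card := by
      refine Finset.card_le_card_of_injOn (fun r => ⌊r⌋₊) (fun r hr' => ?_) hQ.floor_injOn
      obtain ⟨q, hq, rfl⟩ := Finset.mem_image.1 (Finset.mem_coe.1 hr')
      have h0 := hQ.one_le q hq
      simp only [Finset.coe_Ico, mem_Ico]
      refine ⟨Nat.le_floor (hr q hq).1, ?_⟩
      rw [Nat.floor_lt (by linarith)]
      push_cast
      exact (hr q hq).2
    simpa using h1
  have hmaps : ∀ q ∈ Q, q.2 ∈ R := fun q hq => Finset.mem_image_of_mem _ hq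
  rw [← Finset.sum_fiberwise_of_maps_to hmaps]
  calc ‖∑ r ∈ R, ∑ q ∈ Q with q.2 = r, u q‖ ^ 2
      ≤ (∑ r ∈ R, ‖∑ q ∈ Q with q.2 = r, u q‖) ^ 2 := by
        gcongr; exact norm_sum_le _ _
    _ ≤ R.card * ∑ r ∈ R, ‖∑ q ∈ Q with q.2 = r, u q‖ ^ 2 := sq_sum_le_card_mul_sum_sq
    _ ≤ M * ∑ r ∈ R, C * ∑ q ∈ Q with q.2 = r, q.2 ^ (d - 1) := by
        gcongr with r hr'
        obtain ⟨q₀, hq₀, rfl⟩ := Finset.mem_image.1 hr'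
        refine (h.fiber _ (Finset.filter_subset _ _) q₀.2 (hQ.one_le _ hq₀)
          fun q hq => (Finset.mem_filter.1 hq).2).trans (le_of_eq ?_)
        congr 1
        rw [Finset.sum_congr rfl fun q hq => by rw [(Finset.mem_filter.1 hq).2]]
        simp [mul_comm]
    _ = _ := by
        rw [← Finset.mul_sum, Finset.sum_fiberwise_of_maps_to hmaps]
        ring

/-- With a = (d-1)/2 the condition reads d > 3: this is where the dimension makes the dyadic sums
converge. -/
theorem two_rpow_one_sub_lt_one {a : ℝ} (ha : 1 < a) : (2 : ℝ) ^ (1 - a) < 1 :=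
  Real.rpow_lt_one_of_one_lt_of_neg one_lt_two (by linarith)

theorem two_pow_mul_rpow (a : ℝ) (k : ℕ) :
    (2 : ℝ) ^ k * ((2 : ℝ) ^ k) ^ (-a) = ((2 : ℝ) ^ (1 - a)) ^ k := by
  have h0 : (0 : ℝ) < 2 ^ k := by positivity
  calc (2 : ℝ) ^ k * ((2 : ℝ) ^ k) ^ (-a) = ((2 : ℝ) ^ k) ^ (1 + -a) := by
        rw [Real.rpow_add h0, Real.rpow_one]
    _ = _ := by
        rw [← Real.rpow_natCast, ← Real.rpow_natCast, ← Real.rpow_mul zero_le_two,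
          ← Real.rpow_mul zero_le_two, mul_comm, ← sub_eq_add_neg]

/-- The interactions of a fixed `q` with the points of smaller radius, far away from it. -/
theorem exists_sum_inner_far_le (hd : 4 ≤ d) : ∃ K : ℝ, 0 ≤ K ∧
    ∀ (Q : Finset (Space d × ℝ)) (u : Space d × ℝ → H) (C : ℝ) (ν N : ℕ),
      IsAlmostOrthogonal Q u C → IsGrid Q → HasDensityLE Q ν →
      (2 : ℝ) ^ ν ≤ ((2 : ℝ) ^ N) ^ (((d : ℝ) - 1) / 2) → (∀ q ∈ Q, 2 ^ N ≤ q.2) →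
      ∀ q ∈ Q, ∑ q' ∈ Q with 2 ^ N ≤ q.2 - q'.2, ‖(inner ℂ (u q) (u q') : ℂ)‖
        ≤ K * (C * (2 ^ N * q.2 ^ (d - 1))) := by
  classical
  have hd4 : (4 : ℝ) ≤ d := by exact_mod_cast hd
  set a : ℝ := ((d : ℝ) - 1) / 2 with ha
  have ha1 : 1 < a := by rw [ha]; linarith
  set β : ℝ := (2 : ℝ) ^ (1 - a) with hβ
  have hβ0 : 0 < β := by positivity
  have hβ1 : β < 1 := two_rpow_one_sub_lt_one ha1
  have hβ1' : 0 < 1 - β := by linarith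
  set KA : ℝ := 40 * d * 6 ^ (d - 1) * 10 ^ a with hKA
  set KB : ℝ := 16 * 5 ^ a with hKB
  refine ⟨(KA + KB) / (1 - β), by positivity, fun Q u C ν N h hQ hD hν hN q hq => ?_⟩
  have hC := h.nonneg
  set y := q.1
  set r := q.2
  have hr1 : 1 ≤ r := hQ.one_le q hq
  have hr0 : 0 < r := by linarith
  have hr2a : r ^ a * r ^ a = r ^ (d - 1) := by
    rw [← Real.rpow_natCast, ← Real.rpow_add hr0, Nat.cast_sub (by omega), ha]
    congr 1
    push_cast; ring
  -- Vanishing inner products are dropped, so that the geometric constraints of intersecting annuli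
  -- hold on all of `T`.
  set T := Q.filter fun q' => 2 ^ N ≤ r - q'.2 ∧ (inner ℂ (u q) (u q') : ℂ) ≠ 0 with hT
  have hTsum : ∑ q' ∈ Q with 2 ^ N ≤ q.2 - q'.2, ‖(inner ℂ (u q) (u q') : ℂ)‖
      = ∑ q' ∈ T, ‖(inner ℂ (u q) (u q') : ℂ)‖ := by
    rw [hT, ← Finset.filter_filter]
    refine (Finset.sum_filter_of_ne fun q' _ hne => ?_).symm
    simpa using hne
  rw [hTsum]
  have hTQ : T ⊆ Q := Finset.filter_subset _ _
  have h1N : (1 : ℝ) ≤ 2 ^ N := one_le_pow₀ one_le_two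
  -- basic geometry of the points of `T`
  have hgeo : ∀ q' ∈ T, 1 ≤ q'.2 ∧ 2 ^ N ≤ r - q'.2 ∧ r - q'.2 ≤ dist y q'.1 + 2 / 5 ∧
      |dist y q'.1 - r| ≤ q'.2 + 2 / 5 ∧ dist q q' ≤ 5 / 3 * dist y q'.1 ∧ 2 ^ N ≤ dist q q' ∧
      r - q'.2 ≤ dist q q' ∧
      ‖(inner ℂ (u q) (u q') : ℂ)‖ ≤ C * ((r ^ a * q'.2 ^ a) * dist y q'.1 ^ (-a)) := by
    intro q' hq'
    rw [hT, Finset.mem_filter] at hq'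
    obtain ⟨hq'Q, hfar, hne⟩ := hq'
    obtain ⟨g1, g2⟩ := h.of_inner_ne_zero q hq q' hq'Q hne
    have g0 := hQ.one_le q' hq'Q
    have g3 : q.2 - q'.2 ≤ dist q.1 q'.1 + 2 / 5 := (le_abs_self _).trans g1
    have g4 : dist q.2 q'.2 = r - q'.2 := by rw [Real.dist_eq, abs_of_nonneg]; linarith
    -- Since 1 ≤ r - q'.2 ≤ D + 2/5 for D the distance of the centres, D ≥ 3/5 and hence D + 2/5 ≤
    -- 5D/3.
    have g5 : dist q q' ≤ 5 / 3 * dist y q'.1 := by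
      rw [Prod.dist_eq, g4, max_le_iff]
      have := dist_nonneg (x := y) (y := q'.1)
      constructor <;> linarith
    have g6 : r - q'.2 ≤ dist q q' := by
      rw [Prod.dist_eq, g4]; exact le_max_right _ _
    refine ⟨g0, hfar, g3, g2, g5, hfar.trans g6, g6, ?_⟩
    have hne' : y ≠ q'.1 := by
      intro he
      rw [← dist_eq_zero] at he
      linarith
    have := h.inner_le q hq q' hq'Q hne'
    rwa [Real.mul_rpow hr0.le (by linarith)] at this
  have hMnn : 0 ≤ C * (2 ^ ν * r ^ (d - 1)) := by positivity
  -- far points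
  have hA : ∑ q' ∈ T with ¬ dist q q' ≤ 2 ^ scale q'.2, ‖(inner ℂ (u q) (u q') : ℂ)‖
      ≤ KA * (C * (2 ^ ν * r ^ (d - 1))) * (β ^ N / (1 - β)) := by
    refine sum_le_geometric _ (fun q' => scale q'.2) N hβ0.le hβ1 (by positivity)
      (fun q' hq' => ?_) _ (fun k hk => ?_)
    · exact le_scale (hN q' (hTQ (Finset.mem_of_mem_filter q' hq')))
    · set P := (T.filter fun q' => ¬ dist q q' ≤ 2 ^ scale q'.2).filter fun q' => scale q'.2 = k
        with hP
      have hPT : P ⊆ T := (Finset.filter_subset _ _).trans (Finset.filter_subset _ _)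
      have hPk : ∀ q' ∈ P, scale q'.2 = k := fun q' hq' => (Finset.mem_filter.1 hq').2
      set t : ℝ := 2 ^ k with ht
      have ht0 : 0 < t := by positivity
      have hterm : ∀ q' ∈ P, ‖(inner ℂ (u q) (u q') : ℂ)‖ ≤ C * (10 ^ a * t ^ a) ∧
          q'.1 ∈ annulus y r (2 ^ (k + 2)) ∧ t ≤ r := by
        intro q' hq'
        obtain ⟨g0, g1, g2, g3, g4, g5, g6, g7⟩ := hgeo q' (hPT hq')
        have hbig : t < dist q q' := by
          have := (Finset.mem_filter.1 (Finset.mem_filter.1 hq').1).2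
          rwa [hPk q' hq', not_le] at this
        have hk1 := two_pow_scale_le g0
        have hk2 := lt_two_pow_scale q'.2
        rw [hPk q' hq'] at hk1 hk2
        have hk2' : q'.2 ≤ 2 * t := by rw [ht]; rw [pow_succ] at hk2; linarith
        have ht1 : 1 ≤ t := one_le_pow₀ one_le_two
        -- Here r ≤ q'.2 + D + 2/5 with q'.2 ≤ 2t, t < 5D/3 and D ≥ 3/5. So r^a D^(-a) is bounded
        -- and each term is O(t^a); the annulus count then leaves 2^ν r^(d-1) t^(1-a) for the scale
        -- t.
        have hrD : r ≤ 5 * dist y q'.1 := by linarith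
        refine ⟨g7.trans ?_, ?_, by linarith⟩
        · refine mul_le_mul_of_nonneg_left ?_ hC
          have hD0 : 0 < dist y q'.1 := by linarith
          calc r ^ a * q'.2 ^ a * dist y q'.1 ^ (-a)
              ≤ (5 * dist y q'.1) ^ a * (2 * t) ^ a * dist y q'.1 ^ (-a) := by gcongr
            _ = 10 ^ a * t ^ a * (dist y q'.1 ^ a * dist y q'.1 ^ (-a)) := by
                rw [Real.mul_rpow (by norm_num) hD0.le, Real.mul_rpow (by norm_num) ht0.le,
                  show (10 : ℝ) = 5 * 2 by norm_num, Real.mul_rpow (by norm_num) (by norm_num)]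
                ring
            _ = _ := by rw [← Real.rpow_add hD0, add_neg_cancel, Real.rpow_zero, mul_one]
        · rw [mem_annulus, ← dist_eq_norm, dist_comm]
          refine g3.trans ?_
          have : (2 : ℝ) ^ (k + 2) = 4 * t := by rw [ht]; ring
          linarith
      rcases P.eq_empty_or_nonempty with hPe | ⟨q₀, hq₀⟩
      · rw [hPe, Finset.sum_empty]; positivity
      have htr := (hterm q₀ hq₀).2.2
      have hcard := hD.card_annulus_le (by omega) hQ.one_le (hPT.trans hTQ) hPk htr
        fun q' hq' => (hterm q' hq').2.1
      calc ∑ q' ∈ P, ‖(inner ℂ (u q) (u q') : ℂ)‖ ≤ P.card • (C * (10 ^ a * t ^ a)) :=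
            Finset.sum_le_card_nsmul _ _ _ fun q' hq' => (hterm q' hq').1
        _ ≤ (40 * d * 6 ^ (d - 1) * (2 ^ ν * t * r ^ (d - 1) / t ^ (d - 1))) *
              (C * (10 ^ a * t ^ a)) := by
            rw [nsmul_eq_mul]; gcongr
        _ = KA * (C * (2 ^ ν * r ^ (d - 1))) * (t * (t ^ a / t ^ (d - 1))) := by
            rw [hKA]; ring
        _ = _ := by
            have e : t ^ a / t ^ (d - 1) = t ^ (-a) := by
              rw [← Real.rpow_natCast, ← Real.rpow_sub ht0, Nat.cast_sub (by omega), ha]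
              congr 1; push_cast; ring
            rw [e, ht, two_pow_mul_rpow]
  -- near points
  have hB : ∑ q' ∈ T with dist q q' ≤ 2 ^ scale q'.2, ‖(inner ℂ (u q) (u q') : ℂ)‖
      ≤ KB * (C * (2 ^ ν * r ^ (d - 1))) * (β ^ N / (1 - β)) := by
    refine sum_le_geometric _ (fun q' => scale (dist q q')) N hβ0.le hβ1 (by positivity)
      (fun q' hq' => ?_) _ (fun l hl => ?_)
    · exact le_scale (hgeo q' (Finset.mem_of_mem_filter q' hq')).2.2.2.2.2.1
    · set P := (T.filter fun q' => dist q q' ≤ 2 ^ scale q'.2).filter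
        fun q' => scale (dist q q') = l with hP
      have hPT : P ⊆ T := (Finset.filter_subset _ _).trans (Finset.filter_subset _ _)
      set t : ℝ := 2 ^ l with ht
      have ht0 : 0 < t := by positivity
      have hterm : ∀ q' ∈ P, ‖(inner ℂ (u q) (u q') : ℂ)‖ ≤ C * (5 ^ a * r ^ (d - 1) * t ^ (-a)) ∧
          l ≤ scale q'.2 ∧ dist q q' ≤ 2 * t ∧
          (scale q'.2 = scale r ∨ scale q'.2 = scale r - 1) := by
        intro q' hq'
        obtain ⟨g0, g1, g2, g3, g4, g5, g6, g7⟩ := hgeo q' (hPT hq')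
        have hsmall := (Finset.mem_filter.1 (Finset.mem_filter.1 hq').1).2
        have hl' : scale (dist q q') = l := (Finset.mem_filter.1 hq').2
        have hk1 := two_pow_scale_le g0
        have hk2 := lt_two_pow_scale q'.2
        have hl1 := two_pow_scale_le (h1N.trans g5)
        have hl2 := lt_two_pow_scale (dist q q')
        rw [hl'] at hl1 hl2
        have hll : l ≤ scale q'.2 := by
          rw [← pow_le_pow_iff_right₀ (one_lt_two (α := ℝ))]; linarith
        refine ⟨g7.trans ?_, hll, by rw [ht]; rw [pow_succ] at hl2; linarith, ?_⟩
        · refine mul_le_mul_of_nonneg_left ?_ hC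
          have hD0 : t / 5 ≤ dist y q'.1 := by linarith
          calc r ^ a * q'.2 ^ a * dist y q'.1 ^ (-a)
              ≤ r ^ a * r ^ a * (t / 5) ^ (-a) := by
                refine mul_le_mul ?_ ?_ (by positivity) (by positivity)
                · gcongr; linarith
                · exact Real.rpow_le_rpow_of_nonpos (by positivity) hD0 (by linarith)
            _ = _ := by
                rw [hr2a, Real.div_rpow ht0.le (by norm_num),
                  Real.rpow_neg (show (0 : ℝ) ≤ 5 by norm_num), div_inv_eq_mul]
                ring
        -- A point this close satisfies r ≤ q'.2 + dist q q' < 4 · 2^(scale q'.2), so only two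
        -- scales occur.
        · have s1 : scale q'.2 ≤ scale r := le_scale (hk1.trans (by linarith))
          have s2 : scale r ≤ scale q'.2 + 1 := by
            refine scale_le hr1 ?_
            rw [pow_succ]
            linarith
          omega
      -- Points within 2t of q are within 4t = 2^(l+2) of each other. As l is at most their scale,
      -- this explains the range `scale q.2 + 2` in `HasDensityLE`.
      have hcard : P.card ≤ 2 * 2 ^ (ν + 1 + (l + 2)) := by
        have hsplit : P ⊆ (P.filter fun q' => scale q'.2 = scale r) ∪
            (P.filter fun q' => scale q'.2 = scale r - 1) := by
          intro q' hq'
          exact Finset.mem_union.2 ((hterm q' hq').2.2.2.imp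
            (fun h => Finset.mem_filter.2 ⟨hq', h⟩) (fun h => Finset.mem_filter.2 ⟨hq', h⟩))
        have hone : ∀ k, (P.filter fun q' => scale q'.2 = k).card ≤ 2 ^ (ν + 1 + (l + 2)) := by
          intro k
          rcases (P.filter fun q' => scale q'.2 = k).eq_empty_or_nonempty with he | ⟨q₀, hq₀⟩
          · rw [he]; simp
          refine hD.card_le (((Finset.filter_subset _ _).trans hPT).trans hTQ)
            (fun q' hq' => (Finset.mem_filter.1 hq').2) ?_ ?_
          · have := (hterm q₀ (Finset.mem_filter.1 hq₀).1).2.1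
            rw [(Finset.mem_filter.1 hq₀).2] at this
            omega
          · intro q₁ hq₁ q₂ hq₂
            have b1 := (hterm q₁ (Finset.mem_filter.1 hq₁).1).2.2.1
            have b2 := (hterm q₂ (Finset.mem_filter.1 hq₂).1).2.2.1
            have b3 := dist_triangle_left q₁ q₂ q
            have : (2 : ℝ) ^ (l + 2) = 4 * t := by rw [ht]; ring
            linarith
        calc P.card ≤ _ := Finset.card_le_card hsplit
          _ ≤ _ := Finset.card_union_le _ _
          _ ≤ 2 ^ (ν + 1 + (l + 2)) + 2 ^ (ν + 1 + (l + 2)) := add_le_add (hone _) (hone _)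
          _ = _ := by ring
      have hcard' : (P.card : ℝ) ≤ 16 * 2 ^ ν * t := by
        have : (P.card : ℝ) ≤ ((2 * 2 ^ (ν + 1 + (l + 2)) : ℕ) : ℝ) := by exact_mod_cast hcard
        refine this.trans (le_of_eq ?_)
        rw [ht]; push_cast; ring
      calc ∑ q' ∈ P, ‖(inner ℂ (u q) (u q') : ℂ)‖
          ≤ P.card • (C * (5 ^ a * r ^ (d - 1) * t ^ (-a))) :=
            Finset.sum_le_card_nsmul _ _ _ fun q' hq' => (hterm q' hq').1
        _ ≤ (16 * 2 ^ ν * t) * (C * (5 ^ a * r ^ (d - 1) * t ^ (-a))) := by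
            rw [nsmul_eq_mul]; gcongr
        _ = KB * (C * (2 ^ ν * r ^ (d - 1))) * (t * t ^ (-a)) := by rw [hKB]; ring
        _ = _ := by rw [ht, two_pow_mul_rpow]
  rw [← Finset.sum_filter_add_sum_filter_not T (fun q' => dist q q' ≤ 2 ^ scale q'.2)]
  -- β^N = 2^N · 2^(-aN), and the assumption on N is that 2^(aN) outweighs the density 2^ν.
  have hfin : 2 ^ ν * β ^ N ≤ 2 ^ N := by
    rw [hβ, ← two_pow_mul_rpow]
    have hp : (0 : ℝ) < 2 ^ N := by positivity
    calc (2 : ℝ) ^ ν * (2 ^ N * (2 ^ N) ^ (-a)) ≤ (2 ^ N) ^ a * (2 ^ N * (2 ^ N) ^ (-a)) := by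
          gcongr
      _ = 2 ^ N * ((2 ^ N) ^ a * (2 ^ N) ^ (-a)) := by ring
      _ = 2 ^ N := by rw [← Real.rpow_add hp, add_neg_cancel, Real.rpow_zero, mul_one]
  calc _ ≤ KB * (C * (2 ^ ν * r ^ (d - 1))) * (β ^ N / (1 - β))
        + KA * (C * (2 ^ ν * r ^ (d - 1))) * (β ^ N / (1 - β)) := add_le_add hB hA
    _ = (KA + KB) / (1 - β) * (C * ((2 ^ ν * β ^ N) * r ^ (d - 1))) := by ring
    _ ≤ _ := by gcongr

/-- Expanding the square, the pairs within a block reassemble to a norm, which keeps its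
cancellation; only pairs from different blocks are estimated in absolute value. -/
theorem norm_sq_sum_le_blocks {ι κ : Type*} [DecidableEq κ] (T : Finset ι)
    (f : ι → κ) (u : ι → H) :
    ‖∑ i ∈ T, u i‖ ^ 2 ≤ ∑ b ∈ T.image f, ‖∑ i ∈ T with f i = b, u i‖ ^ 2
      + ∑ i ∈ T, ∑ j ∈ T with f j ≠ f i, ‖(inner ℂ (u i) (u j) : ℂ)‖ := by
  have h1 : ((‖∑ i ∈ T, u i‖ ^ 2 : ℝ) : ℂ) = ∑ i ∈ T, ∑ j ∈ T, inner ℂ (u i) (u j) := by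
    have := inner_self_eq_norm_sq_to_K (𝕜 := ℂ) (∑ i ∈ T, u i)
    rw [sum_inner] at this
    simp only [inner_sum] at this
    rw [this]
    push_cast
    rfl
  have h2 : ∑ i ∈ T, ∑ j ∈ T with f j = f i, inner ℂ (u i) (u j)
      = ((∑ b ∈ T.image f, ‖∑ i ∈ T with f i = b, u i‖ ^ 2 : ℝ) : ℂ) := by
    rw [← Finset.sum_fiberwise_of_maps_to (t := T.image f) (g := f)
      (fun i hi => Finset.mem_image_of_mem f hi)]
    push_cast
    refine Finset.sum_congr rfl fun b _ => ?_
    have := inner_self_eq_norm_sq_to_K (𝕜 := ℂ) (∑ i ∈ T with f i = b, u i)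
    rw [sum_inner] at this
    simp only [inner_sum] at this
    refine Eq.trans (Finset.sum_congr rfl fun i hi => ?_) this
    rw [(Finset.mem_filter.1 hi).2]
  have h3 : ((‖∑ i ∈ T, u i‖ ^ 2 : ℝ) : ℂ)
      = ((∑ b ∈ T.image f, ‖∑ i ∈ T with f i = b, u i‖ ^ 2 : ℝ) : ℂ)
        + ∑ i ∈ T, ∑ j ∈ T with f j ≠ f i, inner ℂ (u i) (u j) := by
    rw [h1, ← h2, ← Finset.sum_add_distrib]
    refine Finset.sum_congr rfl fun i _ => ?_
    rw [Finset.sum_filter_add_sum_filter_not]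
  have h4 : 0 ≤ ∑ b ∈ T.image f, ‖∑ i ∈ T with f i = b, u i‖ ^ 2 := by positivity
  calc ‖∑ i ∈ T, u i‖ ^ 2 = ‖((‖∑ i ∈ T, u i‖ ^ 2 : ℝ) : ℂ)‖ := by
        rw [Complex.norm_real, Real.norm_of_nonneg (by positivity)]
    _ ≤ _ := by
        rw [h3]
        refine (norm_add_le _ _).trans ?_
        rw [Complex.norm_real, Real.norm_of_nonneg h4]
        gcongr
        refine (norm_sum_le _ _).trans (Finset.sum_le_sum fun i _ => norm_sum_le _ _)

/-- Radii are cut into blocks of length 2^N. Inside a block Cauchy-Schwarz over the radii costs 2^N.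
Between blocks that are not adjacent the far interactions are summable, and N is large enough that
the density does not show beyond the same factor 2^N. -/
theorem exists_norm_sq_sum_le (hd : 4 ≤ d) : ∃ K : ℝ, 0 ≤ K ∧
    ∀ (Q : Finset (Space d × ℝ)) (u : Space d × ℝ → H) (C : ℝ) (ν N : ℕ),
      IsAlmostOrthogonal Q u C → IsGrid Q → HasDensityLE Q ν →
      (2 : ℝ) ^ ν ≤ ((2 : ℝ) ^ N) ^ (((d : ℝ) - 1) / 2) →
      ‖∑ q ∈ Q, u q‖ ^ 2 ≤ K * (C * (2 ^ N * ∑ q ∈ Q, q.2 ^ (d - 1))) := by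
  classical
  obtain ⟨K₀, hK₀, hfar⟩ := exists_sum_inner_far_le (H := H) hd
  refine ⟨3 * (1 + 2 * K₀), by positivity, fun Q u C ν N h hQ hD hν => ?_⟩
  have hC := h.nonneg
  have hNpos : (0 : ℝ) < 2 ^ N := by positivity
  set b : Space d × ℝ → ℕ := fun q => ⌊q.2 / 2 ^ N⌋₊ with hb
  have hblock : ∀ T ⊆ Q, ∀ m, (∀ q ∈ T, b q = m) →
      ‖∑ q ∈ T, u q‖ ^ 2 ≤ C * (2 ^ N * ∑ q ∈ T, q.2 ^ (d - 1)) := by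
    intro T hT m hm
    have := (h.subset hT).block (hQ.subset hT) (m := m * 2 ^ N) (M := 2 ^ N) (fun q hq => ?_)
    · push_cast at this; exact this
    · have h1 := hm q hq
      have h0 := hQ.one_le q (hT hq)
      have h2 := Nat.floor_le (a := q.2 / 2 ^ N) (by positivity)
      have h3 := Nat.lt_floor_add_one (q.2 / 2 ^ N)
      simp only [hb] at h1
      rw [h1] at h2 h3
      rw [le_div_iff₀ hNpos] at h2
      rw [div_lt_iff₀ hNpos] at h3
      push_cast
      constructor <;> linarith
  have hsep : ∀ T ⊆ Q, (∀ q ∈ T, 1 ≤ b q) → (∀ q ∈ T, ∀ q' ∈ T, b q' ≠ b q →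
      b q + 2 ≤ b q' ∨ b q' + 2 ≤ b q) →
      ‖∑ q ∈ T, u q‖ ^ 2 ≤ (1 + 2 * K₀) * (C * (2 ^ N * ∑ q ∈ T, q.2 ^ (d - 1))) := by
    intro T hT h1 h2
    have hTfar := fun q hq => hfar T u C ν N (h.subset hT) (hQ.subset hT) (hD.subset hT) hν
      (fun q hq => by
        have h0 := hQ.one_le q (hT hq)
        have h3 := h1 q hq
        have h4 := (Nat.le_floor_iff (by positivity)).1 h3
        rw [le_div_iff₀ hNpos] at h4
        simpa using h4) q hq
    refine (norm_sq_sum_le_blocks T b u).trans ?_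
    have hnear : ∑ m ∈ T.image b, ‖∑ i ∈ T with b i = m, u i‖ ^ 2
        ≤ C * (2 ^ N * ∑ q ∈ T, q.2 ^ (d - 1)) := by
      rw [← Finset.sum_fiberwise_of_maps_to (t := T.image b) (g := b)
        (fun i hi => Finset.mem_image_of_mem b hi), Finset.mul_sum, Finset.mul_sum]
      exact Finset.sum_le_sum fun m _ => hblock _ ((Finset.filter_subset _ _).trans hT) m
        fun q hq => (Finset.mem_filter.1 hq).2
    -- Block indices differing by two guarantee a full block between the radii, as the far estimate
    -- demands.
    have hfloor : ∀ q ∈ T, ∀ q' ∈ T, b q' + 2 ≤ b q → 2 ^ N ≤ q.2 - q'.2 := by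
      intro q hq q' hq' hle
      have e1 := Nat.floor_le (a := q.2 / 2 ^ N) (by have := hQ.one_le q (hT hq); positivity)
      have e2 := Nat.lt_floor_add_one (q'.2 / 2 ^ N)
      have e3 : (b q' : ℝ) + 2 ≤ b q := by exact_mod_cast hle
      simp only [hb] at e3
      have e4 : q'.2 / 2 ^ N + 1 ≤ q.2 / 2 ^ N := by linarith
      rw [div_add_one hNpos.ne', div_le_div_iff_of_pos_right hNpos] at e4
      linarith
    have hsplit : ∑ i ∈ T, ∑ j ∈ T with b j ≠ b i, ‖(inner ℂ (u i) (u j) : ℂ)‖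
        ≤ ∑ i ∈ T, ∑ j ∈ T with 2 ^ N ≤ i.2 - j.2, ‖(inner ℂ (u i) (u j) : ℂ)‖
          + ∑ i ∈ T, ∑ j ∈ T with 2 ^ N ≤ j.2 - i.2, ‖(inner ℂ (u i) (u j) : ℂ)‖ := by
      rw [← Finset.sum_add_distrib]
      refine Finset.sum_le_sum fun i hi => ?_
      rw [Finset.sum_filter, Finset.sum_filter, Finset.sum_filter, ← Finset.sum_add_distrib]
      refine Finset.sum_le_sum fun j hj => ?_
      by_cases hij : b j ≠ b i
      · rw [if_pos hij]
        rcases h2 i hi j hj hij with h3 | h3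
        · rw [if_pos (hfloor j hj i hi h3)]
          exact le_add_of_nonneg_left (by split_ifs <;> positivity)
        · rw [if_pos (hfloor i hi j hj h3)]
          exact le_add_of_nonneg_right (by split_ifs <;> positivity)
      · rw [if_neg hij]
        refine add_nonneg ?_ ?_ <;> split_ifs <;> positivity
    -- The far estimate treats partners of smaller radius; symmetry of the inner product covers the
    -- others.
    have hswap : ∑ i ∈ T, ∑ j ∈ T with 2 ^ N ≤ j.2 - i.2, ‖(inner ℂ (u i) (u j) : ℂ)‖
        = ∑ i ∈ T, ∑ j ∈ T with 2 ^ N ≤ i.2 - j.2, ‖(inner ℂ (u i) (u j) : ℂ)‖ := by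
      simp only [Finset.sum_filter]
      rw [Finset.sum_comm]
      refine Finset.sum_congr rfl fun i _ => Finset.sum_congr rfl fun j _ => ?_
      rw [norm_inner_symm]
    rw [hswap] at hsplit
    have hone : ∑ i ∈ T, ∑ j ∈ T with 2 ^ N ≤ i.2 - j.2, ‖(inner ℂ (u i) (u j) : ℂ)‖
        ≤ K₀ * (C * (2 ^ N * ∑ q ∈ T, q.2 ^ (d - 1))) := by
      rw [Finset.mul_sum, Finset.mul_sum, Finset.mul_sum]
      exact Finset.sum_le_sum fun q hq => hTfar q hq
    linarith
  -- Block 0 is set apart because the far estimate needs radii at least 2^N. Among the rest, blocks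
  -- of equal parity are never adjacent.
  set Q₀ := Q.filter fun q => b q = 0
  set Q₁ := (Q.filter fun q => ¬ b q = 0).filter fun q => Even (b q)
  set Q₂ := (Q.filter fun q => ¬ b q = 0).filter fun q => ¬ Even (b q)
  have hQ₁ : Q₁ ⊆ Q := (Finset.filter_subset _ _).trans (Finset.filter_subset _ _)
  have hQ₂ : Q₂ ⊆ Q := (Finset.filter_subset _ _).trans (Finset.filter_subset _ _)
  have hdecomp (w : Space d × ℝ → H) :
      ∑ q ∈ Q, w q = ∑ q ∈ Q₀, w q + (∑ q ∈ Q₁, w q + ∑ q ∈ Q₂, w q) := by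
    rw [Finset.sum_filter_add_sum_filter_not, Finset.sum_filter_add_sum_filter_not]
  have hdecomp' (w : Space d × ℝ → ℝ) :
      ∑ q ∈ Q, w q = ∑ q ∈ Q₀, w q + (∑ q ∈ Q₁, w q + ∑ q ∈ Q₂, w q) := by
    rw [Finset.sum_filter_add_sum_filter_not, Finset.sum_filter_add_sum_filter_not]
  have b0 := hblock Q₀ (Finset.filter_subset _ _) 0 fun q hq => (Finset.mem_filter.1 hq).2
  have b1 := hsep Q₁ hQ₁
    (fun q hq => Nat.one_le_iff_ne_zero.2 (Finset.mem_filter.1 (Finset.mem_filter.1 hq).1).2)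
    (fun q hq q' hq' hne => by
      have e1 := (Finset.mem_filter.1 hq).2
      have e2 := (Finset.mem_filter.1 hq').2
      rw [Nat.even_iff] at e1 e2
      omega)
  have b2 := hsep Q₂ hQ₂
    (fun q hq => Nat.one_le_iff_ne_zero.2 (Finset.mem_filter.1 (Finset.mem_filter.1 hq).1).2)
    (fun q hq q' hq' hne => by
      have e1 := (Finset.mem_filter.1 hq).2
      have e2 := (Finset.mem_filter.1 hq').2
      rw [Nat.even_iff] at e1 e2
      omega)
  rw [hdecomp, hdecomp']
  set x := ∑ q ∈ Q₀, u q
  set y := ∑ q ∈ Q₁, u q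
  set z := ∑ q ∈ Q₂, u q
  have htri : ‖x + (y + z)‖ ^ 2 ≤ 3 * (‖x‖ ^ 2 + (‖y‖ ^ 2 + ‖z‖ ^ 2)) := by
    have e1 : ‖x + (y + z)‖ ≤ ‖x‖ + (‖y‖ + ‖z‖) :=
      (norm_add_le _ _).trans (by gcongr; exact norm_add_le _ _)
    have e2 : ‖x + (y + z)‖ ^ 2 ≤ (‖x‖ + (‖y‖ + ‖z‖)) ^ 2 := by gcongr
    nlinarith [sq_nonneg (‖x‖ - ‖y‖), sq_nonneg (‖x‖ - ‖z‖), sq_nonneg (‖y‖ - ‖z‖)]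
  have hb0' : ‖x‖ ^ 2 ≤ (1 + 2 * K₀) * (C * (2 ^ N * ∑ q ∈ Q₀, q.2 ^ (d - 1))) := by
    refine b0.trans (le_mul_of_one_le_left ?_ (by linarith))
    have : 0 ≤ ∑ q ∈ Q₀, q.2 ^ (d - 1) := Finset.sum_nonneg fun q hq => by
      have := hQ.one_le q (Finset.filter_subset _ _ hq); positivity
    positivity
  calc _ ≤ _ := htri
    _ ≤ 3 * ((1 + 2 * K₀) * (C * (2 ^ N * ∑ q ∈ Q₀, q.2 ^ (d - 1))) +
        ((1 + 2 * K₀) * (C * (2 ^ N * ∑ q ∈ Q₁, q.2 ^ (d - 1))) +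
          (1 + 2 * K₀) * (C * (2 ^ N * ∑ q ∈ Q₂, q.2 ^ (d - 1))))) := by gcongr
    _ = _ := by ring

end AlmostOrthogonal

/-! ### Decomposition by density -/

section Density

variable {d : ℕ}

/-- The points of `Q` of the scale of `q` at distance at most `2^l` from `q`. -/
noncomputable def nearby (Q : Finset (Space d × ℝ)) (q : Space d × ℝ) (l : ℕ) :
    Finset (Space d × ℝ) :=
  Q.filter fun q' => scale q'.2 = scale q.2 ∧ dist q q' ≤ 2 ^ l

open Classical in
/-- The binary logarithm of the density of `Q` near `q`. -/
noncomputable def densityLevel (Q : Finset (Space d × ℝ)) (q : Space d × ℝ) : ℕ :=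
  Nat.findGreatest (fun ν => ∃ l ≤ scale q.2 + 2, 2 ^ (ν + l) ≤ (nearby Q q l).card) Q.card

/-- The search for the greatest level does not fail: level 0 is always reached at l = 0 by q itself.
-/
theorem exists_le_card_nearby {Q : Finset (Space d × ℝ)} {q : Space d × ℝ} (hq : q ∈ Q) :
    ∃ l ≤ scale q.2 + 2, 2 ^ (densityLevel Q q + l) ≤ (nearby Q q l).card := by
  classical
  refine Nat.findGreatest_spec (P := fun ν => ∃ l ≤ scale q.2 + 2,
    2 ^ (ν + l) ≤ (nearby Q q l).card) (m := 0) (Nat.zero_le _) ⟨0, Nat.zero_le _, ?_⟩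
  have : q ∈ nearby Q q 0 := by simp [nearby, hq]
  simpa using Finset.card_pos.2 ⟨q, this⟩

/-- Maximality of the level. The cutoff `Q.card` in its definition is harmless, because 2^n > n
makes any higher level impossible. -/
theorem card_nearby_lt {Q : Finset (Space d × ℝ)} {q : Space d × ℝ} {l : ℕ}
    (hl : l ≤ scale q.2 + 2) : (nearby Q q l).card < 2 ^ (densityLevel Q q + 1 + l) := by
  classical
  by_contra! h
  by_cases hle : densityLevel Q q + 1 ≤ Q.card
  · have := Nat.le_findGreatest (P := fun ν => ∃ l ≤ scale q.2 + 2,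
      2 ^ (ν + l) ≤ (nearby Q q l).card) hle ⟨l, hl, h⟩
    have h2 : densityLevel Q q + 1 ≤ densityLevel Q q := this
    omega
  · have h1 : (nearby Q q l).card ≤ Q.card := Finset.card_filter_le _ _
    have h2 : densityLevel Q q + 1 + l < 2 ^ (densityLevel Q q + 1 + l) := Nat.lt_two_pow_self
    omega

/-- The part of `Q` of density comparable to `2^ν`. -/
noncomputable def densityPart (Q : Finset (Space d × ℝ)) (ν : ℕ) : Finset (Space d × ℝ) :=
  Q.filter fun q => densityLevel Q q = ν

theorem densityPart_subset (Q : Finset (Space d × ℝ)) (ν : ℕ) : densityPart Q ν ⊆ Q :=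
  Finset.filter_subset _ _

theorem hasDensityLE_densityPart (Q : Finset (Space d × ℝ)) (ν : ℕ) :
    HasDensityLE (densityPart Q ν) ν := by
  intro q hq l hl
  have h := card_nearby_lt (Q := Q) hl
  rw [(Finset.mem_filter.1 hq).2] at h
  exact (Finset.card_le_card (Finset.filter_subset_filter _ (densityPart_subset Q ν))).trans h.le

/-- The set where the functions of density level `ν` live is small. -/
theorem exists_volume_densityPart_le (hd : 1 ≤ d) : ∃ K : ℝ, 0 ≤ K ∧
    ∀ (Q : Finset (Space d × ℝ)) (ν : ℕ), IsGrid Q →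
      volume (⋃ q ∈ densityPart Q ν, annulus q.1 q.2 (1 / 5))
        ≤ ENNReal.ofReal (K * ((2 ^ ν)⁻¹ * ∑ q ∈ Q, q.2 ^ (d - 1))) := by
  classical
  have hU := unitBallVol_nonneg d
  refine ⟨22 * d * unitBallVol d * 90 ^ (d - 1), by positivity, fun Q ν hQ => ?_⟩
  set K : ℝ := 22 * d * unitBallVol d * 90 ^ (d - 1)
  have hex : ∀ q ∈ densityPart Q ν, ∃ l ≤ scale q.2 + 2, 2 ^ (ν + l) ≤ (nearby Q q l).card := by
    intro q hq
    have := exists_le_card_nearby (densityPart_subset Q ν hq)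
    rwa [(Finset.mem_filter.1 hq).2] at this
  choose! l hl hcard using hex
  have hbdd : ∀ q ∈ (densityPart Q ν : Set (Space d × ℝ)), (2 : ℝ) ^ l q ≤
      ∑ q' ∈ densityPart Q ν, (2 : ℝ) ^ l q' := fun q hq =>
    Finset.single_le_sum (f := fun q' => (2 : ℝ) ^ l q') (fun _ _ => by positivity)
      (Finset.mem_coe.1 hq)
  -- The balls in ℝ^d × ℝ that witness the crowding are thinned to disjoint ones, each still
  -- containing 2^(ν+l) points of Q; the fivefold enlargements cover the level.
  obtain ⟨W, hW, hdisj, hcov⟩ := Vitali.exists_disjoint_subfamily_covering_enlargement_closedBall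
    (densityPart Q ν : Set (Space d × ℝ)) (fun q => q) (fun q => (2 : ℝ) ^ l q) _ hbdd 5
    (by norm_num)
  lift W to Finset (Space d × ℝ) using (Finset.finite_toSet _).subset hW
  rw [Finset.coe_subset] at hW
  -- Moving q to b changes centre and radius by at most 5 · 2^l each, and 5 + 5 + 1/5 ≤ 11.
  have hincl : (⋃ q ∈ densityPart Q ν, annulus q.1 q.2 (1 / 5))
      ⊆ ⋃ b ∈ W, annulus b.1 b.2 (11 * 2 ^ l b) := by
    intro x hx
    obtain ⟨q, hq, hxq⟩ := mem_iUnion₂.1 hx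
    obtain ⟨b, hb, hqb⟩ := hcov q (Finset.mem_coe.2 hq)
    refine mem_iUnion₂.2 ⟨b, hb, ?_⟩
    have h1 : q ∈ Metric.closedBall b (5 * 2 ^ l b) :=
      hqb (Metric.mem_closedBall_self (by positivity))
    rw [Metric.mem_closedBall, Prod.dist_eq, max_le_iff, Real.dist_eq] at h1
    have h2 : (1 : ℝ) ≤ 2 ^ l b := one_le_pow₀ one_le_two
    have h3 := mem_annulus.1 hxq
    rw [mem_annulus]
    rw [← dist_eq_norm] at h3 ⊢
    have h4 := dist_triangle x q.1 b.1
    have h5 := dist_triangle_right x q.1 b.1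
    have h6 := h1.1
    have h7 := abs_le.1 h1.2
    rw [abs_le] at h3 ⊢
    constructor <;> linarith
  have hvol : ∀ b ∈ W, volume (annulus b.1 b.2 (11 * 2 ^ l b))
      ≤ ENNReal.ofReal (K * ((2 ^ ν)⁻¹ * ∑ q ∈ nearby Q b (l b), q.2 ^ (d - 1))) := by
    intro b hb
    have hb' := hW hb
    have h1 := hQ.one_le b (densityPart_subset Q ν hb')
    refine (volume_annulus_le hd b.1 (by linarith) (by positivity)).trans
      (ENNReal.ofReal_le_ofReal ?_)
    set t : ℝ := 2 ^ scale b.2 with ht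
    have ht1 := two_pow_scale_le h1
    have ht2 := lt_two_pow_scale b.2
    rw [pow_succ] at ht2
    have h3 : (2 : ℝ) ^ l b ≤ 4 * t := by
      calc (2 : ℝ) ^ l b ≤ 2 ^ (scale b.2 + 2) := pow_le_pow_right₀ one_le_two (hl b hb')
        _ = _ := by rw [ht]; ring
    -- One annulus of width 2^l pays for at least 2^(ν+l) points of the same scale: this is the gain
    -- 2^(-ν).
    have h4 : (2 ^ ν)⁻¹ * ∑ q ∈ nearby Q b (l b), q.2 ^ (d - 1) ≥ 2 ^ l b * t ^ (d - 1) := by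
      have e1 : (nearby Q b (l b)).card • t ^ (d - 1)
          ≤ ∑ q ∈ nearby Q b (l b), q.2 ^ (d - 1) := by
        refine Finset.card_nsmul_le_sum _ _ _ fun q hq => ?_
        have hq' := Finset.mem_filter.1 hq
        gcongr
        rw [ht, ← hq'.2.1]
        exact two_pow_scale_le (hQ.one_le q hq'.1)
      have e2 : (2 : ℝ) ^ (ν + l b) ≤ (nearby Q b (l b)).card := by exact_mod_cast hcard b hb'
      calc (2 : ℝ) ^ l b * t ^ (d - 1) = (2 ^ ν)⁻¹ * (2 ^ (ν + l b) * t ^ (d - 1)) := by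
            rw [pow_add]; field_simp
        _ ≤ (2 ^ ν)⁻¹ * ((nearby Q b (l b)).card * t ^ (d - 1)) := by gcongr
        _ ≤ _ := by rw [nsmul_eq_mul] at e1; gcongr
    calc 2 * d * unitBallVol d * (11 * 2 ^ l b) * (b.2 + 11 * 2 ^ l b) ^ (d - 1)
        ≤ 2 * d * unitBallVol d * (11 * 2 ^ l b) * (90 * t) ^ (d - 1) := by
          gcongr
          linarith
      _ = K * (2 ^ l b * t ^ (d - 1)) := by rw [mul_pow]; ring
      _ ≤ _ := by gcongr
  calc volume (⋃ q ∈ densityPart Q ν, annulus q.1 q.2 (1 / 5))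
      ≤ ∑ b ∈ W, volume (annulus b.1 b.2 (11 * 2 ^ l b)) :=
        (measure_mono hincl).trans (measure_biUnion_finset_le _ _)
    _ ≤ ∑ b ∈ W, ENNReal.ofReal (K * ((2 ^ ν)⁻¹ * ∑ q ∈ nearby Q b (l b), q.2 ^ (d - 1))) :=
        Finset.sum_le_sum hvol
    _ = ENNReal.ofReal (∑ b ∈ W, K * ((2 ^ ν)⁻¹ * ∑ q ∈ nearby Q b (l b), q.2 ^ (d - 1))) := by
        rw [ENNReal.ofReal_sum_of_nonneg]
        intro b _
        have : 0 ≤ ∑ q ∈ nearby Q b (l b), q.2 ^ (d - 1) := Finset.sum_nonneg fun q hq => by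
          have := hQ.one_le q (Finset.mem_filter.1 hq).1; positivity
        positivity
    _ ≤ _ := by
        refine ENNReal.ofReal_le_ofReal ?_
        rw [← Finset.mul_sum, ← Finset.mul_sum, ← Finset.sum_biUnion]
        · refine mul_le_mul_of_nonneg_left (mul_le_mul_of_nonneg_left ?_ (by positivity))
            (by positivity)
          refine Finset.sum_le_sum_of_subset_of_nonneg ?_ fun q hq _ => ?_
          · exact Finset.biUnion_subset.2 fun b _ => Finset.filter_subset _ _
          · have := hQ.one_le q hq; positivity
        -- Disjointness of the selected balls ensures that no point of Q is charged twice.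
        · intro b hb b' hb' hne
          refine Finset.disjoint_left.2 fun q hq hq' => ?_
          have hdis := hdisj hb hb' hne
          have m1 : q ∈ Metric.closedBall b (2 ^ l b) :=
            Metric.mem_closedBall'.2 (Finset.mem_filter.1 hq).2.2
          have m2 : q ∈ Metric.closedBall b' (2 ^ l b') :=
            Metric.mem_closedBall'.2 (Finset.mem_filter.1 hq').2.2
          exact Set.disjoint_left.1 hdis m1 m2

end Density

/-! ### The restricted strong type estimate -/

section Restricted

variable {d : ℕ} {ψ₀ : Space d → ℂ}

theorem IsOscillatingBump.exists_isAlmostOrthogonal (hψ : IsOscillatingBump ψ₀) (hd : 1 ≤ d) :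
    ∃ C : ℝ, 0 ≤ C ∧ ∀ (Q : Finset (Space d × ℝ)) (c : Space d × ℝ → ℂ), IsGrid Q →
      (∀ q ∈ Q, ‖c q‖ ≤ 1) → IsAlmostOrthogonal Q (fun q => c q • hψ.toL2 q) C := by
  classical
  obtain ⟨C₁, hC₁, h₁⟩ := hψ.exists_norm_integral_inner_sphereBump_le hd
  obtain ⟨C₂, hC₂, h₂⟩ := hψ.exists_integral_norm_sq_sum_sphereBump_le hd
  refine ⟨max C₁ C₂, by positivity, fun Q c hQ hc => ⟨by positivity, ?_, ?_, ?_⟩⟩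
  · intro S hS r hr1 hr
    have hS0 : ∀ q ∈ S, 0 ≤ q.2 := fun q hq => by linarith [hQ.one_le q (hS hq)]
    rw [hψ.norm_sq_sum_toL2 S hS0]
    have hinj : Set.InjOn Prod.fst (S : Set (Space d × ℝ)) := by
      intro q hq q' hq' he
      exact Prod.ext he ((hr q hq).trans (hr q' hq').symm)
    have hsum : ∀ x, ∑ q ∈ S, c q * sphereBump ψ₀ q.1 q.2 x
        = ∑ y ∈ S.image Prod.fst, c (y, r) * sphereBump ψ₀ y r x := by
      intro x
      rw [Finset.sum_image hinj]
      refine Finset.sum_congr rfl fun q hq => ?_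
      rw [← hr q hq]
    simp_rw [hsum]
    refine (h₂ _ ?_ (fun y => c (y, r)) r hr1).trans ?_
    · intro y hy y' hy'
      obtain ⟨q, hq, rfl⟩ := Finset.mem_image.1 hy
      obtain ⟨q', hq', rfl⟩ := Finset.mem_image.1 hy'
      exact hQ.fst q (hS hq) q' (hS hq')
    · have e1 : ∑ y ∈ S.image Prod.fst, ‖c (y, r)‖ ^ 2 ≤ S.card := by
        rw [Finset.sum_image hinj]
        refine (Finset.sum_le_card_nsmul S _ 1 fun q hq => ?_).trans (by simp)
        rw [← hr q hq]
        exact pow_le_one₀ (norm_nonneg _) (hc q (hS hq))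
      gcongr
      exact le_max_right _ _
  · intro q hq q' hq' hne
    have e1 := hQ.one_le q hq
    have e2 := hQ.one_le q' hq'
    rw [inner_smul_left, inner_smul_right, norm_mul, norm_mul, RCLike.norm_conj,
      hψ.inner_toL2 (by linarith) (by linarith), dist_comm, dist_eq_norm]
    have h3 := h₁ q.1 q'.1 q.2 q'.2 e1 e2 hne
    have e3 : 0 ≤ (q.2 * q'.2) ^ (((d : ℝ) - 1) / 2) * ‖q'.1 - q.1‖ ^ (-(((d : ℝ) - 1) / 2)) := by
      have : 0 ≤ q.2 * q'.2 := by positivity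
      positivity
    refine (mul_le_of_le_one_left (by positivity) (hc q hq)).trans
      ((mul_le_of_le_one_left (by positivity) (hc q' hq')).trans (h3.trans ?_))
    exact mul_le_mul_of_nonneg_right (le_max_left _ _) e3
  · intro q hq q' hq' hne
    have e1 := hQ.one_le q hq
    have e2 := hQ.one_le q' hq'
    refine hψ.inner_toL2_ne_zero (by linarith) (by linarith) fun h0 => hne ?_
    rw [inner_smul_left, inner_smul_right, h0]
    simp

/-- Hölder with exponents 2/s and its conjugate, against the indicator of the support. -/
theorem lintegral_rpow_le_of_support {α : Type*} [MeasurableSpace α] {μ : Measure α}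
    {f : α → ℂ} (hf : AEStronglyMeasurable f μ) {A : Set α} (hA : MeasurableSet A)
    (hfA : ∀ x ∉ A, f x = 0) {s : ℝ} (hs0 : 0 < s) (hs : s < 2) :
    ∫⁻ x, ‖f x‖ₑ ^ s ∂μ ≤ (∫⁻ x, ‖f x‖ₑ ^ (2 : ℝ) ∂μ) ^ (s / 2) * μ A ^ (1 - s / 2) := by
  have h1 : ∀ x, ‖f x‖ₑ ^ s = ‖f x‖ₑ ^ s * A.indicator (fun _ => 1) x := by
    intro x
    by_cases hx : x ∈ A
    · rw [indicator_of_mem hx, mul_one]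
    · rw [indicator_of_notMem hx, mul_zero, hfA x hx]
      simp [hs0]
  have hpq : (2 / s).HolderConjugate (1 - s / 2)⁻¹ := by
    rw [Real.holderConjugate_iff]
    constructor
    · rw [lt_div_iff₀ hs0]; linarith
    · rw [inv_inv, inv_div]; ring
  have h2 := ENNReal.lintegral_mul_le_Lp_mul_Lq μ hpq (f := fun x => ‖f x‖ₑ ^ s)
    (g := A.indicator (fun _ => 1)) (hf.enorm.pow_const _)
    (measurable_const.indicator hA).aemeasurable
  have h3 : ∀ x, (A.indicator (fun _ => (1 : ℝ≥0∞)) x) ^ (1 - s / 2)⁻¹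
      = A.indicator (fun _ => 1) x := by
    intro x
    by_cases hx : x ∈ A
    · simp [hx]
    · rw [indicator_of_notMem hx, ENNReal.zero_rpow_of_pos]
      exact inv_pos.2 (by linarith)
  have h4 : ∀ x, (‖f x‖ₑ ^ s) ^ (2 / s) = ‖f x‖ₑ ^ (2 : ℝ) := by
    intro x
    rw [← ENNReal.rpow_mul]
    congr 1
    field_simp
  simp_rw [Pi.mul_apply, h3, h4, ← h1] at h2
  rw [lintegral_indicator_const hA, one_mul, one_div_div, one_div, inv_inv] at h2
  exact h2

/-- With a = (d-1)/2, the L² bound grows like 2^(ν/a) and the support shrinks like 2^(-ν). Hölder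
gives the exponent s/(2a) - (1 - s/2) = s(d+1)/(2(d-1)) - 1 of 2^ν. -/
theorem IsOscillatingBump.exists_lintegral_densityPart_le (hψ : IsOscillatingBump ψ₀)
    (hd : 4 ≤ d) {s : ℝ} (hs0 : 0 < s) (hs2 : s < 2) :
    ∃ K : ℝ, 0 ≤ K ∧ ∀ (Q : Finset (Space d × ℝ)) (c : Space d × ℝ → ℂ) (ν : ℕ), IsGrid Q →
      (∀ q ∈ Q, ‖c q‖ ≤ 1) →
      ∫⁻ x, ‖∑ q ∈ densityPart Q ν, c q * sphereBump ψ₀ q.1 q.2 x‖ₑ ^ s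
        ≤ ENNReal.ofReal (K * ((2 : ℝ) ^ (s * ((d : ℝ) + 1) / (2 * ((d : ℝ) - 1)) - 1)) ^ ν *
          ∑ q ∈ Q, q.2 ^ (d - 1)) := by
  have hd4 : (4 : ℝ) ≤ d := by exact_mod_cast hd
  set a : ℝ := ((d : ℝ) - 1) / 2 with ha
  have ha0 : 0 < a := by rw [ha]; linarith
  obtain ⟨C, hC, horth⟩ := hψ.exists_isAlmostOrthogonal (by omega)
  obtain ⟨K₁, hK₁, h₁⟩ := exists_norm_sq_sum_le (d := d)
    (H := Lp ℂ 2 (volume : Measure (Space d))) hd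
  obtain ⟨K₂, hK₂, h₂⟩ := exists_volume_densityPart_le (d := d) (by omega)
  refine ⟨(K₁ * C * 2) ^ (s / 2) * K₂ ^ (1 - s / 2), by positivity, fun Q c ν hQ hc => ?_⟩
  set P := densityPart Q ν
  have hPQ : P ⊆ Q := densityPart_subset Q ν
  have hP := hQ.subset hPQ
  set S := ∑ q ∈ Q, q.2 ^ (d - 1) with hS
  have hS0 : 0 ≤ S := Finset.sum_nonneg fun q hq => by
    have := hQ.one_le q hq; positivity
  have hSP : ∑ q ∈ P, q.2 ^ (d - 1) ≤ S :=
    Finset.sum_le_sum_of_subset_of_nonneg hPQ fun q hq _ => by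
      have := hQ.one_le q hq; positivity
  -- The least N with 2^(aN) ≥ 2^ν; rounding up costs the factor 2 in `hNle`.
  set N := ⌈(ν : ℝ) / a⌉₊
  have hN1 : (ν : ℝ) / a ≤ N := Nat.le_ceil _
  have hN2 : (N : ℝ) ≤ ν / a + 1 := (Nat.ceil_lt_add_one (by positivity)).le
  have hν : (2 : ℝ) ^ ν ≤ ((2 : ℝ) ^ N) ^ a := by
    rw [← Real.rpow_natCast, ← Real.rpow_natCast, ← Real.rpow_mul zero_le_two]
    refine Real.rpow_le_rpow_of_exponent_le one_le_two ?_
    rwa [div_le_iff₀ ha0] at hN1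
  have hNle : (2 : ℝ) ^ N ≤ 2 * 2 ^ ((ν : ℝ) / a) := by
    rw [← Real.rpow_natCast]
    calc (2 : ℝ) ^ (N : ℝ) ≤ 2 ^ ((ν : ℝ) / a + 1) :=
          Real.rpow_le_rpow_of_exponent_le one_le_two hN2
      _ = _ := by rw [Real.rpow_add two_pos, Real.rpow_one, mul_comm]
  have hL2 : ∫⁻ x, ‖∑ q ∈ P, c q * sphereBump ψ₀ q.1 q.2 x‖ₑ ^ (2 : ℝ)
      ≤ ENNReal.ofReal (K₁ * C * 2 * (2 ^ ((ν : ℝ) / a) * S)) := by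
    rw [hψ.lintegral_enorm_sq_sum_sphereBump P (fun q hq => by linarith [hP.one_le q hq])]
    refine ENNReal.ofReal_le_ofReal ?_
    refine (h₁ P (fun q => c q • hψ.toL2 q) C ν N
      (horth P c hP fun q hq => hc q (hPQ hq)) hP (hasDensityLE_densityPart Q ν) hν).trans ?_
    calc K₁ * (C * (2 ^ N * ∑ q ∈ P, q.2 ^ (d - 1)))
        ≤ K₁ * (C * ((2 * 2 ^ ((ν : ℝ) / a)) * S)) := by
          refine mul_le_mul_of_nonneg_left (mul_le_mul_of_nonneg_left ?_ hC) hK₁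
          exact mul_le_mul hNle hSP (Finset.sum_nonneg fun q hq => by
            have := hP.one_le q hq; positivity) (by positivity)
      _ = _ := by ring
  have hA := h₂ Q ν hQ
  set A := ⋃ q ∈ P, annulus q.1 q.2 (1 / 5)
  have hAm : MeasurableSet A := Finset.measurableSet_biUnion _ fun q _ => measurableSet_annulus _ _ _
  have hcont : Continuous fun x => ∑ q ∈ P, c q * sphereBump ψ₀ q.1 q.2 x :=
    continuous_finsetSum _ fun q _ =>
      continuous_const.mul (hψ.continuous_sphereBump_right q.1 q.2)
  refine (lintegral_rpow_le_of_support hcont.aestronglyMeasurable hAm (fun x hx => ?_)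
    hs0 hs2).trans ?_
  · refine Finset.sum_eq_zero fun q hq => ?_
    have : sphereBump ψ₀ q.1 q.2 x = 0 := by
      by_contra h
      exact hx (mem_iUnion₂.2 ⟨q, hq, hψ.mem_annulus_of_sphereBump_ne_zero
        (by linarith [hP.one_le q hq]) h⟩)
    rw [this, mul_zero]
  · have hs' : 0 ≤ 1 - s / 2 := by linarith
    calc _ ≤ ENNReal.ofReal (K₁ * C * 2 * (2 ^ ((ν : ℝ) / a) * S)) ^ (s / 2) *
          ENNReal.ofReal (K₂ * ((2 ^ ν)⁻¹ * S)) ^ (1 - s / 2) := by gcongr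
      _ = ENNReal.ofReal ((K₁ * C * 2 * (2 ^ ((ν : ℝ) / a) * S)) ^ (s / 2) *
          (K₂ * ((2 ^ ν)⁻¹ * S)) ^ (1 - s / 2)) := by
          rw [ENNReal.ofReal_rpow_of_nonneg (by positivity) (by positivity),
            ENNReal.ofReal_rpow_of_nonneg (by positivity) hs', ENNReal.ofReal_mul (by positivity)]
      _ = _ := by
          congr 1
          rw [Real.mul_rpow (by positivity) (by positivity),
            Real.mul_rpow (x := (2 : ℝ) ^ ((ν : ℝ) / a)) (by positivity) hS0,
            Real.mul_rpow hK₂ (by positivity),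
            Real.mul_rpow (x := ((2 : ℝ) ^ ν)⁻¹) (by positivity) hS0]
          have e1 : S ^ (s / 2) * S ^ (1 - s / 2) = S := by
            rw [← Real.rpow_add_of_nonneg hS0 (by positivity) hs']
            simp
          have e2 : ((2 : ℝ) ^ ((ν : ℝ) / a)) ^ (s / 2) * (((2 : ℝ) ^ ν)⁻¹) ^ (1 - s / 2)
              = ((2 : ℝ) ^ (s * ((d : ℝ) + 1) / (2 * ((d : ℝ) - 1)) - 1)) ^ ν := by
            rw [← Real.rpow_natCast, ← Real.rpow_natCast, ← Real.rpow_neg zero_le_two,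
              ← Real.rpow_mul zero_le_two, ← Real.rpow_mul zero_le_two,
              ← Real.rpow_mul zero_le_two, ← Real.rpow_add two_pos]
            congr 1
            have : (d : ℝ) - 1 ≠ 0 := by linarith
            rw [ha]
            field_simp
            ring
          rw [← e2]
          linear_combination ((K₁ * C * 2) ^ (s / 2) * K₂ ^ (1 - s / 2) *
            (((2 : ℝ) ^ ((ν : ℝ) / a)) ^ (s / 2) * (((2 : ℝ) ^ ν)⁻¹) ^ (1 - s / 2))) * e1

/-- The restricted strong type estimate. -/
theorem IsOscillatingBump.exists_lintegral_sum_le (hψ : IsOscillatingBump ψ₀)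
    (hd : 4 ≤ d) {s : ℝ} (hs1 : 1 ≤ s) (hs : s < critExp d) :
    ∃ K : ℝ≥0, ∀ (Q : Finset (Space d × ℝ)) (c : Space d × ℝ → ℂ), IsGrid Q →
      (∀ q ∈ Q, ‖c q‖ ≤ 1) →
      ∫⁻ x, ‖∑ q ∈ Q, c q * sphereBump ψ₀ q.1 q.2 x‖ₑ ^ s
        ≤ K * ENNReal.ofReal (∑ q ∈ Q, q.2 ^ (d - 1)) := by
  have hd4 : (4 : ℝ) ≤ d := by exact_mod_cast hd
  have hs0 : 0 < s := by linarith
  rw [critExp, lt_div_iff₀ (by linarith)] at hs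
  have hs2 : s < 2 := by nlinarith
  obtain ⟨K, hK, h⟩ := hψ.exists_lintegral_densityPart_le hd hs0 hs2
  set θ : ℝ := (2 : ℝ) ^ (s * ((d : ℝ) + 1) / (2 * ((d : ℝ) - 1)) - 1) with hθ
  have hθ0 : 0 < θ := by positivity
  -- This is the only use of the critical exponent in summing the levels: the exponent is negative
  -- precisely for s < p_d.
  have hθ1 : θ < 1 := by
    refine Real.rpow_lt_one_of_one_lt_of_neg one_lt_two ?_
    rw [sub_neg, div_lt_one (by linarith)]
    linarith
  set η : ℝ := θ ^ (1 / s) with hη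
  have hη0 : 0 < η := by positivity
  have hη1 : η < 1 := Real.rpow_lt_one hθ0.le hθ1 (by positivity)
  refine ⟨Real.toNNReal (K * ((1 - η)⁻¹) ^ s), fun Q c hQ hc => ?_⟩
  set S := ∑ q ∈ Q, q.2 ^ (d - 1) with hS
  have hS0 : 0 ≤ S := Finset.sum_nonneg fun q hq => by
    have := hQ.one_le q hq; positivity
  set g : ℕ → Space d → ℂ := fun ν x =>
    ∑ q ∈ densityPart Q ν, c q * sphereBump ψ₀ q.1 q.2 x with hg
  have hgc : ∀ ν, Continuous (g ν) := fun ν => continuous_finsetSum _ fun q _ =>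
      continuous_const.mul (hψ.continuous_sphereBump_right q.1 q.2)
  set V := Q.image (densityLevel Q)
  have hsum : (fun x => ∑ q ∈ Q, c q * sphereBump ψ₀ q.1 q.2 x) = ∑ ν ∈ V, g ν := by
    ext x
    rw [Finset.sum_apply, ← Finset.sum_fiberwise_of_maps_to (t := V) (g := densityLevel Q)
      (fun q hq => Finset.mem_image_of_mem _ hq)]
    rfl
  have hs1' : (1 : ℝ≥0∞) ≤ ENNReal.ofReal s := by
    rw [← ENNReal.ofReal_one]; exact ENNReal.ofReal_le_ofReal hs1
  have hnorm (f : Space d → ℂ) : eLpNorm f (ENNReal.ofReal s) volume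
      = (∫⁻ x, ‖f x‖ₑ ^ s) ^ (1 / s) := by
    rw [eLpNorm_eq_lintegral_rpow_enorm_toReal (by simpa using hs0) ENNReal.ofReal_ne_top,
      ENNReal.toReal_ofReal hs0.le]
  have hν : ∀ ν, eLpNorm (g ν) (ENNReal.ofReal s) volume
      ≤ ENNReal.ofReal ((K * S) ^ (1 / s)) * ENNReal.ofReal (η ^ ν) := by
    intro ν
    rw [hnorm, ← ENNReal.ofReal_mul (by positivity)]
    calc _ ≤ (ENNReal.ofReal (K * θ ^ ν * S)) ^ (1 / s) := by
          gcongr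
          exact h Q c ν hQ hc
      _ = _ := by
          rw [ENNReal.ofReal_rpow_of_nonneg (by positivity) (by positivity), mul_right_comm,
            Real.mul_rpow (by positivity) (by positivity), hη, ← Real.rpow_natCast,
            ← Real.rpow_natCast, ← Real.rpow_mul hθ0.le, ← Real.rpow_mul hθ0.le,
            mul_comm (ν : ℝ)]
  -- Minkowski over the levels, which needs s ≥ 1; the norms decay like η^ν with η = θ^(1/s).
  have htot : eLpNorm (fun x => ∑ q ∈ Q, c q * sphereBump ψ₀ q.1 q.2 x) (ENNReal.ofReal s) volume
      ≤ ENNReal.ofReal ((K * S) ^ (1 / s) * (1 - η)⁻¹) := by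
    rw [hsum]
    refine (eLpNorm_sum_le (fun ν _ => (hgc ν).aestronglyMeasurable) hs1').trans ?_
    calc _ ≤ ∑ ν ∈ V, ENNReal.ofReal ((K * S) ^ (1 / s)) * ENNReal.ofReal (η ^ ν) :=
          Finset.sum_le_sum fun ν _ => hν ν
      _ = ENNReal.ofReal ((K * S) ^ (1 / s) * ∑ ν ∈ V, η ^ ν) := by
          rw [← Finset.mul_sum, ENNReal.ofReal_mul (by positivity),
            ENNReal.ofReal_sum_of_nonneg fun _ _ => by positivity]
      _ ≤ _ := by
          refine ENNReal.ofReal_le_ofReal (mul_le_mul_of_nonneg_left ?_ (by positivity))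
          rw [← tsum_geometric_of_lt_one hη0.le hη1]
          exact (summable_geometric_of_lt_one hη0.le hη1).sum_le_tsum _ fun _ _ => by positivity
  rw [hnorm] at htot
  calc _ = ((∫⁻ x, ‖∑ q ∈ Q, c q * sphereBump ψ₀ q.1 q.2 x‖ₑ ^ s) ^ (1 / s)) ^ s := by
        rw [← ENNReal.rpow_mul, one_div_mul_cancel hs0.ne', ENNReal.rpow_one]
    _ ≤ (ENNReal.ofReal ((K * S) ^ (1 / s) * (1 - η)⁻¹)) ^ s := by gcongr
    _ = ENNReal.ofReal (K * (1 - η)⁻¹ ^ s * S) := by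
        have : 0 < 1 - η := by linarith
        rw [ENNReal.ofReal_rpow_of_nonneg (by positivity) hs0.le,
          Real.mul_rpow (by positivity) (by positivity), ← Real.rpow_mul (by positivity),
          one_div_mul_cancel hs0.ne', Real.rpow_one]
        congr 1; ring
    _ = _ := by
        have : 0 < 1 - η := by linarith
        rw [ENNReal.ofReal_mul (by positivity)]
        rfl

end Restricted

/-! ### Real interpolation, pointwise -/

section Interpolation

theorem summable_pow_natAbs {θ : ℝ} (h0 : 0 ≤ θ) (h1 : θ < 1) :
    Summable fun k : ℤ => θ ^ k.natAbs := by
  rw [summable_int_iff_summable_nat_and_neg]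
  simp [summable_geometric_of_lt_one h0 h1]

/-- Let 2^J be the size of Y. For j ≥ J the bound with exponent 1 decays in j - J, since p > 1; for
j ≤ J the bound with exponent s decays in J - j, since p < s. -/
theorem le_mul_pow_natAbs {p s : ℝ} (hp : 1 < p) (hs : p < s) {Y a : ℝ} (hY : 0 < Y) (ha : 0 ≤ a)
    {j J : ℤ} (hJ : (2 : ℝ) ^ J ≤ Y) (hJ' : Y < 2 ^ (J + 1))
    (h1 : (2 : ℝ) ^ ((p - 1) * j) * a ≤ Y ^ p) (h2 : (2 : ℝ) ^ ((p - s) * j) * a ^ s ≤ Y ^ p) :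
    a ≤ Y * (2 ^ (p - 1) * ((2 : ℝ) ^ (-min (p - 1) (1 - p / s))) ^ (j - J).natAbs) := by
  have hs0 : 0 < s := by linarith
  have hJr : (2 : ℝ) ^ (J : ℝ) ≤ Y := by rwa [Real.rpow_intCast]
  have hJr' : Y ≤ (2 : ℝ) ^ ((J : ℝ) + 1) := by
    rw [← Int.cast_one, ← Int.cast_add, Real.rpow_intCast]; exact hJ'.le
  have hβ : 0 ≤ 1 - p / s := by rw [sub_nonneg, div_le_one hs0]; exact hs.le
  rw [← Real.rpow_natCast, ← Real.rpow_mul zero_le_two, ← Real.rpow_add two_pos]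
  set μ := min (p - 1) (1 - p / s) with hμ
  rcases le_total J j with hj | hj
  · have hn : ((j - J).natAbs : ℝ) = j - J := by
      rw [Nat.cast_natAbs, abs_of_nonneg (by omega)]; push_cast; rfl
    have hj' : (0 : ℝ) ≤ j - J := by rw [sub_nonneg]; exact_mod_cast hj
    have e1 : a ≤ Y ^ p * 2 ^ (-((p - 1) * j)) := by
      rw [Real.rpow_neg zero_le_two, ← div_eq_mul_inv, le_div_iff₀ (by positivity)]
      linarith
    calc a ≤ Y ^ p * 2 ^ (-((p - 1) * j)) := e1
      _ = Y * Y ^ (p - 1) * 2 ^ (-((p - 1) * j)) := by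
          rw [Real.rpow_sub hY, Real.rpow_one]; field_simp
      _ ≤ Y * ((2 : ℝ) ^ ((J : ℝ) + 1)) ^ (p - 1) * 2 ^ (-((p - 1) * j)) := by
          refine mul_le_mul_of_nonneg_right (mul_le_mul_of_nonneg_left ?_ hY.le) (by positivity)
          exact Real.rpow_le_rpow hY.le hJr' (by linarith)
      _ = Y * (2 : ℝ) ^ ((p - 1) - (p - 1) * (j - J)) := by
          rw [← Real.rpow_mul zero_le_two, mul_assoc, ← Real.rpow_add two_pos]; ring_nf
      _ ≤ _ := by
          refine mul_le_mul_of_nonneg_left ?_ hY.le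
          refine Real.rpow_le_rpow_of_exponent_le one_le_two ?_
          rw [hn]
          nlinarith [min_le_left (p - 1) (1 - p / s)]
  · have hn : ((j - J).natAbs : ℝ) = J - j := by
      rw [Nat.cast_natAbs, abs_of_nonpos (by omega)]; push_cast; ring
    have hj' : (0 : ℝ) ≤ J - j := by rw [sub_nonneg]; exact_mod_cast hj
    have e1 : a ^ s ≤ Y ^ p * 2 ^ (-((p - s) * j)) := by
      rw [Real.rpow_neg zero_le_two, ← div_eq_mul_inv, le_div_iff₀ (by positivity)]
      linarith
    have e2 : a ≤ Y ^ (p / s) * 2 ^ ((1 - p / s) * j) := by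
      have := Real.rpow_le_rpow (by positivity) e1 (inv_nonneg.2 hs0.le)
      rw [Real.rpow_rpow_inv ha hs0.ne', Real.mul_rpow (by positivity) (by positivity),
        ← Real.rpow_mul hY.le, ← Real.rpow_mul zero_le_two, ← div_eq_mul_inv] at this
      convert this using 3
      field_simp
      ring
    calc a ≤ Y ^ (p / s) * 2 ^ ((1 - p / s) * j) := e2
      _ = Y * Y ^ (-(1 - p / s)) * 2 ^ ((1 - p / s) * j) := by
          congr 1
          nth_rewrite 2 [← Real.rpow_one Y]
          rw [← Real.rpow_add hY]; congr 1; ring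
      _ ≤ Y * ((2 : ℝ) ^ (J : ℝ)) ^ (-(1 - p / s)) * 2 ^ ((1 - p / s) * j) := by
          refine mul_le_mul_of_nonneg_right (mul_le_mul_of_nonneg_left ?_ hY.le) (by positivity)
          exact Real.rpow_le_rpow_of_nonpos (by positivity) hJr (by linarith)
      _ = Y * (2 : ℝ) ^ (- ((1 - p / s) * (J - j))) := by
          rw [← Real.rpow_mul zero_le_two, mul_assoc, ← Real.rpow_add two_pos]; ring_nf
      _ ≤ _ := by
          refine mul_le_mul_of_nonneg_left ?_ hY.le
          refine Real.rpow_le_rpow_of_exponent_le one_le_two ?_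
          rw [hn]
          nlinarith [min_le_right (p - 1) (1 - p / s)]

/-- The pointwise form of real interpolation between the exponents `1` and `s`. -/
theorem exists_rpow_tsum_le {p s : ℝ} (hp : 1 < p) (hs : p < s) : ∃ C : ℝ≥0, ∀ A : ℤ → ℝ≥0∞,
    (∑' j, A j) ^ p ≤ C * ∑' j : ℤ,
      ((2 : ℝ≥0∞) ^ ((p - 1) * j) * A j + (2 : ℝ≥0∞) ^ ((p - s) * j) * A j ^ s) := by
  have hs0 : 0 < s := by linarith
  have hp0 : 0 < p := by linarith
  set θ := (2 : ℝ) ^ (-min (p - 1) (1 - p / s)) with hθ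
  have hθ0 : 0 < θ := by positivity
  have hθ1 : θ < 1 := by
    refine Real.rpow_lt_one_of_one_lt_of_neg one_lt_two ?_
    rw [neg_lt_zero, lt_min_iff, sub_pos, sub_pos, div_lt_one hs0]
    exact ⟨hp, hs⟩
  set T := ∑' k : ℤ, 2 ^ (p - 1) * θ ^ k.natAbs with hT
  have hsum : Summable fun k : ℤ => 2 ^ (p - 1) * θ ^ k.natAbs :=
    (summable_pow_natAbs hθ0.le hθ1).mul_left _
  have hT0 : 0 ≤ T := tsum_nonneg fun k => by positivity
  refine ⟨Real.toNNReal (T ^ p) + 1, fun A => ?_⟩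
  set X := ∑' j : ℤ, ((2 : ℝ≥0∞) ^ ((p - 1) * j) * A j + (2 : ℝ≥0∞) ^ ((p - s) * j) * A j ^ s)
    with hX
  have h2 : ∀ t : ℝ, (2 : ℝ≥0∞) ^ t ≠ 0 := fun t => by simp
  have h2' : ∀ t : ℝ, (2 : ℝ≥0∞) ^ t ≠ ⊤ := fun t => by simp
  have hterm : ∀ j : ℤ, (2 : ℝ≥0∞) ^ ((p - 1) * j) * A j + (2 : ℝ≥0∞) ^ ((p - s) * j) * A j ^ s
      ≤ X := fun j => ENNReal.le_tsum j
  rcases eq_or_ne X ⊤ with hXt | hXt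
  · rw [hXt, ENNReal.mul_top (by simp)]; exact le_top
  have hAt : ∀ j, A j ≠ ⊤ := fun j hj => by
    have := (le_self_add).trans (hterm j)
    rw [hj, ENNReal.mul_top (h2 _)] at this
    exact hXt (top_le_iff.1 this)
  rcases eq_or_ne X 0 with hX0 | hX0
  · have : ∀ j, A j = 0 := fun j => by
      have := (le_self_add).trans (hterm j)
      rw [hX0, nonpos_iff_eq_zero, mul_eq_zero] at this
      exact this.resolve_left (h2 _)
    simp [this, hp0]
  lift A to ℤ → ℝ≥0 using hAt
  -- Each summand of X is at most X = Y^p, so every A j decays geometrically away from the scale of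
  -- Y and the whole sum is O(Y).
  set Y := X.toReal ^ (1 / p) with hY
  have hXr : 0 < X.toReal := ENNReal.toReal_pos hX0 hXt
  have hY0 : 0 < Y := by positivity
  have hYp : Y ^ p = X.toReal := by
    rw [hY, ← Real.rpow_mul hXr.le, one_div_mul_cancel hp0.ne', Real.rpow_one]
  obtain ⟨J, hJ, hJ'⟩ := exists_mem_Ico_zpow hY0 one_lt_two
  have htwo : ∀ t : ℝ, ((2 : ℝ≥0∞) ^ t).toReal = 2 ^ t := fun t => by
    rw [← ENNReal.toReal_rpow]; simp
  have hbound : ∀ j : ℤ, (A j : ℝ≥0∞)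
      ≤ ENNReal.ofReal (Y * (2 ^ (p - 1) * θ ^ (j - J).natAbs)) := by
    intro j
    rw [← ENNReal.ofReal_coe_nnreal]
    refine ENNReal.ofReal_le_ofReal (le_mul_pow_natAbs hp hs hY0 (A j).2 hJ hJ' ?_ ?_)
    · have := ENNReal.toReal_mono hXt ((le_self_add).trans (hterm j))
      rwa [ENNReal.toReal_mul, htwo, ENNReal.coe_toReal, ← hYp] at this
    · have := ENNReal.toReal_mono hXt ((le_add_self).trans (hterm j))
      rwa [ENNReal.toReal_mul, htwo, ← ENNReal.toReal_rpow, ENNReal.coe_toReal, ← hYp] at this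
  have hle : ∑' j, (A j : ℝ≥0∞) ≤ ENNReal.ofReal (Y * T) := by
    calc _ ≤ ∑' j : ℤ, ENNReal.ofReal (Y * (2 ^ (p - 1) * θ ^ (j - J).natAbs)) :=
          ENNReal.tsum_le_tsum hbound
      _ = ∑' j : ℤ, ENNReal.ofReal (Y * (2 ^ (p - 1) * θ ^ j.natAbs)) :=
          (Equiv.subRight J).tsum_eq fun j : ℤ =>
            ENNReal.ofReal (Y * (2 ^ (p - 1) * θ ^ j.natAbs))
      _ = _ := by
          rw [← ENNReal.ofReal_tsum_of_nonneg (fun j => by positivity) (hsum.mul_left Y),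
            tsum_mul_left]
  calc _ ≤ ENNReal.ofReal (Y * T) ^ p := by gcongr
    _ = ENNReal.ofReal (T ^ p) * X := by
        rw [ENNReal.ofReal_rpow_of_nonneg (by positivity) hp0.le,
          Real.mul_rpow hY0.le hT0, hYp, mul_comm, ENNReal.ofReal_mul (by positivity),
          ENNReal.ofReal_toReal hXt]
    _ ≤ _ := by
        gcongr
        rw [ENNReal.ofReal, ENNReal.coe_le_coe]
        simp

end Interpolation

/-! ### The discrete inequality for finite sums -/

section Finite

variable {d : ℕ} {ψ₀ : Space d → ℂ}

theorem four_le_of_one_lt_critExp (h : 1 < critExp d) : 4 ≤ d := by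
  by_contra! hd
  unfold critExp at h
  rw [lt_div_iff₀ (by positivity)] at h
  have : (d : ℝ) ≤ 3 := by exact_mod_cast Nat.lt_succ_iff.1 hd
  linarith

theorem ENNReal.rpow_sum_le_sum_rpow {ι : Type*} (s : Finset ι) (f : ι → ℝ≥0∞) {p : ℝ}
    (hp : 0 < p) (hp1 : p ≤ 1) : (∑ i ∈ s, f i) ^ p ≤ ∑ i ∈ s, f i ^ p := by
  classical
  induction s using Finset.induction_on with
  | empty => simp [hp]
  | insert a s ha ih =>
    rw [Finset.sum_insert ha, Finset.sum_insert ha]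
    exact (ENNReal.rpow_add_le_add_rpow _ _ hp.le hp1).trans (add_le_add_right ih _)

theorem enorm_sum_rpow_le {ι : Type*} (s : Finset ι) (f : ι → ℂ) {p : ℝ} (hp : 0 < p)
    (hp1 : p ≤ 1) : ‖∑ i ∈ s, f i‖ₑ ^ p ≤ ∑ i ∈ s, ‖f i‖ₑ ^ p :=
  (ENNReal.rpow_le_rpow (enorm_sum_le _ _) hp.le).trans
    (ENNReal.rpow_sum_le_sum_rpow s _ hp hp1)

namespace IsOscillatingBump

variable (hψ : IsOscillatingBump ψ₀)
include hψ

/-- Subadditivity of t^p separates the terms, so neither cancellation nor separation of the points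
plays a role. -/
theorem exists_lintegral_sum_rpow_le_of_le_one (hd : 1 ≤ d) {p : ℝ} (hp : 0 < p) (hp1 : p ≤ 1) :
    ∃ K : ℝ≥0, ∀ (Q : Finset (Space d × ℝ)) (c : Space d × ℝ → ℂ), (∀ q ∈ Q, 1 ≤ q.2) →
      ∫⁻ x, ‖∑ q ∈ Q, c q * sphereBump ψ₀ q.1 q.2 x‖ₑ ^ p
        ≤ K * ∑ q ∈ Q, ‖c q‖ₑ ^ p * ENNReal.ofReal (q.2 ^ (d - 1)) := by
  obtain ⟨K, hK⟩ := hψ.exists_lintegral_sphereBump_rpow_le hd hp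
  refine ⟨K, fun Q c hQ => ?_⟩
  calc ∫⁻ x, ‖∑ q ∈ Q, c q * sphereBump ψ₀ q.1 q.2 x‖ₑ ^ p
      ≤ ∫⁻ x, ∑ q ∈ Q, ‖c q‖ₑ ^ p * ‖sphereBump ψ₀ q.1 q.2 x‖ₑ ^ p := by
        refine lintegral_mono fun x => (enorm_sum_rpow_le Q _ hp hp1).trans_eq ?_
        refine Finset.sum_congr rfl fun q _ => ?_
        rw [enorm_mul, ENNReal.mul_rpow_of_nonneg _ _ hp.le]
    _ = ∑ q ∈ Q, ‖c q‖ₑ ^ p * ∫⁻ x, ‖sphereBump ψ₀ q.1 q.2 x‖ₑ ^ p := by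
        have hm : ∀ q : Space d × ℝ, Measurable fun x => ‖sphereBump ψ₀ q.1 q.2 x‖ₑ ^ p :=
          fun q => ((hψ.continuous_sphereBump_right q.1 q.2).measurable.enorm).pow_const p
        rw [lintegral_finsetSum _ fun q _ => (hm q).const_mul _]
        exact Finset.sum_congr rfl fun q _ => lintegral_const_mul _ (hm q)
    _ ≤ ∑ q ∈ Q, ‖c q‖ₑ ^ p * (K * ENNReal.ofReal (q.2 ^ (d - 1))) :=
        Finset.sum_le_sum fun q hq => mul_le_mul_right (hK q.1 q.2 (hQ q hq)) _
    _ = _ := by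
        rw [Finset.mul_sum]
        exact Finset.sum_congr rfl fun q _ => by ring

/-- The part of the sum in which the coefficients have size about `2^j`. -/
theorem exists_lintegral_level_le (hd : 4 ≤ d) {s : ℝ} (hs1 : 1 ≤ s) (hs : s < critExp d) :
    ∃ K : ℝ≥0, ∀ (Q : Finset (Space d × ℝ)) (c : Space d × ℝ → ℂ) (j : ℤ) (p : ℝ), IsGrid Q →
      0 < p → (∀ q ∈ Q, (2 : ℝ) ^ j ≤ ‖c q‖ ∧ ‖c q‖ ≤ 2 ^ (j + 1)) →
      (2 : ℝ≥0∞) ^ ((p - s) * j) * ∫⁻ x, ‖∑ q ∈ Q, c q * sphereBump ψ₀ q.1 q.2 x‖ₑ ^ s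
        ≤ K * ∑ q ∈ Q, ‖c q‖ₑ ^ p * ENNReal.ofReal (q.2 ^ (d - 1)) := by
  obtain ⟨K, hK⟩ := hψ.exists_lintegral_sum_le hd hs1 hs
  have hs0 : 0 < s := by linarith
  refine ⟨Real.toNNReal (2 ^ s) * K, fun Q c j p hQ hp hc => ?_⟩
  have hpos : (0 : ℝ) < 2 ^ (j + 1) := by positivity
  -- Dividing by the upper bound makes the coefficients at most 1. Undoing it costs 2^((j+1)s),
  -- which combines with the weight to 2^s · 2^(pj), and 2^j ≤ |c_q|.
  set t : ℂ := Complex.ofReal ((2 : ℝ) ^ (j + 1)) with ht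
  have ht0 : t ≠ 0 := by rw [ht]; exact_mod_cast hpos.ne'
  have htn : ‖t‖ = 2 ^ (j + 1) := by rw [ht, Complex.norm_real, Real.norm_of_nonneg hpos.le]
  have h2 : ∀ u : ℝ, ENNReal.ofReal ((2 : ℝ) ^ u) = (2 : ℝ≥0∞) ^ u := fun u => by
    rw [← ENNReal.ofReal_rpow_of_pos two_pos]; simp
  have hte : ‖t‖ₑ = (2 : ℝ≥0∞) ^ ((j : ℝ) + 1) := by
    rw [← ofReal_norm, htn, ← h2, ← Real.rpow_intCast]; push_cast; rfl
  have key := hK Q (fun q => c q / t) hQ fun q hq => by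
    rw [norm_div, htn]; exact div_le_one_of_le₀ (hc q hq).2 hpos.le
  have e1 : ∀ x, ‖∑ q ∈ Q, c q * sphereBump ψ₀ q.1 q.2 x‖ₑ ^ s
      = ‖t‖ₑ ^ s * ‖∑ q ∈ Q, c q / t * sphereBump ψ₀ q.1 q.2 x‖ₑ ^ s := fun x => by
    rw [← ENNReal.mul_rpow_of_nonneg _ _ hs0.le, ← enorm_mul, Finset.mul_sum]
    congr 3 with q
    field_simp
  simp_rw [e1]
  rw [lintegral_const_mul' _ _ (by simp [ht0]), hte, ← ENNReal.rpow_mul, ← mul_assoc,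
    ← ENNReal.rpow_add _ _ two_ne_zero ENNReal.ofNat_ne_top]
  have e2 : (p - s) * j + ((j : ℝ) + 1) * s = s + p * j := by ring
  rw [e2, ENNReal.rpow_add _ _ two_ne_zero ENNReal.ofNat_ne_top]
  have e3 : ((Real.toNNReal (2 ^ s) * K : ℝ≥0) : ℝ≥0∞) = 2 ^ s * K := by
    rw [ENNReal.coe_mul, ← h2]; rfl
  rw [e3, mul_assoc, mul_assoc]
  refine mul_le_mul_right ?_ _
  calc _ ≤ (2 : ℝ≥0∞) ^ (p * j) * (K * ENNReal.ofReal (∑ q ∈ Q, q.2 ^ (d - 1))) :=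
        mul_le_mul_right key _
    _ = K * ∑ q ∈ Q, (2 : ℝ≥0∞) ^ (p * j) * ENNReal.ofReal (q.2 ^ (d - 1)) := by
        rw [ENNReal.ofReal_sum_of_nonneg fun q hq => by
          have := hQ.one_le q hq; positivity, ← Finset.mul_sum]
        ring
    _ ≤ _ := by
        refine mul_le_mul_right (Finset.sum_le_sum fun q hq => mul_le_mul_left ?_ _) _
        rw [mul_comm, ENNReal.rpow_mul]
        refine ENNReal.rpow_le_rpow ?_ hp.le
        rw [← ofReal_norm, ← h2, Real.rpow_intCast]
        exact ENNReal.ofReal_le_ofReal (hc q hq).1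

/-- The discrete inequality for finite sums. -/
theorem exists_lintegral_sum_rpow_le (hd : 1 ≤ d) {p : ℝ} (hp : 0 < p) (hpd : p < critExp d) :
    ∃ K : ℝ≥0, ∀ (Q : Finset (Space d × ℝ)) (c : Space d × ℝ → ℂ), IsGrid Q →
      ∫⁻ x, ‖∑ q ∈ Q, c q * sphereBump ψ₀ q.1 q.2 x‖ₑ ^ p
        ≤ K * ∑ q ∈ Q, ‖c q‖ₑ ^ p * ENNReal.ofReal (q.2 ^ (d - 1)) := by
  classical
  rcases le_or_gt p 1 with hp1 | hp1
  · obtain ⟨K, hK⟩ := hψ.exists_lintegral_sum_rpow_le_of_le_one hd hp hp1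
    exact ⟨K, fun Q c hQ => hK Q c hQ.one_le⟩
  have hd4 : 4 ≤ d := four_le_of_one_lt_critExp (hp1.trans hpd)
  -- Room above p is used: the endpoints of the interpolation are 1 and this s, both below p_d.
  obtain ⟨s, hps, hsd⟩ := exists_between hpd
  obtain ⟨C, hC⟩ := exists_rpow_tsum_le hp1 hps
  obtain ⟨K₁, hK₁⟩ := hψ.exists_lintegral_level_le hd4 le_rfl (hp1.trans hpd)
  obtain ⟨K₂, hK₂⟩ := hψ.exists_lintegral_level_le hd4 (hp1.trans hps).le hsd
  refine ⟨C * (K₁ + K₂), fun Q c hQ => ?_⟩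
  set w : Space d × ℝ → ℝ≥0∞ := fun q => ‖c q‖ₑ ^ p * ENNReal.ofReal (q.2 ^ (d - 1)) with hw
  -- The points are sorted by the dyadic size of the coefficient. Zero coefficients have no size and
  -- are left out.
  set E : ℤ → Finset (Space d × ℝ) := fun j => Q.filter fun q => c q ≠ 0 ∧ Int.log 2 ‖c q‖ = j
    with hE
  set f : ℤ → Space d → ℂ := fun j x => ∑ q ∈ E j, c q * sphereBump ψ₀ q.1 q.2 x with hf
  have hfm : ∀ j, Measurable (f j) := fun j => (continuous_finsetSum _ fun q _ =>
      continuous_const.mul (hψ.continuous_sphereBump_right q.1 q.2)).measurable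
  have hEc : ∀ j, ∀ q ∈ E j, (2 : ℝ) ^ j ≤ ‖c q‖ ∧ ‖c q‖ ≤ 2 ^ (j + 1) := by
    intro j q hq
    obtain ⟨-, hq0, hqj⟩ := Finset.mem_filter.1 hq
    have h1 := Int.zpow_log_le_self (b := 2) one_lt_two (norm_pos_iff.2 hq0)
    have h2 := Int.lt_zpow_succ_log_self (b := 2) one_lt_two ‖c q‖
    rw [hqj] at h1 h2
    exact ⟨by exact_mod_cast h1, by exact_mod_cast h2.le⟩
  set V := (Q.filter fun q => c q ≠ 0).image fun q => Int.log 2 ‖c q‖ with hV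
  have hfib : ∀ {M : Type} [AddCommMonoid M] (u : Space d × ℝ → M), (∀ q, c q = 0 → u q = 0) →
      ∑ q ∈ Q, u q = ∑ j ∈ V, ∑ q ∈ E j, u q := by
    intro M _ u hu
    have e : ∀ j, E j = (Q.filter fun q => c q ≠ 0).filter fun q => Int.log 2 ‖c q‖ = j :=
      fun j => (Finset.filter_filter ..).symm
    simp_rw [e]
    rw [Finset.sum_fiberwise_of_maps_to fun q hq => Finset.mem_image_of_mem _ hq]
    exact (Finset.sum_filter_of_ne (p := fun q => c q ≠ 0) fun q _ h h' => h (hu q h')).symm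
  have hpt : ∀ x, ‖∑ q ∈ Q, c q * sphereBump ψ₀ q.1 q.2 x‖ₑ ^ p ≤ C * ∑' j : ℤ,
      ((2 : ℝ≥0∞) ^ ((p - 1) * j) * ‖f j x‖ₑ + (2 : ℝ≥0∞) ^ ((p - s) * j) * ‖f j x‖ₑ ^ s) := by
    intro x
    refine le_trans (ENNReal.rpow_le_rpow ?_ hp.le) (hC fun j => ‖f j x‖ₑ)
    rw [hfib _ fun q hq => by rw [hq, zero_mul]]
    exact (enorm_sum_le _ _).trans (ENNReal.sum_le_tsum V)
  have hwsum : ∑' j : ℤ, ∑ q ∈ E j, w q = ∑ q ∈ Q, w q := by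
    rw [hfib w fun q hq => by simp [hw, hq, hp]]
    refine tsum_eq_sum fun j hj => Finset.sum_eq_zero fun q hq => ?_
    obtain ⟨h1, h2, h3⟩ := Finset.mem_filter.1 hq
    exact absurd (Finset.mem_image.2 ⟨q, Finset.mem_filter.2 ⟨h1, h2⟩, h3⟩) hj
  calc ∫⁻ x, ‖∑ q ∈ Q, c q * sphereBump ψ₀ q.1 q.2 x‖ₑ ^ p
      ≤ ∫⁻ x, C * ∑' j : ℤ, ((2 : ℝ≥0∞) ^ ((p - 1) * j) * ‖f j x‖ₑ
          + (2 : ℝ≥0∞) ^ ((p - s) * j) * ‖f j x‖ₑ ^ s) := lintegral_mono hpt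
    _ = C * ∑' j : ℤ, ((2 : ℝ≥0∞) ^ ((p - 1) * j) * (∫⁻ x, ‖f j x‖ₑ ^ (1 : ℝ))
          + (2 : ℝ≥0∞) ^ ((p - s) * j) * ∫⁻ x, ‖f j x‖ₑ ^ s) := by
        have m1 : ∀ j, Measurable fun x => ‖f j x‖ₑ := fun j => (hfm j).enorm
        have m2 : ∀ j, Measurable fun x => ‖f j x‖ₑ ^ s := fun j => (m1 j).pow_const s
        have m3 : ∀ j : ℤ, Measurable fun x => (2 : ℝ≥0∞) ^ ((p - 1) * j) * ‖f j x‖ₑ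
            + (2 : ℝ≥0∞) ^ ((p - s) * j) * ‖f j x‖ₑ ^ s :=
          fun j => ((m1 j).const_mul _).add ((m2 j).const_mul _)
        rw [lintegral_const_mul' _ _ ENNReal.coe_ne_top, lintegral_tsum fun j => (m3 j).aemeasurable]
        simp_rw [ENNReal.rpow_one]
        congr 2 with j
        rw [lintegral_add_left ((m1 j).const_mul _), lintegral_const_mul _ (m1 j),
          lintegral_const_mul _ (m2 j)]
    _ ≤ C * ∑' j : ℤ, (K₁ * ∑ q ∈ E j, w q + K₂ * ∑ q ∈ E j, w q) := by
        refine mul_le_mul_right (ENNReal.tsum_le_tsum fun j => ?_) _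
        have hEj : IsGrid (E j) := hQ.subset (Finset.filter_subset _ _)
        exact add_le_add (hK₁ (E j) c j p hEj hp (hEc j)) (hK₂ (E j) c j p hEj hp (hEc j))
    _ = _ := by
        simp_rw [← add_mul]
        rw [ENNReal.tsum_mul_left, hwsum]
        push_cast
        ring

end IsOscillatingBump

end Finite

/-! ### Absolute convergence at each point -/

section Pointwise

variable {d : ℕ} {ψ₀ : Space d → ℂ}

/-- Balls of radius 1/3 about the centres are disjoint and lie in an annulus about x of half-width
8/15 = 1/5 + 1/3, so volumes can be compared. -/
theorem exists_card_annulus_le (hd : 1 ≤ d) : ∃ C : ℝ, 0 ≤ C ∧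
    ∀ (P : Finset (Space d)) (x : Space d) (r : ℝ), 1 ≤ r →
      (∀ y ∈ P, ∀ y' ∈ P, y = y' ∨ 1 ≤ dist y y') → (∀ y ∈ P, x ∈ annulus y r (1 / 5)) →
      (P.card : ℝ) ≤ C * r ^ (d - 1) := by
  have hv := unitBallVol_pos d
  refine ⟨2 * d * 2 ^ (d - 1) * 3 ^ d, by positivity, fun P x r hr hP hx => ?_⟩
  have key := card_mul_volume_le P id (1 / 3) 1 (measurableSet_annulus x r (8 / 15)) ?_ ?_
  · rw [volume_closedBall_eq 0 (by norm_num), Nat.cast_one, one_mul] at key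
    have h2 := key.trans (volume_annulus_le hd x (by linarith : (0 : ℝ) ≤ r) (by norm_num))
    rw [← ENNReal.ofReal_natCast, ← ENNReal.ofReal_mul (by positivity),
      ENNReal.ofReal_le_ofReal_iff (by positivity)] at h2
    have h3 : (r + 8 / 15) ^ (d - 1) ≤ 2 ^ (d - 1) * r ^ (d - 1) := by
      rw [← mul_pow]; exact pow_le_pow_left₀ (by linarith) (by linarith) _
    have h4 : (P.card : ℝ) * ((1 / 3) ^ d * unitBallVol d)
        ≤ 2 * d * unitBallVol d * 1 * (2 ^ (d - 1) * r ^ (d - 1)) := by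
      refine h2.trans ?_
      gcongr
      norm_num
    have h5 : (P.card : ℝ) * (1 / 3) ^ d ≤ 2 * d * (2 ^ (d - 1) * r ^ (d - 1)) := by
      refine le_of_mul_le_mul_right ?_ hv
      linarith
    rw [one_div, inv_pow, ← div_eq_mul_inv, div_le_iff₀ (by positivity)] at h5
    linarith
  · intro z
    rw [Finset.card_le_one]
    intro a ha b hb
    obtain ⟨ha, ha'⟩ := Finset.mem_filter.1 ha
    obtain ⟨hb, hb'⟩ := Finset.mem_filter.1 hb
    refine (hP a ha b hb).resolve_right fun h => ?_
    have := dist_triangle_left a b z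
    simp only [id] at ha' hb'
    linarith
  · intro y hy z hz
    have h1 := abs_le.1 (mem_annulus.1 (hx y hy))
    rw [Metric.mem_closedBall, dist_eq_norm, id] at hz
    rw [mem_annulus, abs_le]
    have h2 : ‖x - y‖ ≤ ‖z - x‖ + ‖z - y‖ := by
      have := norm_sub_le (z - y) (z - x); simp at this; linarith
    have h3 : ‖z - x‖ ≤ ‖z - y‖ + ‖x - y‖ := by
      have := norm_sub_le (z - y) (x - y); simpa using this
    constructor <;> linarith

namespace IsOscillatingBump

variable (hψ : IsOscillatingBump ψ₀)
include hψ

/-- At a fixed x only O(r^(d-1)) centres contribute for each radius r, and the functions are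
bounded. What remains is the sum of r^(e+d-1) over separated radii, dominated by a convergent series
over ℕ. -/
theorem exists_sum_norm_rpow_le (hd : 1 ≤ d) {t e : ℝ} (ht : 0 < t) (he : e + (d - 1) < -1) :
    ∃ C : ℝ, 0 ≤ C ∧ ∀ (Q : Finset (Space d × ℝ)) (x : Space d), IsGrid Q →
      ∑ q ∈ Q, ‖sphereBump ψ₀ q.1 q.2 x‖ ^ t * q.2 ^ e ≤ C := by
  classical
  obtain ⟨K, hK0, hK⟩ := hψ.exists_sphereBump_bound hd
  obtain ⟨C, hC0, hC⟩ := exists_card_annulus_le (d := d) hd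
  have hd1 : ((d - 1 : ℕ) : ℝ) = d - 1 := by rw [Nat.cast_sub hd, Nat.cast_one]
  have hsum : Summable fun n : ℕ => (n : ℝ) ^ (e + (d - 1)) := Real.summable_nat_rpow.2 he
  set T := ∑' n : ℕ, (n : ℝ) ^ (e + (d - 1)) with hT
  have hT0 : 0 ≤ T := tsum_nonneg fun n => by positivity
  refine ⟨K ^ t * C * T, by positivity, fun Q x hQ => ?_⟩
  set S := Q.image Prod.snd with hS
  have hS1 : ∀ r ∈ S, 1 ≤ r := fun r hr => by
    obtain ⟨q, hq, rfl⟩ := Finset.mem_image.1 hr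
    exact hQ.one_le q hq
  calc ∑ q ∈ Q, ‖sphereBump ψ₀ q.1 q.2 x‖ ^ t * q.2 ^ e
      = ∑ r ∈ S, ∑ q ∈ Q with q.2 = r, ‖sphereBump ψ₀ q.1 q.2 x‖ ^ t * q.2 ^ e :=
        (Finset.sum_fiberwise_of_maps_to (fun q hq => Finset.mem_image_of_mem _ hq) _).symm
    _ ≤ ∑ r ∈ S, K ^ t * C * (⌊r⌋₊ : ℝ) ^ (e + (d - 1)) := by
        refine Finset.sum_le_sum fun r hr => ?_
        have hr1 := hS1 r hr
        set P := (Q.filter fun q => q.2 = r).filter fun q => x ∈ annulus q.1 r (1 / 5) with hP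
        have hinj : Set.InjOn Prod.fst (P : Set (Space d × ℝ)) := by
          intro q hq q' hq' h
          have h1 := (Finset.mem_filter.1 (Finset.mem_filter.1 hq).1).2
          have h2 := (Finset.mem_filter.1 (Finset.mem_filter.1 hq').1).2
          exact Prod.ext h (h1.trans h2.symm)
        have hcard : (P.card : ℝ) ≤ C * r ^ (d - 1) := by
          rw [← Finset.card_image_of_injOn hinj]
          refine hC _ x r hr1 ?_ ?_
          · intro y hy y' hy'
            obtain ⟨q, hq, rfl⟩ := Finset.mem_image.1 hy
            obtain ⟨q', hq', rfl⟩ := Finset.mem_image.1 hy'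
            exact hQ.fst q (Finset.mem_filter.1 (Finset.mem_filter.1 hq).1).1 q'
              (Finset.mem_filter.1 (Finset.mem_filter.1 hq').1).1
          · intro y hy
            obtain ⟨q, hq, rfl⟩ := Finset.mem_image.1 hy
            exact (Finset.mem_filter.1 hq).2
        have hfl : (1 : ℝ) ≤ ⌊r⌋₊ := by exact_mod_cast Nat.floor_pos.2 hr1
        calc ∑ q ∈ Q with q.2 = r, ‖sphereBump ψ₀ q.1 q.2 x‖ ^ t * q.2 ^ e
            = ∑ q ∈ P, ‖sphereBump ψ₀ q.1 q.2 x‖ ^ t * q.2 ^ e := by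
              refine (Finset.sum_filter_of_ne fun q hq h => ?_).symm
              obtain ⟨hq, hqr⟩ := Finset.mem_filter.1 hq
              rw [← hqr]
              refine hψ.mem_annulus_of_sphereBump_ne_zero (by linarith) fun h0 => h ?_
              rw [h0, norm_zero, Real.zero_rpow ht.ne', zero_mul]
          _ ≤ ∑ q ∈ P, K ^ t * r ^ e := by
              refine Finset.sum_le_sum fun q hq => ?_
              have hqr := (Finset.mem_filter.1 (Finset.mem_filter.1 hq).1).2
              rw [hqr]
              refine mul_le_mul_of_nonneg_right ?_ (by positivity)
              exact Real.rpow_le_rpow (norm_nonneg _) (hK _ _ _ hr1) ht.le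
          _ = P.card * (K ^ t * r ^ e) := by rw [Finset.sum_const, nsmul_eq_mul]
          _ ≤ C * r ^ (d - 1) * (K ^ t * r ^ e) :=
              mul_le_mul_of_nonneg_right hcard (by positivity)
          _ = K ^ t * C * r ^ (e + (d - 1)) := by
              rw [Real.rpow_add (by linarith), ← hd1, Real.rpow_natCast]; ring
          _ ≤ _ := by
              refine mul_le_mul_of_nonneg_left ?_ (by positivity)
              exact Real.rpow_le_rpow_of_nonpos (by linarith) (Nat.floor_le (by linarith))
                (by linarith)
    _ = K ^ t * C * ∑ n ∈ S.image fun r => ⌊r⌋₊, (n : ℝ) ^ (e + (d - 1)) := by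
        rw [← Finset.mul_sum, Finset.sum_image hQ.floor_injOn]
    _ ≤ _ := mul_le_mul_of_nonneg_left
        (hsum.sum_le_tsum _ fun n _ => by positivity) (by positivity)

/-- Absolute convergence of the sums of functions `F_{y,r}`, in quantitative form. -/
theorem exists_sum_norm_mul_le (hd : 1 ≤ d) {p : ℝ} (hp : 1 ≤ p) (hpd : p < critExp d) :
    ∃ C : ℝ, 0 ≤ C ∧ ∀ (Q : Finset (Space d × ℝ)) (c : Space d × ℝ → ℂ) (x : Space d), IsGrid Q →
      ∑ q ∈ Q, ‖c q * sphereBump ψ₀ q.1 q.2 x‖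
        ≤ C * (1 + ∑ q ∈ Q, ‖c q‖ ^ p * q.2 ^ (d - 1)) := by
  have hd1 : (1 : ℝ) ≤ d := by exact_mod_cast hd
  rcases hp.eq_or_lt with rfl | hp1
  · obtain ⟨K, hK0, hK⟩ := hψ.exists_sphereBump_bound hd
    refine ⟨K, hK0, fun Q c x hQ => ?_⟩
    rw [mul_add, Finset.mul_sum]
    refine le_add_of_nonneg_of_le (by linarith) (Finset.sum_le_sum fun q hq => ?_)
    have h1 := hQ.one_le q hq
    rw [norm_mul, Real.rpow_one, mul_comm]
    refine mul_le_mul (hK _ _ _ h1) ?_ (norm_nonneg _) hK0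
    exact le_mul_of_one_le_right (norm_nonneg _) (one_le_pow₀ h1)
  · have hpq : p.HolderConjugate (p / (p - 1)) := Real.HolderConjugate.conjExponent hp1
    have hp0 : 0 < p := by linarith
    have ht0 : 0 < p / (p - 1) := div_pos hp0 (by linarith)
    have ht1 : 1 ≤ p / (p - 1) := by rw [one_le_div (by linarith)]; linarith
    have hdn : ((d - 1 : ℕ) : ℝ) = d - 1 := by rw [Nat.cast_sub hd, Nat.cast_one]
    -- The condition is d(p - 1) < d - 1, weaker than p < p_d.
    have he : -((d - 1) / (p - 1)) + ((d : ℝ) - 1) < -1 := by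
      have h1 : p * (d + 1) < 2 * d - 2 := by
        unfold critExp at hpd; rwa [lt_div_iff₀ (by linarith)] at hpd
      have h2 : (d : ℝ) * (p - 1) < d - 1 := by nlinarith
      have h3 : (d : ℝ) < (d - 1) / (p - 1) := by rwa [lt_div_iff₀ (by linarith)]
      linarith
    obtain ⟨C, hC0, hC⟩ := hψ.exists_sum_norm_rpow_le hd ht0 he
    refine ⟨C + 1, by linarith, fun Q c x hQ => ?_⟩
    have hS0 : 0 ≤ ∑ q ∈ Q, ‖c q‖ ^ p * q.2 ^ (d - 1) := Finset.sum_nonneg fun q hq => by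
      have := hQ.one_le q hq; positivity
    have hterm : ∀ q ∈ Q, ‖c q * sphereBump ψ₀ q.1 q.2 x‖ ≤ ‖c q‖ ^ p * q.2 ^ (d - 1)
        + ‖sphereBump ψ₀ q.1 q.2 x‖ ^ (p / (p - 1)) * q.2 ^ (-(((d : ℝ) - 1) / (p - 1))) := by
      intro q hq
      have hr : 0 < q.2 := by linarith [hQ.one_le q hq]
      -- The weight r^((d-1)/p) is put on the coefficient and its inverse on F, so that the p-th
      -- power reproduces the norm of the right-hand side.
      have hy := Real.young_inequality_of_nonneg
        (mul_nonneg (norm_nonneg (c q)) (Real.rpow_nonneg hr.le (((d : ℝ) - 1) / p)))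
        (mul_nonneg (norm_nonneg (sphereBump ψ₀ q.1 q.2 x))
          (Real.rpow_nonneg hr.le (-(((d : ℝ) - 1) / p)))) hpq
      rw [Real.mul_rpow (norm_nonneg _) (by positivity),
        Real.mul_rpow (norm_nonneg _) (by positivity), ← Real.rpow_mul hr.le,
        ← Real.rpow_mul hr.le, div_mul_cancel₀ _ hp0.ne', ← hdn, Real.rpow_natCast, hdn] at hy
      have e1 : -(((d : ℝ) - 1) / p) * (p / (p - 1)) = -(((d : ℝ) - 1) / (p - 1)) := by
        have : p - 1 ≠ 0 := by linarith
        field_simp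
      rw [e1] at hy
      have e2 : q.2 ^ (((d : ℝ) - 1) / p) * q.2 ^ (-(((d : ℝ) - 1) / p)) = 1 := by
        rw [← Real.rpow_add hr, add_neg_cancel, Real.rpow_zero]
      calc _ = ‖c q‖ * q.2 ^ (((d : ℝ) - 1) / p) * (‖sphereBump ψ₀ q.1 q.2 x‖
            * q.2 ^ (-(((d : ℝ) - 1) / p))) := by
            rw [norm_mul, mul_mul_mul_comm, e2, mul_one]
        _ ≤ _ := hy
        _ ≤ _ := add_le_add (div_le_self (by positivity) hp) (div_le_self (by positivity) ht1)
    calc _ ≤ _ := Finset.sum_le_sum hterm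
      _ = _ := Finset.sum_add_distrib
      _ ≤ (∑ q ∈ Q, ‖c q‖ ^ p * q.2 ^ (d - 1)) + C := by gcongr; exact hC Q x hQ
      _ ≤ _ := by nlinarith

end IsOscillatingBump

end Pointwise

/-! ### The discrete inequality for infinite families -/

section Families

variable {d : ℕ} {ψ₀ : Space d → ℂ}

/-- An enumeration without repetition of points of a product of a `1`-separated set of centres and
a `1`-separated set of radii that are at least `1`. -/
structure IsGridFamily {ι : Type} (e : ι → Space d × ℝ) : Prop where
  injective : Function.Injective e
  fst : ∀ i j, (e i).1 = (e j).1 ∨ 1 ≤ dist (e i).1 (e j).1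
  snd : ∀ i j, (e i).2 = (e j).2 ∨ 1 ≤ dist (e i).2 (e j).2
  one_le : ∀ i, 1 ≤ (e i).2

theorem isGridFamily_subtype {Y : Set (Space d)} {R : Set ℝ} (hY : OneSeparated Y)
    (hR : OneSeparated R) (hR1 : R ⊆ Set.Ici 1) :
    IsGridFamily (fun q : ↥(Y ×ˢ R) => (q : Space d × ℝ)) where
  injective := Subtype.val_injective
  fst i j := or_iff_not_imp_left.2 fun h => hY (mem_prod.1 i.2).1 (mem_prod.1 j.2).1 h
  snd i j := or_iff_not_imp_left.2 fun h => hR (mem_prod.1 i.2).2 (mem_prod.1 j.2).2 h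
  one_le i := mem_Ici.1 (hR1 (mem_prod.1 i.2).2)

namespace IsGridFamily

variable {ι : Type} {e : ι → Space d × ℝ} (he : IsGridFamily e)
include he

theorem isGrid_map (s : Finset ι) : IsGrid (s.map ⟨e, he.injective⟩) := by
  refine ⟨fun q hq q' hq' => ?_, fun q hq q' hq' => ?_, fun q hq => ?_⟩
  · obtain ⟨i, -, rfl⟩ := Finset.mem_map.1 hq
    obtain ⟨j, -, rfl⟩ := Finset.mem_map.1 hq'
    exact he.fst i j
  · obtain ⟨i, -, rfl⟩ := Finset.mem_map.1 hq
    obtain ⟨j, -, rfl⟩ := Finset.mem_map.1 hq'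
    exact he.snd i j
  · obtain ⟨i, -, rfl⟩ := Finset.mem_map.1 hq
    exact he.one_le i

theorem sum_map {M : Type} [AddCommMonoid M] (s : Finset ι) (γ : ι → ℂ)
    (g : ℂ → Space d × ℝ → M) :
    ∑ q ∈ s.map ⟨e, he.injective⟩, g (Function.extend e γ 0 q) q = ∑ i ∈ s, g (γ i) (e i) := by
  rw [Finset.sum_map]
  exact Finset.sum_congr rfl fun i _ => by
    rw [Function.Embedding.coeFn_mk, he.injective.extend_apply]

end IsGridFamily

theorem summable_of_tsum_enorm_ne_top {ι : Type} {f : ι → ℂ} (h : ∑' i, ‖f i‖ₑ ≠ ⊤) :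
    Summable f := by
  refine Summable.of_norm ?_
  have := ENNReal.tsum_coe_ne_top_iff_summable.1 h
  exact NNReal.summable_coe.2 this

namespace IsOscillatingBump

variable (hψ : IsOscillatingBump ψ₀)
include hψ

theorem exists_tsum_enorm_le (hd : 1 ≤ d) {p : ℝ} (hp : 1 ≤ p) (hpd : p < critExp d) :
    ∃ C : ℝ≥0, ∀ {ι : Type} (e : ι → Space d × ℝ) (γ : ι → ℂ) (x : Space d), IsGridFamily e →
      ∑' i, ‖γ i * sphereBump ψ₀ (e i).1 (e i).2 x‖ₑ
        ≤ C * (1 + ∑' i, ‖γ i‖ₑ ^ p * ENNReal.ofReal ((e i).2 ^ (d - 1))) := by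
  have hp0 : 0 < p := by linarith
  obtain ⟨C, hC0, hC⟩ := hψ.exists_sum_norm_mul_le hd hp hpd
  refine ⟨Real.toNNReal C, fun {ι} e γ x he => ENNReal.summable.tsum_le_of_sum_le fun s => ?_⟩
  have h := hC _ (Function.extend e γ 0) x (he.isGrid_map s)
  rw [he.sum_map s γ fun z q => ‖z * sphereBump ψ₀ q.1 q.2 x‖,
    he.sum_map s γ fun z q => ‖z‖ ^ p * q.2 ^ (d - 1)] at h
  have hr : ∀ i, 0 ≤ (e i).2 ^ (d - 1) := fun i => by
    have := he.one_le i; positivity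
  have hn : ∀ i ∈ s, 0 ≤ ‖γ i‖ ^ p * (e i).2 ^ (d - 1) := fun i _ =>
    mul_nonneg (by positivity) (hr i)
  calc ∑ i ∈ s, ‖γ i * sphereBump ψ₀ (e i).1 (e i).2 x‖ₑ
      = ENNReal.ofReal (∑ i ∈ s, ‖γ i * sphereBump ψ₀ (e i).1 (e i).2 x‖) := by
        rw [ENNReal.ofReal_sum_of_nonneg fun _ _ => norm_nonneg _]
        simp_rw [ofReal_norm]
    _ ≤ _ := ENNReal.ofReal_le_ofReal h
    _ = ENNReal.ofReal C * (1 + ∑ i ∈ s, ‖γ i‖ₑ ^ p * ENNReal.ofReal ((e i).2 ^ (d - 1))) := by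
        rw [ENNReal.ofReal_mul hC0, ENNReal.ofReal_add zero_le_one (Finset.sum_nonneg hn),
          ENNReal.ofReal_one, ENNReal.ofReal_sum_of_nonneg hn]
        congr 3 with i
        rw [ENNReal.ofReal_mul (by positivity), ← ofReal_norm,
          ENNReal.ofReal_rpow_of_nonneg (norm_nonneg _) hp0.le]
    _ ≤ _ := mul_le_mul_right (add_le_add_right (ENNReal.sum_le_tsum s) 1) _

/-- For p ≤ 1 the ℓ^1 norm is bounded by the ℓ^p norm, and both the functions F and the inverse
weights r^(-(d-1)) are bounded. -/
theorem exists_tsum_enorm_le_of_le_one (hd : 1 ≤ d) {p : ℝ} (hp : 0 < p) (hp1 : p ≤ 1) :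
    ∃ C : ℝ≥0, ∀ {ι : Type} (e : ι → Space d × ℝ) (γ : ι → ℂ) (x : Space d), IsGridFamily e →
      ∑' i, ‖γ i * sphereBump ψ₀ (e i).1 (e i).2 x‖ₑ
        ≤ C * (∑' i, ‖γ i‖ₑ ^ p * ENNReal.ofReal ((e i).2 ^ (d - 1))) ^ (1 / p) := by
  obtain ⟨K, hK0, hK⟩ := hψ.exists_sphereBump_bound hd
  refine ⟨Real.toNNReal K, fun {ι} e γ x he => ENNReal.summable.tsum_le_of_sum_le fun s => ?_⟩
  calc ∑ i ∈ s, ‖γ i * sphereBump ψ₀ (e i).1 (e i).2 x‖ₑ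
      ≤ ∑ i ∈ s, ENNReal.ofReal K * ‖γ i‖ₑ := by
        refine Finset.sum_le_sum fun i _ => ?_
        rw [enorm_mul, mul_comm, ← ofReal_norm (sphereBump ψ₀ _ _ x)]
        exact mul_le_mul_left (ENNReal.ofReal_le_ofReal (hK _ _ _ (he.one_le i))) _
    _ = ENNReal.ofReal K * (((∑ i ∈ s, ‖γ i‖ₑ) ^ p) ^ (1 / p)) := by
        rw [← Finset.mul_sum, ← ENNReal.rpow_mul, mul_one_div_cancel hp.ne', ENNReal.rpow_one]
    _ ≤ ENNReal.ofReal K * ((∑ i ∈ s, ‖γ i‖ₑ ^ p * ENNReal.ofReal ((e i).2 ^ (d - 1)))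
          ^ (1 / p)) := by
        refine mul_le_mul_right (ENNReal.rpow_le_rpow ?_ (by positivity)) _
        refine (ENNReal.rpow_sum_le_sum_rpow s _ hp hp1).trans (Finset.sum_le_sum fun i _ => ?_)
        refine le_mul_of_one_le_right (by positivity) ?_
        rw [← ENNReal.ofReal_one]
        exact ENNReal.ofReal_le_ofReal (one_le_pow₀ (he.one_le i))
    _ ≤ _ := mul_le_mul_right (ENNReal.rpow_le_rpow (ENNReal.sum_le_tsum s) (by positivity)) _

theorem summable_mul_sphereBump (hd : 1 ≤ d) {p : ℝ} (hp : 0 < p) (hpd : p < critExp d)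
    {ι : Type} {e : ι → Space d × ℝ} (he : IsGridFamily e) {γ : ι → ℂ}
    (hγ : ∑' i, ‖γ i‖ₑ ^ p * ENNReal.ofReal ((e i).2 ^ (d - 1)) ≠ ⊤) (x : Space d) :
    Summable fun i => γ i * sphereBump ψ₀ (e i).1 (e i).2 x := by
  rcases le_total p 1 with hp1 | hp1
  · obtain ⟨C, hC⟩ := hψ.exists_tsum_enorm_le_of_le_one hd hp hp1
    refine summable_of_tsum_enorm_ne_top (ne_top_of_le_ne_top ?_ (hC e γ x he))
    exact ENNReal.mul_ne_top ENNReal.coe_ne_top (ENNReal.rpow_ne_top_of_nonneg (by positivity) hγ)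
  · obtain ⟨C, hC⟩ := hψ.exists_tsum_enorm_le hd hp1 hpd
    refine summable_of_tsum_enorm_ne_top (ne_top_of_le_ne_top ?_ (hC e γ x he))
    exact ENNReal.mul_ne_top ENNReal.coe_ne_top (ENNReal.add_ne_top.2 ⟨ENNReal.one_ne_top, hγ⟩)

/-- The discrete inequality. -/
theorem exists_lintegral_tsum_rpow_le (hd : 1 ≤ d) {p : ℝ} (hp : 0 < p) (hpd : p < critExp d) :
    ∃ K : ℝ≥0, ∀ {ι : Type} (e : ι → Space d × ℝ) (γ : ι → ℂ), IsGridFamily e →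
      ∑' i, ‖γ i‖ₑ ^ p * ENNReal.ofReal ((e i).2 ^ (d - 1)) ≠ ⊤ →
      Measurable (fun x => ∑' i, γ i * sphereBump ψ₀ (e i).1 (e i).2 x) ∧
      ∫⁻ x, ‖∑' i, γ i * sphereBump ψ₀ (e i).1 (e i).2 x‖ₑ ^ p
        ≤ K * ∑' i, ‖γ i‖ₑ ^ p * ENNReal.ofReal ((e i).2 ^ (d - 1)) := by
  obtain ⟨K, hK⟩ := hψ.exists_lintegral_sum_rpow_le hd hp hpd
  refine ⟨K, fun {ι} e γ he hγ => ?_⟩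
  -- Finiteness of the right-hand side makes this set countable. Limits along its finite subsets
  -- then preserve measurability and obey Fatou's lemma.
  set J := Function.support γ with hJ
  have hcount : J.Countable := by
    refine (Summable.countable_support_ennreal hγ).mono fun i hi => ?_
    have h1 := he.one_le i
    have h2 : (0 : ℝ) < (e i).2 ^ (d - 1) := by positivity
    have h3 : γ i ≠ 0 := hi
    simp [h2, h3, hp]
  have := hcount.to_subtype
  have hsum := hψ.summable_mul_sphereBump hd hp hpd he hγ
  have hJt : ∀ x, ∑' i : J, γ i * sphereBump ψ₀ (e i).1 (e i).2 x
      = ∑' i, γ i * sphereBump ψ₀ (e i).1 (e i).2 x := fun x =>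
    tsum_subtype_eq_of_support_subset (f := fun i => γ i * sphereBump ψ₀ (e i).1 (e i).2 x)
      fun i hi => left_ne_zero_of_mul hi
  have hlim : ∀ x, Filter.Tendsto
      (fun s : Finset J => ∑ i ∈ s, γ i * sphereBump ψ₀ (e i).1 (e i).2 x) Filter.atTop
      (nhds (∑' i, γ i * sphereBump ψ₀ (e i).1 (e i).2 x)) := fun x => by
    rw [← hJt x]
    exact ((hsum x).subtype J).hasSum
  have hcont : ∀ s : Finset J, Continuous
      fun x => ∑ i ∈ s, γ i * sphereBump ψ₀ (e i).1 (e i).2 x := fun s =>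
    continuous_finsetSum _ fun i _ =>
      continuous_const.mul (hψ.continuous_sphereBump_right (e i).1 (e i).2)
  refine ⟨measurable_of_tendsto_metrizable' Filter.atTop (fun s => (hcont s).measurable)
    (tendsto_pi_nhds.2 hlim), ?_⟩
  have hfin : ∀ s : Finset J, ∫⁻ x, ‖∑ i ∈ s, γ i * sphereBump ψ₀ (e i).1 (e i).2 x‖ₑ ^ p
      ≤ K * ∑' i, ‖γ i‖ₑ ^ p * ENNReal.ofReal ((e i).2 ^ (d - 1)) := by
    intro s
    have h := hK _ (Function.extend e γ 0)
      (he.isGrid_map (s.map (Function.Embedding.subtype _)))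
    have h1 := fun x => he.sum_map (s.map (Function.Embedding.subtype _)) γ
      fun z q => z * sphereBump ψ₀ q.1 q.2 x
    have h2 := he.sum_map (s.map (Function.Embedding.subtype _)) γ
      fun z q => ‖z‖ₑ ^ p * ENNReal.ofReal (q.2 ^ (d - 1))
    simp only [h1, h2] at h
    simp only [Finset.sum_map, Function.Embedding.subtype_apply] at h
    refine h.trans (mul_le_mul_right ?_ _)
    exact (ENNReal.sum_le_tsum s).trans (ENNReal.tsum_comp_le_tsum_of_injective
      Subtype.val_injective fun i => ‖γ i‖ₑ ^ p * ENNReal.ofReal ((e i).2 ^ (d - 1)))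
  calc ∫⁻ x, ‖∑' i, γ i * sphereBump ψ₀ (e i).1 (e i).2 x‖ₑ ^ p
      = ∫⁻ x, Filter.liminf
          (fun s : Finset J => ‖∑ i ∈ s, γ i * sphereBump ψ₀ (e i).1 (e i).2 x‖ₑ ^ p)
          Filter.atTop := by
        refine lintegral_congr fun x => (Filter.Tendsto.liminf_eq ?_).symm
        exact ((ENNReal.continuous_rpow_const.tendsto _).comp
          ((continuous_enorm.tendsto _).comp (hlim x)))
    _ ≤ _ := lintegral_liminf_le fun s => ((hcont s).measurable.enorm).pow_const p
    _ ≤ _ := Filter.liminf_le_of_frequently_le' (Filter.Frequently.of_forall hfin)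

end IsOscillatingBump

theorem memLp_and_eLpNorm_le_of_lintegral_le {p : ℝ} (hp : 0 < p) {g : Space d → ℂ}
    (hg : AEStronglyMeasurable g volume) {K : ℝ≥0} {W : ℝ≥0∞} (hW : W ≠ ⊤)
    (h : ∫⁻ x, ‖g x‖ₑ ^ p ≤ K * W) :
    MemLp g (ENNReal.ofReal p) volume ∧
      eLpNorm g (ENNReal.ofReal p) volume ≤ (K ^ (1 / p) : ℝ≥0) * W ^ (1 / p) := by
  have hle : eLpNorm g (ENNReal.ofReal p) volume ≤ (K ^ (1 / p) : ℝ≥0) * W ^ (1 / p) := by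
    rw [eLpNorm_eq_lintegral_rpow_enorm_toReal (by simpa using hp) ENNReal.ofReal_ne_top,
      ENNReal.toReal_ofReal hp.le, ENNReal.coe_rpow_of_nonneg _ (by positivity : 0 ≤ 1 / p),
      ← ENNReal.mul_rpow_of_nonneg _ _ (by positivity : 0 ≤ 1 / p)]
    exact ENNReal.rpow_le_rpow h (by positivity)
  refine ⟨⟨hg, hle.trans_lt (ENNReal.mul_lt_top ENNReal.coe_lt_top ?_)⟩, hle⟩
  exact (ENNReal.rpow_ne_top_of_nonneg (by positivity) hW).lt_top

end Families

/-! ### Tiling by unit cells -/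

section Cells

variable {d : ℕ}

/-- The integer lattice in `ℝ^d`. -/
abbrev intLattice (d : ℕ) : Submodule ℤ (Space d) :=
  Submodule.span ℤ (Set.range (EuclideanSpace.basisFun (Fin d) ℝ).toBasis)

/-- Lebesgue measure on the cell whose translates tile `ℝ^d × (1, ∞)`. -/
noncomputable def cellMeasure (d : ℕ) : Measure (Space d × ℝ) :=
  (volume.restrict
    (ZSpan.fundamentalDomain (EuclideanSpace.basisFun (Fin d) ℝ).toBasis)).prod
    (volume.restrict (Set.Ioc (0 : ℝ) 1))

/-- The translation of the base cell to the cell with index `i`. -/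
def cellShift (i : intLattice d × ℕ) : Space d × ℝ → Space d × ℝ :=
  Prod.map (fun z => (i.1 : Space d) + z) fun s => ((i.2 : ℝ) + 1) + s

theorem measurableEmbedding_cellShift (i : intLattice d × ℕ) :
    MeasurableEmbedding (cellShift i) :=
  (measurableEmbedding_addLeft _).prodMap (measurableEmbedding_addLeft _)

theorem continuous_cellShift (i : intLattice d × ℕ) : Continuous (cellShift i) :=
  Continuous.prodMap (continuous_const.add continuous_id) (continuous_const.add continuous_id)

instance : IsFiniteMeasure (cellMeasure d) := by
  have : IsFiniteMeasure ((volume : Measure (Space d)).restrict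
      (ZSpan.fundamentalDomain (EuclideanSpace.basisFun (Fin d) ℝ).toBasis)) :=
    isFiniteMeasure_restrict.2 (ZSpan.fundamentalDomain_isBounded _).measure_lt_top.ne
  unfold cellMeasure
  infer_instance

theorem one_le_norm_of_mem_intLattice {z : Space d} (hz : z ∈ intLattice d) (h0 : z ≠ 0) :
    1 ≤ ‖z‖ := by
  rw [Module.Basis.mem_span_iff_repr_mem] at hz
  obtain ⟨i, hi⟩ : ∃ i, z i ≠ 0 := by
    by_contra! h
    exact h0 (PiLp.ext h)
  obtain ⟨n, hn⟩ := hz i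
  have hn' : (n : ℝ) = z i := by simpa using hn
  refine le_trans ?_ (PiLp.norm_apply_le z i)
  rw [← hn'] at hi ⊢
  rw [Real.norm_eq_abs, ← Int.cast_abs]
  exact_mod_cast Int.one_le_abs (by rintro rfl; simp at hi)

/-- One point of the base cell together with all its translates is an admissible grid, with radii at
least 1 because the shift in the radius starts at 1. -/
theorem isGridFamily_cellShift {ζ : Space d × ℝ} (hζ : 0 ≤ ζ.2) :
    IsGridFamily fun i : intLattice d × ℕ => cellShift i ζ where
  injective i j h := by
    obtain ⟨h1, h2⟩ := Prod.ext_iff.1 h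
    simp only [cellShift, Prod.map_fst, Prod.map_snd] at h1 h2
    refine Prod.ext (Subtype.ext (add_right_cancel h1)) ?_
    exact_mod_cast add_right_cancel (add_right_cancel h2)
  fst i j := by
    simp only [cellShift, Prod.map_fst]
    rw [dist_add_right, dist_eq_norm]
    rcases eq_or_ne (i.1 : Space d) j.1 with h | h
    · exact Or.inl (by rw [h])
    · exact Or.inr (one_le_norm_of_mem_intLattice (sub_mem i.1.2 j.1.2) (sub_ne_zero.2 h))
  snd i j := by
    simp only [cellShift, Prod.map_snd]
    rw [dist_add_right, dist_add_right, Real.dist_eq]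
    rcases eq_or_ne i.2 j.2 with h | h
    · exact Or.inl (by rw [h])
    · right
      have : (i.2 : ℤ) - j.2 ≠ 0 := by omega
      exact_mod_cast Int.one_le_abs this
  one_le i := by
    simp only [cellShift, Prod.map_snd]
    have : (0 : ℝ) ≤ i.2 := by positivity
    linarith

theorem volume_eq_sum_map_lattice : (volume : Measure (Space d)) = Measure.sum
    fun g : intLattice d => Measure.map (fun z => (g : Space d) + z) (volume.restrict
      (ZSpan.fundamentalDomain (EuclideanSpace.basisFun (Fin d) ℝ).toBasis)) := by
  have : VAddInvariantMeasure (intLattice d) (Space d) volume :=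
    ⟨fun c s _ => measure_preimage_add volume (c : Space d) s⟩
  have : MeasurableConstVAdd (intLattice d) (Space d) :=
    ⟨fun c => measurable_const_add (c : Space d)⟩
  conv_lhs => rw [← (ZSpan.isAddFundamentalDomain
    (EuclideanSpace.basisFun (Fin d) ℝ).toBasis volume).sum_restrict]
  congr 1 with g : 1
  exact ((measurePreserving_add_left volume (g : Space d)).restrict_image_emb
    (measurableEmbedding_addLeft _) _).map_eq.symm

theorem restrict_Ioi_eq_sum_map : (volume : Measure ℝ).restrict (Set.Ioi 1) = Measure.sum
    fun n : ℕ => Measure.map (fun s => ((n : ℝ) + 1) + s) (volume.restrict (Set.Ioc 0 1)) := by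
  have hU : (Set.Ioi (1 : ℝ)) = ⋃ n : ℕ, (fun s => ((n : ℝ) + 1) + s) '' Set.Ioc 0 1 := by
    ext r
    simp only [mem_Ioi, mem_iUnion, image_const_add_Ioc, mem_Ioc]
    constructor
    · intro hr
      have hc : 1 < ⌈r⌉₊ := by
        rw [Nat.lt_ceil]; exact_mod_cast hr
      -- The cell of index n is (n+1, n+2], so n + 2 is the ceiling of r.
      refine ⟨⌈r⌉₊ - 2, ?_⟩
      have e : ((⌈r⌉₊ - 2 : ℕ) : ℝ) = ⌈r⌉₊ - 2 := by
        rw [Nat.cast_sub (by omega)]; norm_num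
      have h1 := Nat.ceil_lt_add_one (by linarith : 0 ≤ r)
      have h2 := Nat.le_ceil r
      rw [e]
      constructor <;> linarith
    · rintro ⟨n, hn, -⟩
      have : (0 : ℝ) ≤ n := by positivity
      linarith
  have hmeas : ∀ n : ℕ, MeasurableSet ((fun s => ((n : ℝ) + 1) + s) '' Set.Ioc 0 1) := fun n => by
    rw [image_const_add_Ioc]; exact measurableSet_Ioc
  rw [hU, Measure.restrict_iUnion ?_ hmeas]
  · congr 1 with n : 1
    exact ((measurePreserving_add_left volume ((n : ℝ) + 1)).restrict_image_emb
      (measurableEmbedding_addLeft _) _).map_eq.symm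
  · intro m n hmn
    refine Set.disjoint_left.2 fun r hr hr' => hmn ?_
    simp only [image_const_add_Ioc] at hr hr'
    obtain ⟨h1, h2⟩ := hr
    obtain ⟨h3, h4⟩ := hr'
    have a : (m : ℝ) < n + 1 := by linarith
    have b : (n : ℝ) < m + 1 := by linarith
    have a' : m < n + 1 := by exact_mod_cast a
    have b' : n < m + 1 := by exact_mod_cast b
    omega

/-- Integrals over ℝ^d × (1, ∞) thereby become integrals over the base cell of sums over its
translates, to which the discrete inequality applies. -/
theorem prod_restrict_Ioi_eq_sum_map :
    (volume : Measure (Space d)).prod (volume.restrict (Set.Ioi (1 : ℝ)))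
      = Measure.sum fun i : intLattice d × ℕ => Measure.map (cellShift i) (cellMeasure d) := by
  conv_lhs => rw [volume_eq_sum_map_lattice, restrict_Ioi_eq_sum_map]
  rw [Measure.prod_sum]
  congr 1 with i : 1
  exact Measure.map_prod_map _ _ (measurable_const_add _) (measurable_const_add _)

theorem ae_cellMeasure_nonneg : ∀ᵐ ζ ∂(cellMeasure d), 0 ≤ ζ.2 := by
  have h : ∀ᵐ s ∂((volume : Measure ℝ).restrict (Set.Ioc 0 1)), (0 : ℝ) ≤ s :=
    (ae_restrict_mem measurableSet_Ioc).mono fun s hs => hs.1.le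
  exact Measure.quasiMeasurePreserving_snd.ae h

theorem AEStronglyMeasurable.comp_cellShift {E : Type} [TopologicalSpace E]
    [TopologicalSpace.PseudoMetrizableSpace E] {f : Space d × ℝ → E}
    (hf : AEStronglyMeasurable f
      ((volume : Measure (Space d)).prod (volume.restrict (Set.Ioi (1 : ℝ)))))
    (i : intLattice d × ℕ) : AEStronglyMeasurable (fun ζ => f (cellShift i ζ)) (cellMeasure d) := by
  rw [prod_restrict_Ioi_eq_sum_map, aestronglyMeasurable_sum_measure_iff] at hf
  exact (hf i).comp_measurable (measurableEmbedding_cellShift i).measurable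

theorem lintegral_prod_restrict_Ioi {f : Space d × ℝ → ℝ≥0∞}
    (hf : AEMeasurable f
      ((volume : Measure (Space d)).prod (volume.restrict (Set.Ioi (1 : ℝ))))) :
    ∫⁻ q, f q ∂((volume : Measure (Space d)).prod (volume.restrict (Set.Ioi (1 : ℝ))))
      = ∫⁻ ζ, ∑' i : intLattice d × ℕ, f (cellShift i ζ) ∂(cellMeasure d) := by
  have h := fun i => (AEStronglyMeasurable.comp_cellShift hf.aestronglyMeasurable i).aemeasurable
  rw [lintegral_tsum h, prod_restrict_Ioi_eq_sum_map, lintegral_sum_measure]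
  exact tsum_congr fun i => (measurableEmbedding_cellShift i).lintegral_map _

theorem integral_prod_restrict_Ioi {f : Space d × ℝ → ℂ}
    (hf : Integrable f ((volume : Measure (Space d)).prod (volume.restrict (Set.Ioi (1 : ℝ))))) :
    ∫ q, f q ∂((volume : Measure (Space d)).prod (volume.restrict (Set.Ioi (1 : ℝ))))
      = ∫ ζ, ∑' i : intLattice d × ℕ, f (cellShift i ζ) ∂(cellMeasure d) := by
  have h := AEStronglyMeasurable.comp_cellShift hf.aestronglyMeasurable
  have hfin : ∫⁻ q, ‖f q‖ₑ ∂((volume : Measure (Space d)).prod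
      (volume.restrict (Set.Ioi (1 : ℝ)))) ≠ ⊤ := hf.2.ne
  rw [lintegral_prod_restrict_Ioi hf.1.enorm, lintegral_tsum fun i => (h i).enorm] at hfin
  rw [integral_tsum h hfin]
  rw [prod_restrict_Ioi_eq_sum_map] at hf ⊢
  rw [integral_sum_measure hf]
  exact tsum_congr fun i => (measurableEmbedding_cellShift i).integral_map _

end Cells

/-! ### The continuous inequality -/

section Continuous

variable {d : ℕ} {ψ₀ : Space d → ℂ}

/-- The product of Lebesgue measures on `ℝ^d × (1, ∞)`. -/
noncomputable abbrev prodMeasure (d : ℕ) : Measure (Space d × ℝ) :=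
  (volume : Measure (Space d)).prod (volume.restrict (Set.Ioi (1 : ℝ)))

/-- Hölder against the constant 1; this is how the average over the cell is taken out of the p-th
power. -/
theorem enorm_integral_rpow_le {α : Type} [MeasurableSpace α] (ν : Measure α) {p : ℝ} (hp : 1 ≤ p)
    {g : α → ℂ} (hg : AEStronglyMeasurable g ν) :
    ‖∫ a, g a ∂ν‖ₑ ^ p ≤ ν univ ^ (p - 1) * ∫⁻ a, ‖g a‖ₑ ^ p ∂ν := by
  have hp0 : 0 < p := by linarith
  have h := eLpNorm_le_eLpNorm_mul_rpow_measure_univ (p := 1) (q := ENNReal.ofReal p)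
    (by rw [← ENNReal.ofReal_one]; exact ENNReal.ofReal_le_ofReal hp) hg
  rw [eLpNorm_one_eq_lintegral_enorm,
    eLpNorm_eq_lintegral_rpow_enorm_toReal (by simpa using hp0) ENNReal.ofReal_ne_top,
    ENNReal.toReal_ofReal hp0.le, ENNReal.toReal_one, div_one] at h
  refine (ENNReal.rpow_le_rpow ((enorm_integral_le_lintegral_enorm _).trans h) hp0.le).trans_eq ?_
  rw [ENNReal.mul_rpow_of_nonneg _ _ hp0.le, ← ENNReal.rpow_mul, ← ENNReal.rpow_mul,
    one_div_mul_cancel hp0.ne', ENNReal.rpow_one, mul_comm, sub_mul, one_div_mul_cancel hp0.ne',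
    one_mul]

namespace IsOscillatingBump

variable (hψ : IsOscillatingBump ψ₀)
include hψ

/-- The continuous inequality. -/
theorem exists_lintegral_integral_rpow_le (hd : 1 ≤ d) {p : ℝ} (hp : 1 ≤ p)
    (hpd : p < critExp d) :
    ∃ K : ℝ≥0, ∀ h : Space d × ℝ → ℂ, AEStronglyMeasurable h (prodMeasure d) →
      ∫⁻ q, ‖h q‖ₑ ^ p * ENNReal.ofReal (q.2 ^ (d - 1)) ∂(prodMeasure d) ≠ ⊤ →
      (∀ x, Integrable (fun q => h q * sphereBump ψ₀ q.1 q.2 x) (prodMeasure d)) ∧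
      AEStronglyMeasurable (fun x => ∫ q, h q * sphereBump ψ₀ q.1 q.2 x ∂(prodMeasure d)) volume ∧
      ∫⁻ x, ‖∫ q, h q * sphereBump ψ₀ q.1 q.2 x ∂(prodMeasure d)‖ₑ ^ p
        ≤ K * ∫⁻ q, ‖h q‖ₑ ^ p * ENNReal.ofReal (q.2 ^ (d - 1)) ∂(prodMeasure d) := by
  have hp0 : 0 < p := by linarith
  obtain ⟨C, hC⟩ := hψ.exists_tsum_enorm_le hd hp hpd
  obtain ⟨K, hK⟩ := hψ.exists_lintegral_tsum_rpow_le hd hp0 hpd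
  set V : ℝ≥0 := (cellMeasure d univ).toNNReal with hV
  have hVe : (V : ℝ≥0∞) = cellMeasure d univ := ENNReal.coe_toNNReal (measure_ne_top _ _)
  refine ⟨V ^ (p - 1) * K, fun h hh hW => ?_⟩
  have hFc := hψ.continuous_sphereBump
  have hFx : ∀ x, Continuous fun q : Space d × ℝ => sphereBump ψ₀ q.1 q.2 x := fun x =>
    hFc.comp (continuous_id.prodMk continuous_const)
  have hwm : AEMeasurable (fun q : Space d × ℝ => ‖h q‖ₑ ^ p * ENNReal.ofReal (q.2 ^ (d - 1)))
      (prodMeasure d) :=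
    (hh.enorm.pow_const p).mul (by fun_prop)
  set w : Space d × ℝ → ℝ≥0∞ := fun ζ => ∑' i : intLattice d × ℕ,
    ‖h (cellShift i ζ)‖ₑ ^ p * ENNReal.ofReal ((cellShift i ζ).2 ^ (d - 1)) with hw
  have hWw : ∫⁻ q, ‖h q‖ₑ ^ p * ENNReal.ofReal (q.2 ^ (d - 1)) ∂(prodMeasure d)
      = ∫⁻ ζ, w ζ ∂(cellMeasure d) := lintegral_prod_restrict_Ioi hwm
  have hwm' : AEMeasurable w (cellMeasure d) := AEMeasurable.tsum fun i =>
    (AEStronglyMeasurable.comp_cellShift hwm.aestronglyMeasurable i).aemeasurable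
  -- For almost every position in the cell the coefficients h at the translates have finite discrete
  -- norm.
  have hwfin : ∀ᵐ ζ ∂(cellMeasure d), w ζ < ⊤ := ae_lt_top' hwm' (hWw ▸ hW)
  have hmeas : ∀ x, AEStronglyMeasurable (fun q => h q * sphereBump ψ₀ q.1 q.2 x)
      (prodMeasure d) := fun x => hh.mul (hFx x).aestronglyMeasurable
  have hint : ∀ x, Integrable (fun q => h q * sphereBump ψ₀ q.1 q.2 x) (prodMeasure d) := by
    intro x
    refine ⟨hmeas x, ?_⟩
    rw [HasFiniteIntegral, lintegral_prod_restrict_Ioi (hmeas x).enorm]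
    -- The inhomogeneous form 1 + w of the pointwise bound is integrable because the cell has finite
    -- measure.
    calc _ ≤ ∫⁻ ζ, C * (1 + w ζ) ∂(cellMeasure d) := by
          refine lintegral_mono_ae (ae_cellMeasure_nonneg.mono fun ζ hζ => ?_)
          exact hC _ (fun i => h (cellShift i ζ)) x (isGridFamily_cellShift hζ)
      _ = C * (cellMeasure d univ + ∫⁻ ζ, w ζ ∂(cellMeasure d)) := by
          rw [lintegral_const_mul' _ _ ENNReal.coe_ne_top, lintegral_add_left measurable_const,
            lintegral_one]
      _ < ⊤ := by
          rw [← hWw]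
          exact ENNReal.mul_lt_top ENNReal.coe_lt_top
            (ENNReal.add_lt_top.2 ⟨measure_lt_top _ _, hW.lt_top⟩)
  have hprod : AEStronglyMeasurable
      (fun z : Space d × (Space d × ℝ) => h z.2 * sphereBump ψ₀ z.2.1 z.2.2 z.1)
      (volume.prod (prodMeasure d)) :=
    hh.comp_snd.mul
      (hFc.comp (continuous_snd.prodMk continuous_fst)).aestronglyMeasurable
  refine ⟨hint, hprod.integral_prod_right', ?_⟩
  set g : Space d × (Space d × ℝ) → ℂ := fun z => ∑' i : intLattice d × ℕ,
    h (cellShift i z.2) * sphereBump ψ₀ (cellShift i z.2).1 (cellShift i z.2).2 z.1 with hg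
  have hgm : AEStronglyMeasurable g (volume.prod (cellMeasure d)) :=
    AEStronglyMeasurable.tsum fun i => (AEStronglyMeasurable.comp_cellShift hh i).comp_snd.mul
      (hFc.comp (((continuous_cellShift i).comp continuous_snd).prodMk
        continuous_fst)).aestronglyMeasurable
  have hgx : ∀ x, AEStronglyMeasurable (fun ζ => g (x, ζ)) (cellMeasure d) := fun x =>
    AEStronglyMeasurable.tsum fun i => AEStronglyMeasurable.comp_cellShift (hmeas x) i
  calc ∫⁻ x, ‖∫ q, h q * sphereBump ψ₀ q.1 q.2 x ∂(prodMeasure d)‖ₑ ^ p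
      ≤ ∫⁻ x, cellMeasure d univ ^ (p - 1) * ∫⁻ ζ, ‖g (x, ζ)‖ₑ ^ p ∂(cellMeasure d) := by
        refine lintegral_mono fun x => ?_
        rw [integral_prod_restrict_Ioi (hint x)]
        exact enorm_integral_rpow_le _ hp (hgx x)
    _ = cellMeasure d univ ^ (p - 1) * ∫⁻ ζ, (∫⁻ x, ‖g (x, ζ)‖ₑ ^ p) ∂(cellMeasure d) := by
        rw [lintegral_const_mul' _ _ (ENNReal.rpow_ne_top_of_nonneg (by linarith)
          (measure_ne_top _ _)), lintegral_lintegral_swap (hgm.enorm.pow_const p)]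
    _ ≤ cellMeasure d univ ^ (p - 1) * ∫⁻ ζ, K * w ζ ∂(cellMeasure d) := by
        refine mul_le_mul_right (lintegral_mono_ae ?_) _
        filter_upwards [ae_cellMeasure_nonneg, hwfin] with ζ hζ hζw
        exact (hK _ (fun i => h (cellShift i ζ)) (isGridFamily_cellShift hζ) hζw.ne).2
    _ = _ := by
        rw [lintegral_const_mul' _ _ ENNReal.coe_ne_top, ← hWw, ← hVe, ENNReal.coe_mul,
          ENNReal.coe_rpow_of_nonneg _ (by linarith), mul_assoc]

end IsOscillatingBump

end Continuous

/-! ### From vanishing derivatives to a power bound -/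

section Vanishing

/-- Induction on n through the mean value inequality: the derivative vanishes to one order less. The
target space is quantified inside, since it changes when f is replaced by its derivative. -/
theorem exists_norm_le_pow_of_iteratedFDeriv_eq_zero {E : Type} [NormedAddCommGroup E]
    [NormedSpace ℝ E] [FiniteDimensional ℝ E] (n : ℕ) : ∀ {F : Type} [NormedAddCommGroup F]
    [NormedSpace ℝ F] {f : E → F}, ContDiff ℝ (⊤ : ℕ∞) f →
    (∀ k < n, iteratedFDeriv ℝ k f 0 = 0) →
    ∃ C : ℝ, 0 ≤ C ∧ ∀ ξ, ‖ξ‖ ≤ 1 → ‖f ξ‖ ≤ C * ‖ξ‖ ^ n := by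
  induction n with
  | zero =>
    intro F _ _ f hf _
    have := FiniteDimensional.proper ℝ E
    obtain ⟨C, hC⟩ := (isCompact_closedBall (0 : E) 1).exists_bound_of_continuousOn
      hf.continuous.continuousOn
    exact ⟨C, (norm_nonneg _).trans (hC 0 (by simp)), fun ξ hξ => by
      simpa using hC ξ (by simpa using hξ)⟩
  | succ n ih =>
    intro F _ _ f hf h
    have hf' : ContDiff ℝ (⊤ : ℕ∞) (fderiv ℝ f) := hf.fderiv_right (by simp)
    obtain ⟨C, hC0, hC⟩ := ih hf' fun k hk => by
      have h1 := h (k + 1) (by omega)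
      rw [iteratedFDeriv_succ_eq_comp_right, Function.comp_apply] at h1
      exact (LinearIsometryEquiv.map_eq_zero_iff _).1 h1
    have h0 : f 0 = 0 := by
      have h1 := h 0 (by omega)
      rw [iteratedFDeriv_zero_eq_comp, Function.comp_apply] at h1
      exact (LinearIsometryEquiv.map_eq_zero_iff _).1 h1
    refine ⟨C, hC0, fun ξ hξ => ?_⟩
    have key := (convex_closedBall (0 : E) ‖ξ‖).norm_image_sub_le_of_norm_fderiv_le (𝕜 := ℝ)
      (f := f) (C := C * ‖ξ‖ ^ n) (fun x _ => hf.differentiable (by simp) x) (fun x hx => ?_)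
      (by simp : (0 : E) ∈ _) (by simp : ξ ∈ _)
    · rwa [h0, sub_zero, sub_zero, mul_assoc, ← pow_succ] at key
    · rw [mem_closedBall_zero_iff] at hx
      exact (hC x (hx.trans hξ)).trans (by gcongr)

variable {d : ℕ} {ψ₀ : Space d → ℂ}

/-- Vanishing to order 2d already gives the power bound near 0; away from 0 the transform is
bounded. -/
theorem IsBump.isOscillatingBump (hψ : IsBump ψ₀) : IsOscillatingBump ψ₀ where
  radial := hψ.radial
  smooth := hψ.smooth
  support_subset := hψ.support_subset
  fourier_le := by
    have hc : HasCompactSupport ψ₀ := (isCompact_closedBall 0 (1 / 10)).of_isClosed_subset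
      (isClosed_tsupport _) hψ.support_subset
    have hF : 𝓕 ψ₀ = (𝓕 (hc.toSchwartzMap hψ.smooth) : SchwartzMap (Space d) ℂ) := by
      rw [SchwartzMap.fourier_coe]; rfl
    have hs : ContDiff ℝ (⊤ : ℕ∞) (𝓕 ψ₀) := by
      rw [hF]; exact SchwartzMap.smooth _ _
    obtain ⟨C, hC0, hC⟩ := exists_norm_le_pow_of_iteratedFDeriv_eq_zero (2 * d) hs
      fun k hk => hψ.fourier_vanish k (by omega)
    obtain ⟨B, hB0, hB⟩ := IsOscillatingBump.exists_fourier_bound (ψ₀ := ψ₀)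
    refine ⟨C + B, fun ξ => ?_⟩
    rcases le_total ‖ξ‖ 1 with h | h
    · exact (hC ξ h).trans (by gcongr; linarith)
    · calc ‖𝓕 ψ₀ ξ‖ ≤ B * 1 := by rw [mul_one]; exact hB ξ
        _ ≤ (C + B) * ‖ξ‖ ^ (2 * d) := by
          gcongr
          · linarith
          · exact one_le_pow₀ h

end Vanishing

/-! ### Construction of an oscillating bump -/

section Existence

open scoped Laplacian

variable {d : ℕ}

theorem fourierInv_isRadial {f : Space d → ℂ} (hf : IsRadial f) : IsRadial (𝓕⁻ f) := by
  intro x x' h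
  rw [Real.fourierInv_eq_fourier_neg, Real.fourierInv_eq_fourier_neg]
  exact fourier_isRadial hf _ _ (by simpa using h)

theorem fourier_laplacian_apply (f : SchwartzMap (Space d) ℂ) (ξ : Space d) :
    𝓕 (Δ f) ξ = -((2 * Real.pi) ^ 2 * ‖ξ‖ ^ 2 : ℝ) * 𝓕 f ξ := by
  have ht : Function.HasTemperateGrowth fun x : Space d => ‖x‖ ^ 2 := by fun_prop
  rw [SchwartzMap.laplacian_eq_fourierMultiplierCLM, FourierTransform.fourier_smul,
    SchwartzMap.fourierMultiplierCLM_apply, FourierTransform.fourier_fourierInv_eq,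
    smul_apply]
  have := SchwartzMap.smulLeftCLM_apply_apply (F := ℂ) ht (𝓕 f) ξ
  rw [this]
  simp
  ring

theorem tsupport_laplacian_subset (f : SchwartzMap (Space d) ℂ) : 
    tsupport (Δ f : SchwartzMap (Space d) ℂ) ⊆ tsupport f := by
  refine closure_minimal (fun x hx => ?_) (isClosed_tsupport _)
  by_contra h
  rw [notMem_tsupport_iff_eventuallyEq] at h
  refine hx ?_
  rw [SchwartzMap.laplacian_apply,
    (InnerProductSpace.laplacian_congr_nhds h).self_of_nhds]
  have : Δ (0 : Space d → ℂ) = 0 := by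
    ext y
    simp [InnerProductSpace.laplacian_eq_iteratedFDeriv_stdOrthonormalBasis]
  rw [this]; rfl

/-- On the Fourier side the Laplacian multiplies by a radial function, and the transform and its
inverse preserve radiality. -/
theorem isRadial_laplacian {f : SchwartzMap (Space d) ℂ} (hf : IsRadial f) :
    IsRadial (Δ f : SchwartzMap (Space d) ℂ) := by
  have h : IsRadial (𝓕 (Δ f) : SchwartzMap (Space d) ℂ) := by
    intro x x' hx
    rw [fourier_laplacian_apply, fourier_laplacian_apply, hx]
    congr 1
    have := fourier_isRadial hf x x' hx
    rwa [← SchwartzMap.fourier_coe] at this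
  have h2 := fourierInv_isRadial h
  rwa [← SchwartzMap.fourierInv_coe, FourierTransform.fourierInv_fourier_eq] at h2

/-- A radial smooth function on `ℝ^d` that is positive on the ball of radius `1/10` and vanishes
outside. -/
noncomputable def radialBump (d : ℕ) (x : Space d) : ℝ := Real.smoothTransition (1 - 100 * ‖x‖ ^ 2)

theorem contDiff_radialBump : ContDiff ℝ (⊤ : ℕ∞) (radialBump d) :=
  Real.smoothTransition.contDiff.comp (contDiff_const.sub (contDiff_const.mul (contDiff_norm_sq ℝ)))

theorem tsupport_radialBump_subset : tsupport (radialBump d) ⊆ Metric.closedBall 0 (1 / 10) := by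
  refine closure_minimal (fun x hx => ?_) Metric.isClosed_closedBall
  rw [mem_closedBall_zero_iff]
  by_contra! h
  exact hx (Real.smoothTransition.zero_of_nonpos (by nlinarith [norm_nonneg x]))

theorem hasCompactSupport_radialBump : HasCompactSupport (radialBump d) :=
  (isCompact_closedBall 0 (1 / 10)).of_isClosed_subset (isClosed_tsupport _)
    tsupport_radialBump_subset

/-- The bump `radialBump` as a complex-valued Schwartz function. -/
noncomputable def radialBumpSchwartz (d : ℕ) : SchwartzMap (Space d) ℂ :=
  HasCompactSupport.toSchwartzMap (f := fun x => (radialBump d x : ℂ))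
    (hasCompactSupport_radialBump.comp_left Complex.ofReal_zero)
    (Complex.ofRealCLM.contDiff.comp contDiff_radialBump)

theorem radialBumpSchwartz_apply (x : Space d) : radialBumpSchwartz d x = radialBump d x := rfl

/-- On the support |2π x·ξ| ≤ 2π · 9/40 < π/2, so the cosine is positive there and the real part of
the transform is positive. -/
theorem fourier_radialBump_ne_zero {ξ : Space d} (hξ : ‖ξ‖ ≤ 9 / 4) :
    𝓕 (radialBumpSchwartz d) ξ ≠ 0 := by
  intro h0
  have hre : (𝓕 (radialBumpSchwartz d) ξ).re
      = ∫ x : Space d, Real.cos (-2 * Real.pi * inner ℝ x ξ) * radialBump d x := by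
    rw [SchwartzMap.fourier_coe, Real.fourier_eq']
    have hi : Integrable fun v : Space d =>
        Complex.exp (↑(-2 * Real.pi * inner ℝ v ξ) * Complex.I) • radialBumpSchwartz d v := by
      refine ((radialBumpSchwartz d).integrable).bdd_mul (c := 1) ?_ ?_
      · exact (by fun_prop : Continuous _).aestronglyMeasurable
      · exact .of_forall fun v => (Complex.norm_exp_ofReal_mul_I _).le
    have h := Complex.reCLM.integral_comp_comm hi
    rw [Complex.reCLM_apply] at h
    rw [← h]
    refine integral_congr_ae (.of_forall fun v => ?_)
    simp only [Complex.reCLM_apply, smul_eq_mul, radialBumpSchwartz_apply,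
      Complex.re_mul_ofReal, Complex.exp_ofReal_mul_I_re]
  have hpos : 0 < ∫ x : Space d, Real.cos (-2 * Real.pi * inner ℝ x ξ) * radialBump d x := by
    refine Continuous.integral_pos_of_hasCompactSupport_nonneg_nonzero (x := 0) ?_ ?_ ?_ ?_
    · exact (by fun_prop : Continuous fun x : Space d =>
        Real.cos (-2 * Real.pi * inner ℝ x ξ)).mul contDiff_radialBump.continuous
    · exact hasCompactSupport_radialBump.mul_left
    · intro x
      rcases le_total ‖x‖ (1 / 10) with hx | hx
      · refine mul_nonneg (Real.cos_nonneg_of_mem_Icc ?_) (Real.smoothTransition.nonneg _)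
        have h1 := abs_real_inner_le_norm x ξ
        have h2 : ‖x‖ * ‖ξ‖ ≤ 1 / 10 * (9 / 4) := mul_le_mul hx hξ (norm_nonneg _) (by norm_num)
        have h3 := abs_le.1 (h1.trans h2)
        constructor <;> nlinarith [Real.pi_pos]
      · refine (mul_eq_zero_of_right _ (Real.smoothTransition.zero_of_nonpos ?_)).ge
        nlinarith [norm_nonneg x]
    · simp [radialBump]
  rw [← hre, h0] at hpos
  simp at hpos

theorem exists_iterate_laplacian_radialBump (n : ℕ) : ∃ f : SchwartzMap (Space d) ℂ,
    IsRadial f ∧ tsupport f ⊆ Metric.closedBall 0 (1 / 10) ∧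
      ∀ ξ, 𝓕 f ξ = (-((2 * Real.pi) ^ 2 * ‖ξ‖ ^ 2 : ℝ) : ℂ) ^ n * 𝓕 (radialBumpSchwartz d) ξ := by
  induction n with
  | zero =>
    refine ⟨radialBumpSchwartz d, fun x x' h => ?_, ?_, fun ξ => by simp⟩
    · rw [radialBumpSchwartz_apply, radialBumpSchwartz_apply, radialBump, radialBump, h]
    · refine (closure_mono fun x hx => ?_).trans tsupport_radialBump_subset
      intro h
      exact hx (by rw [radialBumpSchwartz_apply, h, Complex.ofReal_zero])
  | succ n ih =>
    obtain ⟨f, h1, h2, h3⟩ := ih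
    refine ⟨Δ f, isRadial_laplacian h1, (tsupport_laplacian_subset f).trans h2, fun ξ => ?_⟩
    rw [fourier_laplacian_apply, h3, pow_succ']
    ring

/-- Applying the Laplacian d times to the radial bump multiplies the transform by a constant times
|ξ|^(2d): a zero of the right order at 0 and no new zeros elsewhere, with support and radiality
preserved. -/
theorem exists_isOscillatingBump (d : ℕ) : ∃ ψ₀ : SchwartzMap (Space d) ℂ,
    IsOscillatingBump (ψ₀ : Space d → ℂ) ∧
      ∀ ξ, 1 / 4 ≤ ‖ξ‖ → ‖ξ‖ ≤ 9 / 4 → 𝓕 (ψ₀ : Space d → ℂ) ξ ≠ 0 := by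
  obtain ⟨f, h1, h2, h3⟩ := exists_iterate_laplacian_radialBump (d := d) d
  simp_rw [SchwartzMap.fourier_coe] at h3
  refine ⟨f, ⟨h1, f.smooth _, h2, ?_⟩, fun ξ hξ hξ' => ?_⟩
  · obtain ⟨B, hB0, hB⟩ := IsOscillatingBump.exists_fourier_bound
      (ψ₀ := (radialBumpSchwartz d : Space d → ℂ))
    refine ⟨((2 * Real.pi) ^ 2) ^ d * B, fun ξ => ?_⟩
    rw [h3, norm_mul, norm_pow, norm_neg, Complex.norm_real, Real.norm_of_nonneg (by positivity),
      mul_pow, ← pow_mul ‖ξ‖]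
    calc _ ≤ ((2 * Real.pi) ^ 2) ^ d * ‖ξ‖ ^ (2 * d) * B :=
          mul_le_mul_of_nonneg_left (hB ξ) (by positivity)
      _ = _ := by ring
  · rw [h3]
    refine mul_ne_zero (pow_ne_zero _ (neg_ne_zero.2 ?_)) ?_
    · rw [Complex.ofReal_ne_zero]
      have : 0 < ‖ξ‖ := by linarith
      positivity
    · have := fourier_radialBump_ne_zero hξ'
      rwa [SchwartzMap.fourier_coe] at this

end Existence

/-! ### Young's inequality and existence of convolutions -/

section Young

variable {d : ℕ}

/-- Hölder for b against 1, with respect to the measure a dμ. -/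
theorem lintegral_mul_rpow_le {α : Type} [MeasurableSpace α] {μ : Measure α} {a b : α → ℝ≥0∞}
    (ha : AEMeasurable a μ) (hb : AEMeasurable b μ) {p : ℝ} (hp : 1 ≤ p) :
    (∫⁻ t, a t * b t ∂μ) ^ p ≤ (∫⁻ t, a t ∂μ) ^ (p - 1) * ∫⁻ t, a t * b t ^ p ∂μ := by
  have hp0 : 0 < p := by linarith
  have hν := withDensity_absolutelyContinuous μ a
  have h := eLpNorm_le_eLpNorm_mul_rpow_measure_univ (p := 1) (q := ENNReal.ofReal p)
    (f := b) (μ := μ.withDensity a)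
    (by rw [← ENNReal.ofReal_one]; exact ENNReal.ofReal_le_ofReal hp)
    (hb.mono_ac hν).aestronglyMeasurable
  rw [eLpNorm_one_eq_lintegral_enorm,
    eLpNorm_eq_lintegral_rpow_enorm_toReal (by simpa using hp0) ENNReal.ofReal_ne_top,
    ENNReal.toReal_ofReal hp0.le, ENNReal.toReal_one, div_one, withDensity_apply _ .univ,
    Measure.restrict_univ] at h
  simp only [enorm_eq_self] at h
  rw [lintegral_withDensity_eq_lintegral_mul₀ ha hb,
    lintegral_withDensity_eq_lintegral_mul₀ ha (hb.pow_const p)] at h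
  refine (ENNReal.rpow_le_rpow h hp0.le).trans_eq ?_
  rw [ENNReal.mul_rpow_of_nonneg _ _ hp0.le, ← ENNReal.rpow_mul, ← ENNReal.rpow_mul,
    one_div_mul_cancel hp0.ne', ENNReal.rpow_one, mul_comm, sub_mul, one_div_mul_cancel hp0.ne',
    one_mul]
  rfl

theorem AEMeasurable.comp_sub {b : Space d → ℝ≥0∞} (hb : AEMeasurable b volume) (x : Space d) :
    AEMeasurable (fun t => b (x - t)) volume :=
  hb.comp_quasiMeasurePreserving (quasiMeasurePreserving_sub_left_of_right_invariant volume x)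

/-- Young's inequality. -/
theorem lintegral_lintegral_mul_sub_rpow_le {a b : Space d → ℝ≥0∞} (ha : AEMeasurable a volume)
    (ha' : ∫⁻ t, a t ≠ ⊤) (hb : AEMeasurable b volume) {p : ℝ} (hp : 1 ≤ p) :
    ∫⁻ x, (∫⁻ t, a t * b (x - t)) ^ p ≤ (∫⁻ t, a t) ^ p * ∫⁻ t, b t ^ p := by
  have hp0 : 0 < p := by linarith
  have hm : AEMeasurable (fun z : Space d × Space d => a z.2 * b (z.1 - z.2) ^ p)
      (volume.prod volume) :=
    ha.comp_snd.mul ((hb.comp_quasiMeasurePreserving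
      (quasiMeasurePreserving_sub_of_right_invariant volume volume)).pow_const p)
  calc ∫⁻ x, (∫⁻ t, a t * b (x - t)) ^ p
      ≤ ∫⁻ x, (∫⁻ t, a t) ^ (p - 1) * ∫⁻ t, a t * b (x - t) ^ p :=
        lintegral_mono fun x => lintegral_mul_rpow_le ha (hb.comp_sub x) hp
    _ = (∫⁻ t, a t) ^ (p - 1) * ∫⁻ t, (∫⁻ x, a t * b (x - t) ^ p) := by
        rw [lintegral_const_mul' _ _ (ENNReal.rpow_ne_top_of_nonneg (by linarith) ha'),
          lintegral_lintegral_swap hm]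
    _ = (∫⁻ t, a t) ^ (p - 1) * ∫⁻ t, a t * ∫⁻ x, b x ^ p := by
        congr 1
        refine lintegral_congr_ae ((ae_lt_top' ha ha').mono fun t ht => ?_)
        simp only
        rw [lintegral_const_mul' _ _ ht.ne, lintegral_sub_right_eq_self fun x => b x ^ p]
    _ = _ := by
        rw [lintegral_mul_const'' _ ha, ← mul_assoc]
        congr 1
        nth_rewrite 2 [← ENNReal.rpow_one (∫⁻ t, a t)]
        rw [← ENNReal.rpow_add_of_nonneg _ _ (by linarith) zero_le_one, sub_add_cancel]

variable {𝕜 : Type} [RCLike 𝕜]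

theorem aestronglyMeasurable_convolution {a b : Space d → 𝕜} (ha : AEStronglyMeasurable a volume)
    (hb : AEStronglyMeasurable b volume) :
    AEStronglyMeasurable (convolution a b (ContinuousLinearMap.mul ℝ 𝕜) volume) volume :=
  (ha.convolution_integrand (ContinuousLinearMap.mul ℝ 𝕜) hb).integral_prod_right'

theorem enorm_convolution_le (a b : Space d → 𝕜) (x : Space d) :
    ‖convolution a b (ContinuousLinearMap.mul ℝ 𝕜) volume x‖ₑ ≤ ∫⁻ t, ‖a t‖ₑ * ‖b (x - t)‖ₑ := by
  rw [convolution_def]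
  refine (enorm_integral_le_lintegral_enorm _).trans_eq (lintegral_congr fun t => ?_)
  rw [ContinuousLinearMap.mul_apply', enorm_mul]

theorem eLpNorm_convolution_le {a b : Space d → 𝕜} (ha : Integrable a)
    (hb : AEStronglyMeasurable b volume) {p : ℝ} (hp : 1 ≤ p) :
    eLpNorm (convolution a b (ContinuousLinearMap.mul ℝ 𝕜) volume) (ENNReal.ofReal p) volume
      ≤ eLpNorm a 1 volume * eLpNorm b (ENNReal.ofReal p) volume := by
  have hp0 : 0 < p := by linarith
  have hp' : ENNReal.ofReal p ≠ 0 := by simpa using hp0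
  rw [eLpNorm_one_eq_lintegral_enorm, eLpNorm_eq_lintegral_rpow_enorm_toReal hp'
    ENNReal.ofReal_ne_top, eLpNorm_eq_lintegral_rpow_enorm_toReal hp' ENNReal.ofReal_ne_top,
    ENNReal.toReal_ofReal hp0.le, one_div, ENNReal.rpow_inv_le_iff hp0,
    ENNReal.mul_rpow_of_nonneg _ _ hp0.le, ← ENNReal.rpow_mul _ p⁻¹, inv_mul_cancel₀ hp0.ne',
    ENNReal.rpow_one]
  exact (lintegral_mono fun x => ENNReal.rpow_le_rpow (enorm_convolution_le a b x) hp0.le).trans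
    (lintegral_lintegral_mul_sub_rpow_le ha.1.enorm ha.2.ne hb.enorm hp)

theorem memLp_convolution {a b : Space d → 𝕜} (ha : Integrable a) {p : ℝ} (hp : 1 ≤ p)
    (hb : MemLp b (ENNReal.ofReal p) volume) :
    MemLp (convolution a b (ContinuousLinearMap.mul ℝ 𝕜) volume) (ENNReal.ofReal p) volume :=
  ⟨aestronglyMeasurable_convolution ha.1 hb.1, (eLpNorm_convolution_le ha hb.1 hp).trans_lt
    (ENNReal.mul_lt_top (memLp_one_iff_integrable.2 ha).2 hb.2)⟩

theorem convolution_mul_comm (a b : Space d → 𝕜) :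
    convolution a b (ContinuousLinearMap.mul ℝ 𝕜) volume
      = convolution b a (ContinuousLinearMap.mul ℝ 𝕜) volume := by
  rw [← convolution_flip]
  congr 1
  ext
  simp

theorem MemLp.of_bound_of_le {b : Space d → 𝕜} {p q : ℝ≥0∞} (hp : p ≠ 0) (hp' : p ≠ ⊤) (hpq : p ≤ q)
    (hb : MemLp b p volume) {M : ℝ} (hM : ∀ x, ‖b x‖ ≤ M) : MemLp b q volume := by
  rcases eq_or_ne q ⊤ with rfl | hq
  · exact memLp_top_of_bound hb.1 M (.of_forall hM)
  have hp0 : 0 < p.toReal := ENNReal.toReal_pos hp hp'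
  have hpq' : p.toReal ≤ q.toReal := ENNReal.toReal_mono hq hpq
  have hq0 : q ≠ 0 := (hp.bot_lt.trans_le hpq).ne'
  refine ⟨hb.1, ?_⟩
  rw [eLpNorm_lt_top_iff_lintegral_rpow_enorm_lt_top hq0 hq]
  have hb' := (eLpNorm_lt_top_iff_lintegral_rpow_enorm_lt_top hp hp').1 hb.2
  calc ∫⁻ x, ‖b x‖ₑ ^ q.toReal
      ≤ ∫⁻ x, ENNReal.ofReal M ^ (q.toReal - p.toReal) * ‖b x‖ₑ ^ p.toReal := by
        refine lintegral_mono fun x => ?_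
        have h : ‖b x‖ₑ ≤ ENNReal.ofReal M := by
          rw [← ofReal_norm]; exact ENNReal.ofReal_le_ofReal (hM x)
        calc ‖b x‖ₑ ^ q.toReal = ‖b x‖ₑ ^ (q.toReal - p.toReal) * ‖b x‖ₑ ^ p.toReal := by
              rw [← ENNReal.rpow_add_of_nonneg _ _ (by linarith) hp0.le, sub_add_cancel]
          _ ≤ _ := mul_le_mul_left (ENNReal.rpow_le_rpow h (by linarith)) _
    _ = ENNReal.ofReal M ^ (q.toReal - p.toReal) * ∫⁻ x, ‖b x‖ₑ ^ p.toReal :=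
        lintegral_const_mul' _ _
          (ENNReal.rpow_ne_top_of_nonneg (by linarith) ENNReal.ofReal_ne_top)
    _ < ⊤ := ENNReal.mul_lt_top
        (ENNReal.rpow_ne_top_of_nonneg (by linarith) ENNReal.ofReal_ne_top).lt_top hb'

/-- For p ≤ 2 the conjugate exponent is at least p, so a bounded function in L^p also lies in the
dual space and Hölder applies at every point. -/
theorem convolutionExists_of_memLp_of_bound {a b : Space d → 𝕜} {p : ℝ} (hp : 1 ≤ p) (hp2 : p ≤ 2)
    (ha : MemLp a (ENNReal.ofReal p) volume) {M : ℝ} (hM : ∀ x, ‖a x‖ ≤ M)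
    (hb : MemLp b (ENNReal.ofReal p) volume) :
    ConvolutionExists a b (ContinuousLinearMap.mul ℝ 𝕜) volume := by
  have hp1 : 1 ≤ ENNReal.ofReal p := by
    rw [← ENNReal.ofReal_one]; exact ENNReal.ofReal_le_ofReal hp
  have hconj := ENNReal.HolderConjugate.conjExponent hp1
  have hle : ENNReal.ofReal p ≤ ENNReal.conjExponent (ENNReal.ofReal p) := by
    rw [ENNReal.conjExponent]
    have e : ENNReal.ofReal p - 1 ≤ 1 := by
      rw [← ENNReal.ofReal_one, ← ENNReal.ofReal_sub _ zero_le_one]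
      exact ENNReal.ofReal_le_ofReal (by linarith)
    calc ENNReal.ofReal p ≤ ENNReal.ofReal 2 := ENNReal.ofReal_le_ofReal hp2
      _ = 1 + 1 := by norm_num
      _ ≤ _ := add_le_add_right (ENNReal.one_le_inv.2 e) 1
  have ha' := MemLp.of_bound_of_le (by positivity) ENNReal.ofReal_ne_top hle ha hM
  intro x
  have hb' : MemLp (fun t => b (x - t)) (ENNReal.ofReal p) volume :=
    hb.comp_measurePreserving (Measure.measurePreserving_sub_left volume x)
  exact hb'.integrable_mul ha' |>.congr (.of_forall fun t => mul_comm _ _)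

end Young

/-! ### Polar coordinates -/

section Polar

variable {d : ℕ}

theorem measurePreserving_polar (hd : 1 ≤ d) :
    MeasurePreserving (fun q : Metric.sphere (0 : Space d) 1 × Ioi (0 : ℝ) =>
        (q.2 : ℝ) • (q.1 : Space d))
      ((volume : Measure (Space d)).toSphere.prod (Measure.volumeIoiPow (d - 1))) volume := by
  have : Nonempty (Fin d) := ⟨⟨0, hd⟩⟩
  have h := (volume : Measure (Space d)).measurePreserving_homeomorphUnitSphereProd
  rw [finrank_euclideanSpace_fin] at h
  have h1 : MeasurePreserving (homeomorphUnitSphereProd (Space d)).symm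
      ((volume : Measure (Space d)).toSphere.prod (Measure.volumeIoiPow (d - 1)))
      (volume.comap (Subtype.val : ({0}ᶜ : Set (Space d)) → Space d)) :=
    MeasurePreserving.symm (homeomorphUnitSphereProd (Space d)).toMeasurableEquiv h
  have h2 : MeasurePreserving (Subtype.val : ({0}ᶜ : Set (Space d)) → Space d)
      (volume.comap (Subtype.val : ({0}ᶜ : Set (Space d)) → Space d)) volume := by
    refine ⟨measurable_subtype_coe, ?_⟩
    rw [(MeasurableEmbedding.subtype_coe (measurableSet_singleton _).compl).map_comap,
      Subtype.range_coe, restrict_compl_singleton]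
  exact h2.comp h1

theorem measurableEmbedding_polar : MeasurableEmbedding
    (fun q : Metric.sphere (0 : Space d) 1 × Ioi (0 : ℝ) => (q.2 : ℝ) • (q.1 : Space d)) :=
  (MeasurableEmbedding.subtype_coe (measurableSet_singleton (0 : Space d)).compl).comp
    (homeomorphUnitSphereProd (Space d)).symm.measurableEmbedding

theorem integral_polar (hd : 1 ≤ d) {F : Space d → ℂ} (hF : Integrable F) :
    ∫ x, F x = ∫ r in Ioi (0 : ℝ), r ^ (d - 1) •
      ∫ θ, F (r • (θ : Space d)) ∂(volume : Measure (Space d)).toSphere := by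
  have hmp := measurePreserving_polar hd
  have hi : Integrable (fun q : Metric.sphere (0 : Space d) 1 × Ioi (0 : ℝ) =>
      F ((q.2 : ℝ) • (q.1 : Space d)))
      ((volume : Measure (Space d)).toSphere.prod (Measure.volumeIoiPow (d - 1))) :=
    (hmp.integrable_comp_emb measurableEmbedding_polar).2 hF
  rw [← hmp.integral_comp measurableEmbedding_polar, integral_prod_symm _ hi,
    Measure.volumeIoiPow, ← integral_subtype_comap measurableSet_Ioi
      fun r : ℝ => r ^ (d - 1) • ∫ θ, F (r • (θ : Space d)) ∂(volume : Measure (Space d)).toSphere]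
  simp only [ENNReal.ofReal]
  rw [integral_withDensity_eq_integral_smul (by fun_prop)]
  refine integral_congr_ae (.of_forall fun r => ?_)
  simp only
  rw [NNReal.smul_def, Real.coe_toNNReal _ (pow_nonneg (mem_Ioi.1 r.2).le _)]

theorem lintegral_norm_polar (hd : 1 ≤ d) {u : ℝ → ℝ≥0∞} (hu : Measurable u) :
    ∫⁻ x : Space d, u ‖x‖ = (volume : Measure (Space d)).toSphere univ *
      ∫⁻ r in Ioi (0 : ℝ), u r * ENNReal.ofReal (r ^ (d - 1)) := by
  rw [← (measurePreserving_polar hd).lintegral_comp_emb measurableEmbedding_polar]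
  have e : ∀ q : Metric.sphere (0 : Space d) 1 × Ioi (0 : ℝ),
      u ‖(q.2 : ℝ) • (q.1 : Space d)‖ = 1 * u q.2 := fun q => by
    rw [norm_smul, norm_eq_of_mem_sphere, mul_one, Real.norm_of_nonneg (mem_Ioi.1 q.2.2).le,
      one_mul]
  simp_rw [e]
  rw [lintegral_prod_mul (f := fun _ => 1) (g := fun r : Ioi (0 : ℝ) => u r) aemeasurable_const
    (hu.comp measurable_subtype_coe).aemeasurable, lintegral_one, Measure.volumeIoiPow,
    lintegral_withDensity_eq_lintegral_mul (g := fun r : Ioi (0 : ℝ) => u r) _ (by fun_prop)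
      (hu.comp measurable_subtype_coe), ← lintegral_subtype_comap measurableSet_Ioi
      fun r => u r * ENNReal.ofReal (r ^ (d - 1))]
  congr 2 with r
  exact mul_comm _ _

end Polar

/-! ### Convolution and inverse Fourier transforms -/

section FourierConvolution

variable {d : ℕ}

theorem norm_fourierInv_le (m : Space d → ℂ) (x : Space d) : ‖𝓕⁻ m x‖ ≤ ∫ ξ, ‖m ξ‖ := by
  rw [Real.fourierInv_eq_fourier_neg]
  exact VectorFourier.norm_fourierIntegral_le_integral_norm _ _ _ _ _

theorem continuous_fourierInv {m : Space d → ℂ} (hm : Integrable m) : Continuous (𝓕⁻ m) := by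
  have h : 𝓕⁻ m = fun x => 𝓕 m (-x) := funext fun x => Real.fourierInv_eq_fourier_neg m x
  rw [h]
  exact (continuous_fourier hm).comp continuous_neg

/-- Convolution with `h` multiplies the Fourier transform by that of `h`. -/
theorem conv_fourierInv {m h : Space d → ℂ} (hm : Integrable m) (hh : Integrable h) :
    conv (𝓕⁻ m) h = 𝓕⁻ fun ξ => m ξ * 𝓕 h ξ := by
  ext x
  rw [conv, convolution_eq_swap]
  simp only [ContinuousLinearMap.mul_apply']
  have e1 : ∀ t, 𝓕⁻ m (x - t) * h t = ∫ ξ, Real.fourierChar (inner ℝ ξ x) •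
      (m ξ * ((Real.fourierChar (-inner ℝ t ξ) : ℂ) * h t)) := by
    intro t
    rw [Real.fourierInv_eq, ← integral_mul_const]
    refine integral_congr_ae (.of_forall fun ξ => ?_)
    simp only [Circle.smul_def, smul_eq_mul]
    rw [inner_sub_right, sub_eq_add_neg, AddChar.map_add_eq_mul, Circle.coe_mul,
      real_inner_comm t ξ]
    ring
  simp_rw [e1]
  rw [integral_integral_swap]
  · rw [Real.fourierInv_eq]
    refine integral_congr_ae (.of_forall fun ξ => ?_)
    simp only [Circle.smul_def, smul_eq_mul]
    rw [integral_const_mul, integral_const_mul, Real.fourier_eq]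
    rfl
  · have hc : Continuous fun z : Space d × Space d => (Real.fourierChar (inner ℝ z.2 x) : ℂ) :=
      continuous_fourierChar_coe.comp (by fun_prop)
    have hc' : Continuous fun z : Space d × Space d =>
        (Real.fourierChar (-inner ℝ z.1 z.2) : ℂ) :=
      continuous_fourierChar_coe.comp (by fun_prop)
    refine (hh.mul_prod hm).mono ?_ (.of_forall fun z => ?_)
    · exact hc.aestronglyMeasurable.mul (hm.1.comp_snd.mul
        (hc'.aestronglyMeasurable.mul hh.1.comp_fst))
    · simp only [Function.uncurry, Circle.smul_def, smul_eq_mul, norm_mul, Circle.norm_coe, one_mul]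
      exact (mul_comm _ _).le

end FourierConvolution

/-! ### A reproducing formula on the annulus -/

section Reproducing

variable {d : ℕ}

/-- A smooth radial function that is `1` on `1/2 ≤ |ξ| ≤ 2` and vanishes unless
`1/4 < |ξ| < 9/4`. -/
noncomputable def annularCutoff (ξ : Space d) : ℝ :=
  Real.smoothTransition (16 / 3 * ‖ξ‖ ^ 2 - 1 / 3) *
    Real.smoothTransition (81 / 17 - 16 / 17 * ‖ξ‖ ^ 2)

theorem contDiff_annularCutoff : ContDiff ℝ (⊤ : ℕ∞) (annularCutoff (d := d)) :=
  (Real.smoothTransition.contDiff.comp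
      ((contDiff_const.mul (contDiff_norm_sq ℝ)).sub contDiff_const)).mul
    (Real.smoothTransition.contDiff.comp
      (contDiff_const.sub (contDiff_const.mul (contDiff_norm_sq ℝ))))

theorem annularCutoff_eq_one {ξ : Space d} (h : 1 / 2 ≤ ‖ξ‖) (h' : ‖ξ‖ ≤ 2) :
    annularCutoff ξ = 1 := by
  rw [annularCutoff, Real.smoothTransition.one_of_one_le (by nlinarith),
    Real.smoothTransition.one_of_one_le (by nlinarith), one_mul]

theorem tsupport_annularCutoff_subset :
    tsupport (annularCutoff (d := d)) ⊆ {ξ | 1 / 4 ≤ ‖ξ‖ ∧ ‖ξ‖ ≤ 9 / 4} := by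
  refine closure_minimal (fun ξ hξ => ?_) ?_
  · have h1 := left_ne_zero_of_mul hξ
    have h2 := right_ne_zero_of_mul hξ
    rw [ne_eq, Real.smoothTransition.zero_iff_nonpos, not_le] at h1 h2
    have := norm_nonneg ξ
    exact ⟨by nlinarith, by nlinarith⟩
  · exact (isClosed_le continuous_const continuous_norm).inter
      (isClosed_le continuous_norm continuous_const)

/-- The transform of ψ₀ has no zeros on the support of the cutoff, so the cutoff divided by its
square is smooth with compact support; φ is the inverse transform of this quotient. -/
theorem exists_isOscillatingBump_reproducing (d : ℕ) :
    ∃ ψ₀ φ : SchwartzMap (Space d) ℂ, IsOscillatingBump (ψ₀ : Space d → ℂ) ∧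
      ∀ ξ, 1 / 2 < ‖ξ‖ → ‖ξ‖ < 2 →
        𝓕 (ψ₀ : Space d → ℂ) ξ ^ 2 * 𝓕 (φ : Space d → ℂ) ξ = 1 := by
  obtain ⟨ψ₀, hψ, hne⟩ := exists_isOscillatingBump d
  set G : Space d → ℂ := fun ξ => annularCutoff ξ * (𝓕 (ψ₀ : Space d → ℂ) ξ ^ 2)⁻¹ with hG
  have hsub : tsupport G ⊆ tsupport (annularCutoff (d := d)) := by
    refine closure_mono fun ξ hξ h => hξ ?_
    simp [hG, h]
  have hcomp : HasCompactSupport G := by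
    refine (isCompact_closedBall (0 : Space d) (9 / 4)).of_isClosed_subset (isClosed_tsupport _) ?_
    intro ξ hξ
    rw [mem_closedBall_zero_iff]
    exact (tsupport_annularCutoff_subset (hsub hξ)).2
  have hψs : ContDiff ℝ (⊤ : ℕ∞) (𝓕 (ψ₀ : Space d → ℂ)) := by
    rw [← SchwartzMap.fourier_coe]; exact SchwartzMap.smooth _ _
  have hsmooth : ContDiff ℝ (⊤ : ℕ∞) G := by
    refine contDiff_iff_contDiffAt.2 fun ξ => ?_
    by_cases hξ : ξ ∈ tsupport G
    swap
    · exact contDiffAt_const.congr_of_eventuallyEq (notMem_tsupport_iff_eventuallyEq.1 hξ)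
    have h := tsupport_annularCutoff_subset (hsub hξ)
    refine ContDiffAt.mul ?_ (((hψs.contDiffAt).pow 2).inv (pow_ne_zero 2 (hne ξ h.1 h.2)))
    exact (Complex.ofRealCLM.contDiff.comp contDiff_annularCutoff).contDiffAt
  refine ⟨ψ₀, 𝓕⁻ (hcomp.toSchwartzMap hsmooth), hψ, fun ξ h1 h2 => ?_⟩
  have h3 := hne ξ (by linarith) (by linarith)
  rw [← SchwartzMap.fourier_coe (𝓕⁻ _), FourierTransform.fourier_fourierInv_eq]
  change _ * G ξ = 1
  rw [hG]
  simp only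
  rw [annularCutoff_eq_one h1.le h2.le, Complex.ofReal_one, one_mul, mul_inv_cancel₀]
  exact pow_ne_zero 2 h3

end Reproducing

/-! ### The kernel inside and outside the unit ball -/

section KernelParts

variable {d : ℕ} {ψ₀ : Space d → ℂ}

theorem convolutionExists_of_bound {a b : Space d → ℂ} (ha : AEStronglyMeasurable a volume) {M : ℝ}
    (hM : ∀ x, ‖a x‖ ≤ M) (hb : Integrable b) :
    ConvolutionExists a b (ContinuousLinearMap.mul ℝ ℂ) volume := fun x =>
  (hb.comp_sub_left x).bdd_mul ha (.of_forall hM)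

theorem norm_conv_le_of_bound {a b : Space d → ℂ} {M : ℝ} (hM : ∀ x, ‖a x‖ ≤ M)
    (hb : Integrable b) (x : Space d) : ‖conv a b x‖ ≤ M * ∫ t, ‖b t‖ := by
  rw [conv, convolution_def, ← integral_sub_left_eq_self (fun t => ‖b t‖) volume x,
    ← integral_const_mul]
  refine norm_integral_le_of_norm_le ((hb.comp_sub_left x).norm.const_mul M)
    (.of_forall fun t => ?_)
  rw [ContinuousLinearMap.mul_apply', norm_mul]
  exact mul_le_mul_of_nonneg_right (hM t) (norm_nonneg _)

/-- The restriction of a function to the complement of the unit ball. -/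
noncomputable def farPart (K : Space d → ℂ) : Space d → ℂ :=
  Set.indicator {x | 1 < ‖x‖} K

/-- The restriction of a function to the unit ball. -/
noncomputable def nearPart (K : Space d → ℂ) : Space d → ℂ :=
  Set.indicator {x | 1 < ‖x‖}ᶜ K

theorem measurableSet_one_lt_norm : MeasurableSet {x : Space d | 1 < ‖x‖} :=
  measurableSet_lt measurable_const measurable_norm

theorem exists_eLpNorm_nearPart_le (d : ℕ) {p : ℝ} (hp : 1 ≤ p) : ∃ C : ℝ≥0, ∀ K : Space d → ℂ,
    AEStronglyMeasurable K volume →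
      eLpNorm (nearPart K) 1 volume ≤ C * eLpNorm K (ENNReal.ofReal p) volume := by
  set B : Set (Space d) := {x | 1 < ‖x‖}ᶜ with hB
  have hfin : volume B < ⊤ := by
    refine (measure_mono fun x hx => ?_).trans_lt
      (measure_closedBall_lt_top (x := (0 : Space d)) (r := 1))
    rw [mem_closedBall_zero_iff]
    exact not_lt.1 hx
  refine ⟨(volume B ^ (1 - 1 / p)).toNNReal, fun K hK => ?_⟩
  have hp' : 0 ≤ 1 - 1 / p := by
    rw [sub_nonneg, div_le_one (by linarith)]; exact hp
  rw [ENNReal.coe_toNNReal (ENNReal.rpow_ne_top_of_nonneg hp' hfin.ne), nearPart,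
    eLpNorm_indicator_eq_eLpNorm_restrict measurableSet_one_lt_norm.compl]
  have h := eLpNorm_le_eLpNorm_mul_rpow_measure_univ (p := 1) (q := ENNReal.ofReal p)
    (μ := volume.restrict B)
    (by rw [← ENNReal.ofReal_one]; exact ENNReal.ofReal_le_ofReal hp) hK.restrict
  rw [Measure.restrict_apply_univ, ENNReal.toReal_ofReal (by linarith), ENNReal.toReal_one,
    div_one] at h
  refine h.trans ?_
  rw [mul_comm]
  exact mul_le_mul_right (eLpNorm_mono_measure _ Measure.restrict_le_self) _

namespace IsOscillatingBump

variable (hψ : IsOscillatingBump ψ₀)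
include hψ

omit hψ in
theorem sphereBump_eq_sub (y : Space d) (r : ℝ) (x : Space d) :
    sphereBump ψ₀ y r x = sphereBump ψ₀ 0 r (x - y) := by
  simp only [sphereBump, sub_zero]
  congr 1 with z
  rw [sub_right_comm]

/-- In polar coordinates K is constant on each sphere, so integrating ψ over the sphere of radius r
produces F_{0,r} with coefficient K(re). Removing the unit ball leaves exactly the radii r > 1 of
the continuous inequality. -/
theorem conv_farPart_eq (hd : 1 ≤ d) {K : Space d → ℂ} (hK : AEStronglyMeasurable K volume)
    (hKr : IsRadial K) {M : ℝ} (hM : ∀ x, ‖K x‖ ≤ M) {e : Space d} (he : ‖e‖ = 1) (z : Space d) :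
    conv (farPart K) (conv ψ₀ ψ₀) z
      = ∫ r in Ioi (1 : ℝ), K (r • e) * sphereBump ψ₀ 0 r z := by
  have hM0 : 0 ≤ M := (norm_nonneg _).trans (hM 0)
  have hex := convolutionExists_of_bound (hK.indicator measurableSet_one_lt_norm)
    (M := M) (fun x => (norm_indicator_le_norm_self _ _).trans (hM x)) hψ.conv_integrable z
  rw [conv, convolution_def, farPart, integral_polar hd hex,
    ← integral_indicator measurableSet_Ioi, ← integral_indicator measurableSet_Ioi]
  congr 1 with r
  rcases le_or_gt r 1 with hr | hr
  · rw [indicator_of_notMem (s := Ioi 1) (by simpa using hr)]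
    rcases le_or_gt r 0 with hr0 | hr0
    · rw [indicator_of_notMem (by simpa using hr0)]
    · rw [indicator_of_mem (by simpa using hr0)]
      refine smul_eq_zero_of_right _ (integral_eq_zero_of_ae (.of_forall fun θ => ?_))
      have : r • (θ : Space d) ∉ {x : Space d | 1 < ‖x‖} := by
        rw [mem_ofPred_eq, norm_smul, norm_eq_of_mem_sphere, mul_one, Real.norm_of_nonneg hr0.le]
        exact not_lt.2 hr
      simp [indicator_of_notMem this]
  · have hr0 : 0 < r := by linarith
    rw [indicator_of_mem (by simpa using hr0), indicator_of_mem (by simpa using hr),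
      hψ.sphereBump_eq, max_eq_left (by positivity), mul_smul_comm, ← integral_const_mul]
    congr 2 with θ
    have hn : ‖r • (θ : Space d)‖ = r := by
      rw [norm_smul, norm_eq_of_mem_sphere, mul_one, Real.norm_of_nonneg hr0.le]
    have : r • (θ : Space d) ∈ {x : Space d | 1 < ‖x‖} := by
      rw [mem_ofPred_eq, hn]; exact hr
    rw [ContinuousLinearMap.mul_apply', indicator_of_mem this,
      hKr (r • (θ : Space d)) (r • e) (by rw [hn, norm_smul, he, mul_one,
        Real.norm_of_nonneg hr0.le]), sub_zero]

end IsOscillatingBump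

end KernelParts

/-! ### Radial multipliers -/

section Multiplier

variable {d : ℕ} {ψ₀ : Space d → ℂ}

theorem farPart_add_nearPart (K : Space d → ℂ) : farPart K + nearPart K = K :=
  Set.indicator_self_add_compl _ _

theorem lintegral_far_le (hd : 1 ≤ d) {p : ℝ} {K : Space d → ℂ} (hK : Continuous K)
    (hKr : IsRadial K) {e : Space d} (he : ‖e‖ = 1) :
    (volume : Measure (Space d)).toSphere univ *
      ∫⁻ r in Ioi (1 : ℝ), ‖K (r • e)‖ₑ ^ p * ENNReal.ofReal (r ^ (d - 1))
        ≤ ∫⁻ x, ‖K x‖ₑ ^ p := by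
  have hKe : Continuous fun r : ℝ => K (r • e) := hK.comp (by fun_prop)
  have hu : Measurable ((Ioi (1 : ℝ)).indicator fun r => ‖K (r • e)‖ₑ ^ p) :=
    ((hKe.measurable.enorm).pow_const p).indicator measurableSet_Ioi
  calc _ = ∫⁻ x : Space d, (Ioi (1 : ℝ)).indicator (fun r => ‖K (r • e)‖ₑ ^ p) ‖x‖ := by
        rw [lintegral_norm_polar hd hu, ← lintegral_indicator measurableSet_Ioi,
          ← lintegral_indicator measurableSet_Ioi]
        congr 2 with r
        rcases le_or_gt r 1 with hr | hr
        · have : r ∉ Ioi (1 : ℝ) := by simpa using hr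
          rw [indicator_of_notMem this]
          rcases le_or_gt r 0 with hr0 | hr0
          · rw [indicator_of_notMem (by simpa using hr0)]
          · rw [indicator_of_mem (by simpa using hr0), indicator_of_notMem this, zero_mul]
        · have : r ∈ Ioi (1 : ℝ) := hr
          rw [indicator_of_mem this, indicator_of_mem (mem_Ioi.2 (by linarith)),
            indicator_of_mem this]
    _ ≤ _ := by
        refine lintegral_mono fun x => ?_
        by_cases hx : ‖x‖ ∈ Ioi (1 : ℝ)
        · rw [indicator_of_mem hx, hKr (‖x‖ • e) x (by simp [norm_smul, he])]
        · rw [indicator_of_notMem hx]; exact zero_le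

namespace IsOscillatingBump

variable (hψ : IsOscillatingBump ψ₀)
include hψ

/-- The continuous inequality with h(y, r) = g(y) K(re). Its right-hand side factorises into the
norm of g and a radial integral of K, which polar coordinates compare with the norm of K. -/
theorem exists_eLpNorm_farPart_le (hd : 1 ≤ d) {p : ℝ} (hp : 1 ≤ p) (hpd : p < critExp d) :
    ∃ C : ℝ≥0, ∀ K g : Space d → ℂ, Continuous K → IsRadial K → (∃ M, ∀ x, ‖K x‖ ≤ M) →
      MemLp K (ENNReal.ofReal p) volume → MemLp g (ENNReal.ofReal p) volume →
      eLpNorm (conv (conv (farPart K) (conv ψ₀ ψ₀)) g) (ENNReal.ofReal p) volume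
        ≤ C * eLpNorm K (ENNReal.ofReal p) volume * eLpNorm g (ENNReal.ofReal p) volume := by
  have hp0 : 0 < p := by linarith
  have hpn : ENNReal.ofReal p ≠ 0 := by simpa using hp0
  have : Nonempty (Fin d) := ⟨⟨0, hd⟩⟩
  obtain ⟨e, he⟩ : ∃ e : Space d, ‖e‖ = 1 := exists_norm_eq _ zero_le_one
  obtain ⟨C, hC⟩ := hψ.exists_lintegral_integral_rpow_le hd hp hpd
  set S := (volume : Measure (Space d)).toSphere univ with hS
  have hS0 : S ≠ 0 := by
    have : d ≠ 0 := by omega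
    simpa [hS, this] using (Metric.measure_ball_pos _ (0 : Space d) one_pos).ne'
  have hSt : S ≠ ⊤ := measure_ne_top _ _
  refine ⟨C ^ (1 / p) * (S⁻¹ ^ (1 / p)).toNNReal, fun K g hK hKr ⟨M, hM⟩ hKp hgp => ?_⟩
  have hKe : Continuous fun r : ℝ => K (r • e) := hK.comp (by fun_prop)
  set h : Space d × ℝ → ℂ := fun q => g q.1 * K (q.2 • e) with hh
  have hhm : AEStronglyMeasurable h (prodMeasure d) :=
    hgp.1.comp_fst.mul (hKe.comp continuous_snd).aestronglyMeasurable
  set J := ∫⁻ r in Ioi (1 : ℝ), ‖K (r • e)‖ₑ ^ p * ENNReal.ofReal (r ^ (d - 1)) with hJ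
  have hW : ∫⁻ q, ‖h q‖ₑ ^ p * ENNReal.ofReal (q.2 ^ (d - 1)) ∂(prodMeasure d)
      = (∫⁻ y, ‖g y‖ₑ ^ p) * J := by
    rw [← lintegral_prod_mul (hgp.1.enorm.pow_const p) (by fun_prop)]
    refine lintegral_congr fun q => ?_
    rw [hh, enorm_mul, ENNReal.mul_rpow_of_nonneg _ _ hp0.le, mul_assoc]
  have hJle : J ≤ S⁻¹ * ∫⁻ x, ‖K x‖ₑ ^ p := by
    rw [← ENNReal.mul_le_iff_le_inv hS0 hSt]
    exact lintegral_far_le hd hK hKr he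
  have hn : ∀ u : Space d → ℂ, eLpNorm u (ENNReal.ofReal p) volume
      = (∫⁻ x, ‖u x‖ₑ ^ p) ^ (1 / p) := fun u => by
    rw [eLpNorm_eq_lintegral_rpow_enorm_toReal hpn ENNReal.ofReal_ne_top,
      ENNReal.toReal_ofReal hp0.le]
  have hfin : ∀ u : Space d → ℂ, MemLp u (ENNReal.ofReal p) volume →
      ∫⁻ x, ‖u x‖ₑ ^ p ≠ ⊤ := fun u hu => by
    have := (eLpNorm_lt_top_iff_lintegral_rpow_enorm_lt_top hpn ENNReal.ofReal_ne_top).1 hu.2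
    rw [ENNReal.toReal_ofReal hp0.le] at this
    exact this.ne
  have hWt : (∫⁻ y, ‖g y‖ₑ ^ p) * J ≠ ⊤ := ENNReal.mul_ne_top (hfin g hgp)
    (ne_top_of_le_ne_top (ENNReal.mul_ne_top (ENNReal.inv_ne_top.2 hS0) (hfin K hKp)) hJle)
  obtain ⟨h1, h2, h3⟩ := hC h hhm (hW ▸ hWt)
  have hrep : ∀ x, conv (conv (farPart K) (conv ψ₀ ψ₀)) g x
      = ∫ q, h q * sphereBump ψ₀ q.1 q.2 x ∂(prodMeasure d) := by
    intro x
    rw [integral_prod _ (h1 x), conv, convolution_eq_swap]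
    refine integral_congr_ae (.of_forall fun y => ?_)
    simp only [ContinuousLinearMap.mul_apply']
    rw [hψ.conv_farPart_eq hd hK.aestronglyMeasurable hKr hM he, mul_comm, ← integral_const_mul]
    refine integral_congr_ae (.of_forall fun r => ?_)
    simp only [hh]
    rw [sphereBump_eq_sub y r x, mul_assoc]
  rw [funext hrep]
  refine (memLp_and_eLpNorm_le_of_lintegral_le hp0 h2 (hW ▸ hWt) h3).2.trans ?_
  rw [hW, hn, hn, ENNReal.coe_mul, ENNReal.coe_toNNReal
    (ENNReal.rpow_ne_top_of_nonneg (by positivity) (ENNReal.inv_ne_top.2 hS0)), mul_assoc,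
    mul_assoc]
  refine mul_le_mul_right ?_ _
  rw [← ENNReal.mul_rpow_of_nonneg _ _ (by positivity : 0 ≤ 1 / p),
    ← ENNReal.mul_rpow_of_nonneg _ _ (by positivity : 0 ≤ 1 / p)]
  refine ENNReal.rpow_le_rpow ?_ (by positivity)
  calc _ ≤ (∫⁻ y, ‖g y‖ₑ ^ p) * (S⁻¹ * ∫⁻ x, ‖K x‖ₑ ^ p) := mul_le_mul_right hJle _
    _ = _ := by ring

/-- On the unit ball the L^1 norm of K is controlled by its L^p norm, so Young's inequality, used
twice, is enough. -/
theorem exists_eLpNorm_nearPart_conv_le {p : ℝ} (hp : 1 ≤ p) : ∃ C : ℝ≥0, ∀ K g : Space d → ℂ,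
      MemLp K (ENNReal.ofReal p) volume → MemLp g (ENNReal.ofReal p) volume →
      eLpNorm (conv (conv (nearPart K) (conv ψ₀ ψ₀)) g) (ENNReal.ofReal p) volume
        ≤ C * eLpNorm K (ENNReal.ofReal p) volume * eLpNorm g (ENNReal.ofReal p) volume := by
  obtain ⟨C, hC⟩ := exists_eLpNorm_nearPart_le d hp
  have hψi := hψ.conv_integrable
  have hψt : eLpNorm (conv ψ₀ ψ₀) 1 volume ≠ ⊤ := (memLp_one_iff_integrable.2 hψi).2.ne
  refine ⟨(eLpNorm (conv ψ₀ ψ₀) 1 volume).toNNReal * C, fun K g hK hg => ?_⟩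
  have h1 := hC K hK.1
  have hi : Integrable (nearPart K) := memLp_one_iff_integrable.1
    ⟨hK.1.indicator measurableSet_one_lt_norm.compl,
      h1.trans_lt (ENNReal.mul_lt_top ENNReal.coe_lt_top hK.2)⟩
  have h2 : eLpNorm (conv (nearPart K) (conv ψ₀ ψ₀)) 1 volume
      ≤ eLpNorm (conv ψ₀ ψ₀) 1 volume * eLpNorm (nearPart K) 1 volume := by
    have := eLpNorm_convolution_le hψi hi.1 le_rfl
    rwa [ENNReal.ofReal_one, convolution_mul_comm] at this
  have hi2 : Integrable (conv (nearPart K) (conv ψ₀ ψ₀)) :=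
    hi.integrable_convolution _ hψi
  refine (eLpNorm_convolution_le hi2 hg.1 hp).trans (mul_le_mul_left ?_ _)
  rw [ENNReal.coe_mul, ENNReal.coe_toNNReal hψt, mul_assoc]
  exact h2.trans (mul_le_mul_right h1 _)

end IsOscillatingBump

theorem critExp_lt_two (d : ℕ) : critExp d < 2 := by
  rw [critExp, div_lt_iff₀ (by positivity)]
  linarith

/-- The estimate for radial Fourier multipliers supported in an annulus. -/
theorem exists_eLpNorm_conv_fourierInv_le (hd : 1 ≤ d) {p : ℝ} (hp : 1 ≤ p)
    (hpd : p < critExp d) : ∃ C : ℝ≥0, ∀ m : Space d → ℂ,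
      Integrable m volume → IsRadial m →
      Function.support m ⊆ {ξ | 1 / 2 < ‖ξ‖ ∧ ‖ξ‖ < 2} →
      MemLp (𝓕⁻ m) (ENNReal.ofReal p) volume →
      ∀ f : Space d → ℂ, MemLp f (ENNReal.ofReal p) volume →
        ConvolutionExists (𝓕⁻ m) f (ContinuousLinearMap.mul ℝ ℂ) volume ∧
        MemLp (conv (𝓕⁻ m) f) (ENNReal.ofReal p) volume ∧
        eLpNorm (conv (𝓕⁻ m) f) (ENNReal.ofReal p) volume ≤
          C * eLpNorm (𝓕⁻ m) (ENNReal.ofReal p) volume * eLpNorm f (ENNReal.ofReal p) volume := by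
  have hp2 : p ≤ 2 := (hpd.trans (critExp_lt_two d)).le
  have hp1 : 1 ≤ ENNReal.ofReal p := by
    rw [← ENNReal.ofReal_one]; exact ENNReal.ofReal_le_ofReal hp
  obtain ⟨ψ₀, φ, hψ, hφ⟩ := exists_isOscillatingBump_reproducing d
  obtain ⟨C₁, hC₁⟩ := hψ.exists_eLpNorm_farPart_le hd hp hpd
  obtain ⟨C₂, hC₂⟩ := hψ.exists_eLpNorm_nearPart_conv_le hp
  set ψ := conv (ψ₀ : Space d → ℂ) ψ₀ with hψdef
  have hψi : Integrable ψ := hψ.conv_integrable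
  have hφi : Integrable (φ : Space d → ℂ) := φ.integrable
  have hφt : eLpNorm φ 1 volume ≠ ⊤ := (memLp_one_iff_integrable.2 hφi).2.ne
  refine ⟨(C₁ + C₂) * (eLpNorm φ 1 volume).toNNReal, fun m hm hmr hms hK f hf => ?_⟩
  set K := 𝓕⁻ m with hKdef
  have hKc : Continuous K := continuous_fourierInv hm
  have hKr : IsRadial K := fourierInv_isRadial hmr
  have hKb : ∀ x, ‖K x‖ ≤ ∫ ξ, ‖m ξ‖ := norm_fourierInv_le m
  have hex := convolutionExists_of_memLp_of_bound hp hp2 hK hKb hf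
  set g := conv (φ : Space d → ℂ) f with hg
  have hgp : MemLp g (ENNReal.ofReal p) volume := memLp_convolution hφi hp hf
  have hgn : eLpNorm g (ENNReal.ofReal p) volume
      ≤ eLpNorm φ 1 volume * eLpNorm f (ENNReal.ofReal p) volume :=
    eLpNorm_convolution_le hφi hf.1 hp
  set A := conv K ψ with hA
  have hmψ : Integrable fun ξ => m ξ * 𝓕 ψ ξ := by
    refine hm.mul_bdd (c := ∫ x, ‖ψ x‖) (continuous_fourier hψi).aestronglyMeasurable
      (.of_forall fun ξ => ?_)
    exact VectorFourier.norm_fourierIntegral_le_integral_norm _ _ _ _ _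
  -- On the support of m the transforms of ψ and φ have product 1, so the two smoothings together
  -- change nothing.
  have hKA : K = conv A φ := by
    rw [hA, hKdef, conv_fourierInv hm hψi, conv_fourierInv hmψ hφi]
    congr 1 with ξ
    by_cases hξ : m ξ = 0
    · simp [hξ]
    · obtain ⟨h1, h2⟩ := hms hξ
      rw [hψ.fourier_conv, mul_assoc, hφ ξ h1 h2, mul_one]
  have hpart : ∀ B : Space d → ℂ, MemLp B (ENNReal.ofReal p) volume → (∀ x, ‖B x‖ ≤ ∫ ξ, ‖m ξ‖) →
      MemLp (conv B ψ) (ENNReal.ofReal p) volume ∧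
        ∀ x, ‖conv B ψ x‖ ≤ (∫ ξ, ‖m ξ‖) * ∫ t, ‖ψ t‖ := fun B hB hBb => by
    refine ⟨?_, fun x => norm_conv_le_of_bound hBb hψi x⟩
    rw [conv, convolution_mul_comm]
    exact memLp_convolution hψi hp hB
  obtain ⟨hAp, hAb⟩ := hpart K hK hKb
  -- Associativity requires absolute convergence of the iterated convolution. A is bounded and in
  -- L^p and φ is Schwartz, so everything reduces to L^p functions with p ≤ 2.
  have hassoc : conv K f = conv A g := by
    ext x
    conv_lhs => rw [hKA]
    have hfn : MemLp (fun x => ‖f x‖) (ENNReal.ofReal p) volume := hf.norm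
    have hφn : Integrable fun x => ‖φ x‖ := hφi.norm
    have hφp : MemLp (fun x => ‖φ x‖) (ENNReal.ofReal p) volume := (φ.memLp _ _).norm
    have hAn : MemLp (fun x => ‖A x‖) (ENNReal.ofReal p) volume := hAp.norm
    obtain ⟨B, hB⟩ : ∃ B, ∀ x, ‖φ x‖ ≤ B := by
      obtain ⟨B, -, hB⟩ := φ.decay 0 0
      exact ⟨B, fun x => by simpa using hB x⟩
    refine convolution_assoc _ _ _ _ (fun x y z => mul_assoc x y z) hAp.1 hφi.1 hf.1 ?_ ?_ ?_
    · exact .of_forall (convolutionExists_of_bound hAp.1 hAb hφi)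
    · exact .of_forall (convolutionExists_of_memLp_of_bound hp hp2 hφp
        (fun x => by simpa using hB x) hfn)
    · exact convolutionExists_of_memLp_of_bound hp hp2 hAn (fun x => by simpa using hAb x)
        (memLp_convolution hφn hp hfn) x
  have hfar : MemLp (farPart K) (ENNReal.ofReal p) volume := hK.indicator measurableSet_one_lt_norm
  have hnear : MemLp (nearPart K) (ENNReal.ofReal p) volume :=
    hK.indicator measurableSet_one_lt_norm.compl
  have hfarb : ∀ x, ‖farPart K x‖ ≤ ∫ ξ, ‖m ξ‖ := fun x =>
    (norm_indicator_le_norm_self _ _).trans (hKb x)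
  have hnearb : ∀ x, ‖nearPart K x‖ ≤ ∫ ξ, ‖m ξ‖ := fun x =>
    (norm_indicator_le_norm_self _ _).trans (hKb x)
  obtain ⟨h1p, h1b⟩ := hpart _ hfar hfarb
  obtain ⟨h2p, h2b⟩ := hpart _ hnear hnearb
  have hAsum : A = conv (farPart K) ψ + conv (nearPart K) ψ := by
    rw [hA, conv, conv, conv, ← (convolutionExists_of_bound hfar.1 hfarb hψi).add_distrib
      (convolutionExists_of_bound hnear.1 hnearb hψi), farPart_add_nearPart]
  have hsum : conv K f = conv (conv (farPart K) ψ) g + conv (conv (nearPart K) ψ) g := by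
    rw [hassoc, hAsum]
    exact (convolutionExists_of_memLp_of_bound hp hp2 h1p h1b hgp).add_distrib
      (convolutionExists_of_memLp_of_bound hp hp2 h2p h2b hgp)
  have hle : eLpNorm (conv K f) (ENNReal.ofReal p) volume
      ≤ ((C₁ + C₂) * (eLpNorm φ 1 volume).toNNReal : ℝ≥0) * eLpNorm K (ENNReal.ofReal p) volume
        * eLpNorm f (ENNReal.ofReal p) volume := by
    calc _ ≤ eLpNorm (conv (conv (farPart K) ψ) g) (ENNReal.ofReal p) volume
          + eLpNorm (conv (conv (nearPart K) ψ) g) (ENNReal.ofReal p) volume := by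
          rw [hsum]
          exact eLpNorm_add_le (aestronglyMeasurable_convolution h1p.1 hgp.1)
            (aestronglyMeasurable_convolution h2p.1 hgp.1) hp1
      _ ≤ C₁ * eLpNorm K (ENNReal.ofReal p) volume * eLpNorm g (ENNReal.ofReal p) volume
          + C₂ * eLpNorm K (ENNReal.ofReal p) volume * eLpNorm g (ENNReal.ofReal p) volume :=
          add_le_add (hC₁ K g hKc hKr ⟨_, hKb⟩ hK hgp) (hC₂ K g hK hgp)
      _ = (C₁ + C₂) * eLpNorm K (ENNReal.ofReal p) volume
          * eLpNorm g (ENNReal.ofReal p) volume := by ring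
      _ ≤ (C₁ + C₂) * eLpNorm K (ENNReal.ofReal p) volume
          * (eLpNorm φ 1 volume * eLpNorm f (ENNReal.ofReal p) volume) :=
          mul_le_mul_right hgn _
      _ = _ := by
          rw [ENNReal.coe_mul, ENNReal.coe_toNNReal hφt, ENNReal.coe_add]
          ring
  refine ⟨hex, ⟨aestronglyMeasurable_convolution hK.1 hf.1, hle.trans_lt ?_⟩, hle⟩
  exact ENNReal.mul_lt_top (ENNReal.mul_lt_top ENNReal.coe_lt_top hK.2) hf.2

end Multiplier

/-! ### The theorem -/

theorem corollary3p2 (d : ℕ) (hd : 2 ≤ d) (p : ℝ) (hp0 : 0 < p) (hp : p < critExp d) :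
    -- the discrete inequality
    (∀ ψ₀ : EuclideanSpace ℝ (Fin d) → ℂ, IsBump ψ₀ →
      ∃ C : ℝ≥0, ∀ (Y : Set (EuclideanSpace ℝ (Fin d))) (R : Set ℝ),
        OneSeparated Y → OneSeparated R → R ⊆ Set.Ici 1 →
        ∀ γ : EuclideanSpace ℝ (Fin d) × ℝ → ℂ,
          (∑' q : ↥(Y ×ˢ R), ‖γ q‖ₑ ^ p * ENNReal.ofReal (q.1.2 ^ (d - 1))) ≠ ⊤ →
          (∀ x, Summable fun q : ↥(Y ×ˢ R) => γ q * sphereBump ψ₀ q.1.1 q.1.2 x) ∧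
          MemLp (fun x => ∑' q : ↥(Y ×ˢ R), γ q * sphereBump ψ₀ q.1.1 q.1.2 x)
            (ENNReal.ofReal p) volume ∧
          eLpNorm (fun x => ∑' q : ↥(Y ×ˢ R), γ q * sphereBump ψ₀ q.1.1 q.1.2 x)
              (ENNReal.ofReal p) volume ≤
            C * (∑' q : ↥(Y ×ˢ R), ‖γ q‖ₑ ^ p * ENNReal.ofReal (q.1.2 ^ (d - 1))) ^ (1 / p)) ∧
    -- the continuous inequality
    (1 ≤ p → ∀ ψ₀ : EuclideanSpace ℝ (Fin d) → ℂ, IsBump ψ₀ →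
      ∃ C : ℝ≥0, ∀ h : EuclideanSpace ℝ (Fin d) × ℝ → ℂ,
        AEStronglyMeasurable h (volume.prod (volume.restrict (Set.Ioi (1 : ℝ)))) →
        (∫⁻ y, ∫⁻ r in Set.Ioi (1 : ℝ), ‖h (y, r)‖ₑ ^ p * ENNReal.ofReal (r ^ (d - 1))) ≠ ⊤ →
        (∀ x, Integrable (fun q : EuclideanSpace ℝ (Fin d) × ℝ => h q * sphereBump ψ₀ q.1 q.2 x)
          (volume.prod (volume.restrict (Set.Ioi (1 : ℝ))))) ∧
        MemLp (fun x => ∫ y, ∫ r in Set.Ioi (1 : ℝ), h (y, r) * sphereBump ψ₀ y r x)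
          (ENNReal.ofReal p) volume ∧
        eLpNorm (fun x => ∫ y, ∫ r in Set.Ioi (1 : ℝ), h (y, r) * sphereBump ψ₀ y r x)
            (ENNReal.ofReal p) volume ≤
          C * (∫⁻ y, ∫⁻ r in Set.Ioi (1 : ℝ),
            ‖h (y, r)‖ₑ ^ p * ENNReal.ofReal (r ^ (d - 1))) ^ (1 / p)) ∧
    -- the estimate for radial multipliers supported in an annulus
    (1 ≤ p →
      ∃ C : ℝ≥0, ∀ m : EuclideanSpace ℝ (Fin d) → ℂ,
        Integrable m volume → IsRadial m →
        Function.support m ⊆ {ξ | 1 / 2 < ‖ξ‖ ∧ ‖ξ‖ < 2} →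
        MemLp (𝓕⁻ m) (ENNReal.ofReal p) volume →
        ∀ f : EuclideanSpace ℝ (Fin d) → ℂ, MemLp f (ENNReal.ofReal p) volume →
          ConvolutionExists (𝓕⁻ m) f (ContinuousLinearMap.mul ℝ ℂ) volume ∧
          MemLp (conv (𝓕⁻ m) f) (ENNReal.ofReal p) volume ∧
          eLpNorm (conv (𝓕⁻ m) f) (ENNReal.ofReal p) volume ≤
            C * eLpNorm (𝓕⁻ m) (ENNReal.ofReal p) volume *
              eLpNorm f (ENNReal.ofReal p) volume) := by
  have hd1 : 1 ≤ d := by omega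
  refine ⟨fun ψ₀ hψ => ?_, fun hp1 ψ₀ hψ => ?_, fun hp1 =>
    exists_eLpNorm_conv_fourierInv_le hd1 hp1 hp⟩
  · have hψ' := hψ.isOscillatingBump
    obtain ⟨K, hK⟩ := hψ'.exists_lintegral_tsum_rpow_le hd1 hp0 hp
    refine ⟨K ^ (1 / p), fun Y R hY hR hR1 γ hW => ?_⟩
    have he := isGridFamily_subtype hY hR hR1
    obtain ⟨hm, hle⟩ := hK _ (fun q : ↥(Y ×ˢ R) => γ q) he hW
    exact ⟨hψ'.summable_mul_sphereBump hd1 hp0 hp he hW,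
      memLp_and_eLpNorm_le_of_lintegral_le hp0 hm.aestronglyMeasurable hW hle⟩
  · have hψ' := hψ.isOscillatingBump
    obtain ⟨K, hK⟩ := hψ'.exists_lintegral_integral_rpow_le hd1 hp1 hp
    refine ⟨K ^ (1 / p), fun h hh hW => ?_⟩
    -- Tonelli for the weight, and Fubini below for the integral, translate between iterated
    -- integrals and the product measure.
    have hWeq := lintegral_prod (fun q : EuclideanSpace ℝ (Fin d) × ℝ =>
      ‖h q‖ₑ ^ p * ENNReal.ofReal (q.2 ^ (d - 1)))
      ((hh.enorm.pow_const p).mul (by fun_prop))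
    obtain ⟨hi, hm, hle⟩ := hK h hh (hWeq ▸ hW)
    have hint : ∀ x, ∫ y, ∫ r in Ioi (1 : ℝ), h (y, r) * sphereBump ψ₀ y r x
        = ∫ q, h q * sphereBump ψ₀ q.1 q.2 x ∂(prodMeasure d) := fun x =>
      (integral_prod _ (hi x)).symm
    simp only [hint]
    rw [hWeq] at hle
    exact ⟨hi, memLp_and_eLpNorm_le_of_lintegral_le hp0 hm hW hle⟩
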